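/- **Notation.** $SP$ and $OP$ are the sets of partitions with distinct parts and with odd parts; $\ell(\lambda)$ is the number of parts, $|\lambda|$ their sum, $\delta(\lambda)\in\{0,1\}$ the parity of $\ell(\lambda)$, $z_\mu=\prod_k k^{m_k}m_k!$ with $m_k$ the number of parts of $\mu$ equal to $k$. The times are $t=(t_1,t_3,t_5,\dots)$. For a partition $\lambda$, $Q_\lambda(t)=2^{-\ell(\lambda)/2}\operatorname{Pf}\big(P_{\lambda_i,\lambda_j}(t)\big)$, where one zero part is added if $\ell(\lambda)$ is odd and $$\sum_{n,m\ge 0}P_{n,m}z_1^nz_2^m=\Big[\exp\Big(2\sum_{k\text{ odd}}t_k(z_1^k+z_2^k)\Big)-1\Big]\frac{z_1-z_2}{z_1+z_2}.$$ A formal power series $\tau(t)$ solves $B$KP if $\oint e^{\sum_{j\text{ odd}}(t_j-t'_j)k^j}\,\tau(t-2[k^{-1}])\,\tau(t'+2[k^{-1}])\frac{dk}{2\pi i k}=\tau(t)\tau(t')$, where $t\pm2[k^{-1}]=(t_j\pm\tfrac{2}{j}k^{-j})_j$ and $\oint\frac{dk}{2\pi i}$ takes the coefficient of $k^{-1}$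 (the first exponential is expanded in $k$, the other factors in $k^{-1}$). It solves $\hbar$-$B$KP if $\tau(\hbar t)$ solves $B$KP. For $r:\mathbb Z\to R$ with $r(n)=r(1-n)$ and parameters $\beta=(\beta_1,\beta_3,\dots)$, the hypergeometric series is $\tau_{r,\beta}(t)=\sum_{\lambda\in SP}r_\lambda Q_\lambda(\beta/2)Q_\lambda(t/2)$, $r_\lambda=\prod_i\prod_{j=1}^{\lambda_i}r(j)$. For odd $k>0$ put $\mathbf p_k(\lambda)=\sum_i\lambda_i^k$ and $\mathbf p_k(n)=n^k-(n-1)^k$. **Statement.** All sums over $SP$ below are locally finite: for every monomial in $t$ only finitely many $Q_\lambda(t)$, $\lambda\in SP$, contain it. 1. Let $u=(u_1,u_3,\dots)$ be complex numbers such that $\sum_k u_kn^k$ converges absolutely for every $n\in\mathbb N$, and $\beta$ any complex parameters. Then $r(n)=\exp\big(\sum_k u_k\mathbf p_k(n)\big)$ satisfies $r(n)=r(1-n)$, the spin Hurwitz generating function is hypergeometric, $$\sum_{\lambda\in SP}\exp\Big(\sum_k u_k\mathbf p_k(\lambda)\Big)Q_\lambda(\beta/2)Q_\lambda(t/2)=\tau_{r,\beta}(t),$$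 and it solves $B$KP. 2. Conversely, for every $r:\mathbb Z\to\mathbb C\setminus\{0\}$ with $r(n)=r(1-n)$ there is such a $u$ with $r(n)=\exp\big(\sum_k u_k\mathbf p_k(n)\big)$ for all $n\in\mathbb Z$; hence for every $\beta$ the series $\tau_{r,\beta}$ is a generating function as in 1. 3. (Deformation rule $\mathbf p_k\to\hbar^{k-1}\mathbf p_k$, $\beta_k\to\beta_k/\hbar$, $t_k\to t_k/\hbar$.) Put $r^\hbar(n)=\exp\big(\sum_k u_k\hbar^{k-1}\mathbf p_k(n)\big)$. Then $r^\hbar(n)=r^\hbar(1-n)$, and $$\sum_{\lambda\in SP}\exp\Big(\sum_k u_k\hbar^{k-1}\mathbf p_k(\lambda)\Big)Q_\lambda\Big(\frac{\beta}{2\hbar}\Big)Q_\lambda\Big(\frac{t}{2\hbar}\Big)=\tau_{r^\hbar,\beta/\hbar}(t/\hbar)$$ solves $\hbar$-$B$KP. This holds for numerical $u$ as in 1 with $\hbar\in\mathbb C\setminus\{0\}$ and $\beta_k\in\mathbb C$, and also for formal variables $u_1,u_3,\dots$ with $\hbar$ any invertible element of a commutative $\mathbb C$-algebra $A$ (for example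 the variable of $\mathbb C[\hbar,\hbar^{-1}]$) and $\beta_k\in A[[u_1,u_3,\dots]]$. 4. Let $r>0$ be even and $\hbar$ an invertible element of a commutative $\mathbb C$-algebra. Define $\zeta^\lambda_\mu$ by $Q_\lambda=2^{-\delta(\lambda)/2}\sum_{\mu\in OP}\frac{\zeta^\lambda_\mu}{z_\mu}p_\mu$, where $p_k=kt_k$ and $p_\mu=\prod_ip_{\mu_i}$, put $\dim\lambda=\zeta^\lambda_{[1^{|\lambda|}]}$, and let $$h^{\bullet}_{g,\mu}=\sum_{\lambda\in SP,\ |\lambda|=|\mu|}\frac{\dim\lambda}{2^{\delta(\lambda)+|\lambda|}|\lambda|!}\,\frac{\zeta^\lambda_\mu}{z_\mu}\Big(\frac{\mathbf p_{r+1}(\lambda)}{(r+1)!}\Big)^b,\qquad 2g-2=br-\ell(\mu)-|\mu|,$$ be the disconnected spin Hurwitz numbers with completed $(r+1)$-cycles. Then, for a formal variable $u$, the partition function with $\hbar$ inserted according to the genus, taken at $p_k=kt_k/2$, is $$\sum_{\mu\in OP}\sum_{b\ge0}\hbar^{2g-2}h^{\bullet}_{g,\mu}\,p_\mu\frac{u^b}{b!}=\sum_{\lambda\in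 SP}\exp\Big(\hbar^ru\frac{\mathbf p_{r+1}(\lambda)}{(r+1)!}\Big)Q_\lambda\Big(\frac{\delta_{k,1}}{2\hbar}\Big)Q_\lambda\Big(\frac{t}{2\hbar}\Big).$$ It equals $\tau_{\rho,\beta}(t/\hbar)$ with $\rho(n)=\exp\big(\hbar^ru\,\mathbf p_{r+1}(n)/(r+1)!\big)=\rho(1-n)$ and $\beta_k=\delta_{k,1}/\hbar$, that is, it arises by the rule in 3, and it solves $\hbar$-$B$KP. -/

import Mathlib

open scoped Nat

noncomputable section

namespace SpinHurwitz

/-- Indices of the times: the odd positive integers. -/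
abbrev OddPos : Type := {k : ℕ // Odd k}

/-! ### Formal series -/

section Formal

variable {ι σ R : Type*} [CommRing R]

/-- The coefficientwise sum of a family of formal power series. It is used for families that are
locally finite: each coefficient is nonzero for only finitely many members. -/
def formalSum (f : ι → MvPowerSeries σ R) : MvPowerSeries σ R :=
  fun m => ∑ᶠ i, MvPowerSeries.coeff m (f i)

/-- `exp f` for a formal power series `f` without constant term. -/
def formalExp [Algebra ℂ R] (f : MvPowerSeries σ R) : MvPowerSeries σ R :=
  (PowerSeries.exp ℂ).subst f

end Formal

/-! ### Partitions -/

/-- Strict partitions (`SP`): all parts are different. -/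
abbrev StrictPartition : Type := {l : (n : ℕ) × n.Partition // l.2 ∈ Nat.Partition.distincts l.1}

/-- Odd partitions (`OP`): all parts are odd. -/
abbrev OddPartition : Type := {l : (n : ℕ) × n.Partition // l.2 ∈ Nat.Partition.odds l.1}

/-- The multiset of (nonzero) parts of a strict partition. -/
abbrev StrictPartition.parts (l : StrictPartition) : Multiset ℕ := l.1.2.parts

/-- The multiset of (nonzero) parts of an odd partition. -/
abbrev OddPartition.parts (l : OddPartition) : Multiset ℕ := l.1.2.parts

/-- `p_r(λ) = ∑ᵢ λᵢ ^ r`. -/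
def casimir (r : ℕ) (l : Multiset ℕ) : ℕ := (l.map (· ^ r)).sum

/-- `p_r(n) = n ^ r - (n - 1) ^ r`. -/
def boxCasimir (r : ℕ) (n : ℤ) : ℤ := n ^ r - (n - 1) ^ r

/-- `z_μ = ∏ₖ k ^ mₖ * mₖ !`, where `mₖ` is the number of parts equal to `k`. -/
def zFactor (l : Multiset ℕ) : ℕ := ∏ k ∈ l.toFinset, k ^ l.count k * (l.count k)!

/-- The exponent of the monomial `x_μ = ∏ᵢ x_{μᵢ}` for a partition `μ` with odd parts. -/
def partExponent (l : Multiset ℕ) : OddPos →₀ ℕ :=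
  (Multiset.toFinsupp l).comapDomain Subtype.val Subtype.val_injective.injOn

/-! ### `Q`-Schur polynomials -/

/-- `qₙ`, defined by `∑ₙ qₙ zⁿ = exp (2 ∑ₖ tₖ zᵏ)`, `k` odd. -/
def rowQ (n : ℕ) : MvPolynomial OddPos ℂ :=
  PowerSeries.coeff n (formalExp (R := MvPolynomial OddPos ℂ) (σ := Unit)
    (PowerSeries.mk fun k => if h : Odd k then 2 * MvPolynomial.X ⟨k, h⟩ else 0))

/-- The polynomials `P_{n,m}`, defined by
`∑ P_{n,m} z₁ⁿ z₂ᵐ = (exp (2 ∑ₖ tₖ (z₁ᵏ + z₂ᵏ)) - 1) * (z₁ - z₂) / (z₁ + z₂)`; see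
`pairP_generating`. -/
def pairP (n m : ℕ) : MvPolynomial OddPos ℂ :=
  if n = 0 ∧ m = 0 then 0
  else rowQ n * rowQ m + 2 * ∑ i ∈ Finset.Icc 1 m, (-1) ^ i * (rowQ (n + i) * rowQ (m - i))

theorem rowQ_series_mul_neg :
    (PowerSeries.mk rowQ) * PowerSeries.evalNegHom (PowerSeries.mk rowQ) = 1 := by
  set g : PowerSeries (MvPolynomial OddPos ℂ) :=
    PowerSeries.mk fun k => if h : Odd k then 2 * MvPolynomial.X ⟨k, h⟩ else 0 with hg
  have hF : PowerSeries.mk rowQ = (PowerSeries.exp ℂ).subst g := by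
    ext1 n; simp [rowQ, formalExp, hg]
  have hs : PowerSeries.HasSubst g := by
    apply PowerSeries.HasSubst.of_constantCoeff_zero'
    simp [hg]
  have hn : PowerSeries.evalNegHom ((PowerSeries.exp ℂ).subst g) =
      (PowerSeries.evalNegHom (PowerSeries.exp ℂ)).subst g := by
    have h1 : PowerSeries.rescale (-1 : MvPolynomial OddPos ℂ) g = -g := by
      ext1 n
      by_cases h : Odd n
      · simp [hg, PowerSeries.coeff_rescale, h]
      · simp [hg, PowerSeries.coeff_rescale, h]
    ext1 n
    simp only [PowerSeries.evalNegHom, PowerSeries.coeff_rescale]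
    rw [PowerSeries.coeff_subst' hs, PowerSeries.coeff_subst' hs,
      mul_finsum' _ _ (PowerSeries.coeff_subst_finite' hs _ n)]
    apply finsum_congr
    intro d
    rw [PowerSeries.coeff_rescale, mul_smul_comm, ← PowerSeries.coeff_rescale, map_pow, h1, neg_pow]
    rcases Nat.even_or_odd d with hd | hd <;> simp [hd.neg_one_pow]
  rw [hF, hn, ← PowerSeries.subst_mul hs, PowerSeries.exp_mul_exp_neg_eq_one]
  rw [← PowerSeries.coe_substAlgHom hs, map_one]

theorem rowQ_zero : rowQ 0 = 1 := by
  have hs : PowerSeries.HasSubst (PowerSeries.mk fun k =>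
      if h : Odd k then (2 * MvPolynomial.X ⟨k, h⟩ : MvPolynomial OddPos ℂ) else 0) := by
    apply PowerSeries.HasSubst.of_constantCoeff_zero'
    simp
  rw [rowQ, formalExp, PowerSeries.coeff_subst' hs, finsum_eq_single _ 0]
  · simp
  · intro d hd
    simp [hd]

theorem rowQ_alternating {n : ℕ} (hn : n ≠ 0) :
    ∑ i ∈ Finset.range (n + 1), (-1) ^ i * (rowQ i * rowQ (n - i)) = 0 := by
  have h := congrArg (PowerSeries.coeff n) rowQ_series_mul_neg
  rw [mul_comm, PowerSeries.coeff_mul, Finset.Nat.sum_antidiagonal_eq_sum_range_succ_mk] at h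
  simpa [PowerSeries.evalNegHom, PowerSeries.coeff_rescale, PowerSeries.coeff_one, hn,
    mul_assoc] using h

/-- The defining generating function identity of the `P_{n,m}`, multiplied by `z₁ + z₂` and
written coefficientwise: the coefficients of `z₁ⁿ⁺¹ z₂ᵐ⁺¹`, of `z₁ⁿ⁺¹` and of `z₂ᵐ⁺¹`. -/
theorem pairP_generating (n m : ℕ) :
    pairP n (m + 1) + pairP (n + 1) m = rowQ n * rowQ (m + 1) - rowQ (n + 1) * rowQ m ∧
      pairP n 0 = rowQ n * rowQ 0 - (if n = 0 then 1 else 0) ∧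
      pairP 0 m = -(rowQ 0 * rowQ m - (if m = 0 then 1 else 0)) := by
  refine ⟨?_, ?_, ?_⟩
  · have h : ∑ i ∈ Finset.Icc 1 (m + 1), (-1 : MvPolynomial OddPos ℂ) ^ i *
        (rowQ (n + i) * rowQ (m + 1 - i)) = -(rowQ (n + 1) * rowQ m) -
        ∑ i ∈ Finset.Icc 1 m, (-1) ^ i * (rowQ (n + 1 + i) * rowQ (m - i)) := by
      have e : Finset.Icc 1 (m + 1) = Finset.Ico 1 (m + 2) := by
        ext; simp only [Finset.mem_Icc, Finset.mem_Ico]; omega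
      have e' : Finset.Icc 1 m = Finset.Ico 1 (m + 1) := by
        ext; simp only [Finset.mem_Icc, Finset.mem_Ico]; omega
      rw [e, e', Finset.sum_eq_sum_Ico_succ_bot (by omega), Finset.sum_Ico_eq_sum_range,
        Finset.sum_Ico_eq_sum_range, sub_eq_add_neg, ← Finset.sum_neg_distrib]
      congr 1
      · simp
      · refine Finset.sum_congr (by congr 1) fun i _ => ?_
        rw [show n + (1 + 1 + i) = n + 1 + (1 + i) by ring,
          show m + 1 - (1 + 1 + i) = m - (1 + i) by omega]
        ring
    simp only [pairP, h]
    simp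
    ring
  · by_cases h : n = 0 <;> simp [pairP, h, rowQ_zero]
  · by_cases h : m = 0
    · simp [pairP, h, rowQ_zero]
    · have h2 := rowQ_alternating h
      rw [Finset.range_eq_Ico, Finset.sum_eq_sum_Ico_succ_bot (by omega)] at h2
      have h3 : Finset.Ico (0 + 1) (m + 1) = Finset.Icc 1 m := by
        ext; simp only [Finset.mem_Icc, Finset.mem_Ico]; omega
      rw [h3] at h2
      simp only [pairP, h, rowQ_zero] at h2 ⊢
      simp at h2 ⊢
      linear_combination 2 * h2

/-- The Pfaffian of the antisymmetric matrix whose entries above the diagonal are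
`a (l i) (l j)`, `i < j`, by expansion along the first row. -/
def pfaffian {R : Type*} [CommRing R] (a : ℕ → ℕ → R) : List ℕ → R
  | [] => 1
  | x :: l => ∑ i : Fin l.length, (-1) ^ (i : ℕ) * a x (l.get i) * pfaffian a (l.eraseIdx i)
  termination_by l => l.length
  decreasing_by
    have := i.isLt
    simp [List.length_eraseIdx]

/-- The parts in decreasing order, with one zero line added if their number is odd. -/
def evenRows (l : Multiset ℕ) : List ℕ :=
  if Even (Multiset.card l) then l.sort (· ≥ ·) else l.sort (· ≥ ·) ++ [0]

/-- The `Q`-Schur polynomial `Q_λ(t) = 2 ^ (-ℓ(λ) / 2) Pf (P_{λᵢ,λⱼ}(t))`. -/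
def schurQ (l : Multiset ℕ) : MvPolynomial OddPos ℂ :=
  MvPolynomial.C (((Real.sqrt 2 : ℝ) : ℂ) ^ Multiset.card l)⁻¹ * pfaffian pairP (evenRows l)

/-- The value of `Q_λ` at times `c`. -/
def schurQAt {R : Type*} [CommRing R] [Algebra ℂ R] (l : Multiset ℕ) (c : OddPos → R) : R :=
  MvPolynomial.aeval c (schurQ l)

/-! ### The `BKP` hierarchy -/

section BKP

variable {R : Type*} [CommRing R] [Algebra ℂ R]

/-- Two sets of times `t` (left) and `t'` (right). -/
abbrev TwoTimes : Type := OddPos ⊕ OddPos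

/-- The coefficient of `zⁿ`, as a series in `t, t'`, of a series in `t, t'` and one more
variable `z`, the index `none`. -/
def spectralCoeff (n : ℕ) (f : MvPowerSeries (Option TwoTimes) R) : MvPowerSeries TwoTimes R :=
  fun m => MvPowerSeries.coeff
    (m.embDomain Function.Embedding.some + Finsupp.single none n) f

/-- `exp ξ(t - t', k)`, `ξ(t, k) = ∑ⱼ tⱼ kʲ`, expanded in powers of `k`. -/
def expXi : MvPowerSeries (Option TwoTimes) R :=
  formalExp (formalSum fun j : OddPos =>
    (MvPowerSeries.X (some (Sum.inl j)) - MvPowerSeries.X (some (Sum.inr j))) *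
      MvPowerSeries.X none ^ (j : ℕ))

/-- `τ(t - 2[k⁻¹]) τ(t' + 2[k⁻¹])`, expanded in powers of `k⁻¹`, where
`t ± 2[k⁻¹] = (tⱼ ± 2 k⁻ʲ / j)ⱼ`. -/
def shiftedProduct (τ : MvPowerSeries OddPos R) : MvPowerSeries (Option TwoTimes) R :=
  τ.subst (fun j : OddPos => (MvPowerSeries.X (some (Sum.inl j)) -
      (2 / (j : ℂ)) • MvPowerSeries.X none ^ (j : ℕ) : MvPowerSeries (Option TwoTimes) R)) *
  τ.subst (fun j : OddPos => (MvPowerSeries.X (some (Sum.inr j)) +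
      (2 / (j : ℂ)) • MvPowerSeries.X none ^ (j : ℕ) : MvPowerSeries (Option TwoTimes) R))

/-- The `BKP` hierarchy in Hirota bilinear form:
`∮ exp ξ(t - t', k) τ(t - 2[k⁻¹]) τ(t' + 2[k⁻¹]) dk / (2πi k) = τ(t) τ(t')`, that is, the
coefficient of `k⁰` in the product of the first two factors is `τ(t) τ(t')`. -/
def IsBKP (τ : MvPowerSeries OddPos R) : Prop :=
  formalSum (fun n : ℕ => spectralCoeff n expXi * spectralCoeff n (shiftedProduct τ)) =
    (τ.subst (fun j : OddPos => (MvPowerSeries.X (Sum.inl j) : MvPowerSeries TwoTimes R))) *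
    (τ.subst (fun j : OddPos => (MvPowerSeries.X (Sum.inr j) : MvPowerSeries TwoTimes R)))

/-- `τ(t / ħ)`. -/
def timesOver (ħ : Rˣ) (τ : MvPowerSeries OddPos R) : MvPowerSeries OddPos R :=
  MvPowerSeries.rescale (fun _ => ((ħ⁻¹ : Rˣ) : R)) τ

/-- The `ħ`-`BKP` hierarchy is the `BKP` hierarchy in the variables `t / ħ`: a series `τ(t)`
solves it if and only if `τ(ħ t)` solves `BKP`. -/
def IsHbarBKP (ħ : Rˣ) (τ : MvPowerSeries OddPos R) : Prop :=
  IsBKP (MvPowerSeries.rescale (fun _ => (ħ : R)) τ)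

/-! ### Hypergeometric `τ`-functions -/

/-- `∑_{λ ∈ SP} w(λ) Q_λ(β / 2ħ) Q_λ(t / 2ħ)`. -/
def weightedQSeries (ħ : Rˣ) (w : StrictPartition → R) (β : OddPos → R) :
    MvPowerSeries OddPos R :=
  formalSum fun l : StrictPartition =>
    MvPowerSeries.C (w l * schurQAt l.parts fun k => (1 / 2 : ℂ) • (((ħ⁻¹ : Rˣ) : R) * β k)) *
      schurQAt l.parts fun k =>
        (1 / 2 : ℂ) • (MvPowerSeries.C ((ħ⁻¹ : Rˣ) : R) * MvPowerSeries.X k)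

/-- `r_λ = ∏_{w ∈ λ} r(c(w))`, where the content of the `j`-th box of every row is `j`. -/
def contentProduct (r : ℤ → R) (l : Multiset ℕ) : R :=
  (l.map fun m => ∏ j ∈ Finset.Icc 1 m, r (j : ℤ)).prod

/-- The hypergeometric series `∑_{λ ∈ SP} r_λ Q_λ(β / 2) Q_λ(t / 2)`. -/
def hypergeometricTau (r : ℤ → R) (β : OddPos → R) : MvPowerSeries OddPos R :=
  weightedQSeries 1 (fun l => contentProduct r l.parts) β

/-- The hypergeometric series with `r`, `β_k → β_k / ħ` and `t_k → t_k / ħ`. -/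
def scaledHypergeometricTau (ħ : Rˣ) (r : ℤ → R) (β : OddPos → R) : MvPowerSeries OddPos R :=
  timesOver ħ (hypergeometricTau r fun k => ((ħ⁻¹ : Rˣ) : R) * β k)

/-- The times `δ_{k,1}`. -/
def deltaTimes : OddPos → R := fun k => if (k : ℕ) = 1 then 1 else 0

end BKP

/-! ### Exponential weights -/

/-- `exp (∑_k u_k c_k)` for numbers `u_k`, `k` odd. -/
def numExp (u c : OddPos → ℂ) : ℂ := Complex.exp (∑' k, u k * c k)

/-- `exp (∑_k u_k c_k)` for formal variables `u_k`, `k` odd, and coefficients `c_k` in `A`. -/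
def varExp {A : Type*} [CommRing A] [Algebra ℂ A] (c : OddPos → A) : MvPowerSeries OddPos A :=
  formalExp (formalSum fun k : OddPos => MvPowerSeries.C (c k) * MvPowerSeries.X k)

/-- `exp (u c)` for one formal variable `u` and a coefficient `c` in `A`. -/
def oneVarExp {A : Type*} [CommRing A] [Algebra ℂ A] (c : A) : PowerSeries A :=
  formalExp (σ := Unit) (PowerSeries.C c * PowerSeries.X)

/-- A unit of `A` as a constant power series. -/
def constUnit {A : Type*} [CommRing A] (σ : Type*) (ħ : Aˣ) : (MvPowerSeries σ A)ˣ :=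
  Units.map (MvPowerSeries.C : A →+* MvPowerSeries σ A).toMonoidHom ħ

/-- `exp (∑_k u_k ħ^{k-1} p_k(λ))`, numerical `u_k`. -/
def numWeight (u : OddPos → ℂ) (ħ : ℂ) (l : Multiset ℕ) : ℂ :=
  numExp u fun k => ħ ^ ((k : ℕ) - 1) * (casimir k l : ℂ)

/-- `exp (∑_k u_k ħ^{k-1} p_k(n))`, numerical `u_k`. -/
def numBox (u : OddPos → ℂ) (ħ : ℂ) (n : ℤ) : ℂ :=
  numExp u fun k => ħ ^ ((k : ℕ) - 1) * (boxCasimir k n : ℂ)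

section Weights

variable {A : Type*} [CommRing A] [Algebra ℂ A]

/-- `exp (∑_k u_k ħ^{k-1} p_k(λ))`, formal variables `u_k`. -/
def varWeight (ħ : A) (l : Multiset ℕ) : MvPowerSeries OddPos A :=
  varExp fun k => ħ ^ ((k : ℕ) - 1) * (casimir k l : A)

/-- `exp (∑_k u_k ħ^{k-1} p_k(n))`, formal variables `u_k`. -/
def varBox (ħ : A) (n : ℤ) : MvPowerSeries OddPos A :=
  varExp fun k => ħ ^ ((k : ℕ) - 1) * (boxCasimir k n : A)

/-- `exp (ħ^r u p_{r+1}(λ) / (r+1)!)`, one formal variable `u`. -/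
def cycleWeight (r : ℕ) (ħ : A) (l : Multiset ℕ) : PowerSeries A :=
  oneVarExp (ħ ^ r * algebraMap ℂ A ((casimir (r + 1) l : ℂ) / ((r + 1)! : ℂ)))

/-- `exp (ħ^r u p_{r+1}(n) / (r+1)!)`, one formal variable `u`. -/
def cycleBox (r : ℕ) (ħ : A) (n : ℤ) : PowerSeries A :=
  oneVarExp (ħ ^ r * algebraMap ℂ A ((boxCasimir (r + 1) n : ℂ) / ((r + 1)! : ℂ)))

end Weights

/-! ### Spin Hurwitz numbers with completed cycles -/

/-- The characters `ζ_μ^λ` of the Sergeev group, given by the Frobenius-type formula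
`Q_λ = 2 ^ (-δ(λ) / 2) ∑_{μ ∈ OP} ζ_μ^λ p_μ / z_μ`, `p_k = k t_k`, where `δ(λ)` is the parity
of `ℓ(λ)`: here `ζ_μ^λ` is read off from the coefficient of `p_μ` in `Q_λ`. -/
def sergeevChar (l μ : Multiset ℕ) : ℂ :=
  ((Real.sqrt 2 : ℝ) : ℂ) ^ (Multiset.card l % 2) * (zFactor μ : ℂ) *
    MvPolynomial.coeff (partExponent μ)
      (schurQAt l fun k : OddPos =>
        (MvPolynomial.C ((k : ℂ)⁻¹) * MvPolynomial.X k : MvPolynomial OddPos ℂ))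

/-- `dim λ = ζ^λ_{[1^{|λ|}]}`. -/
def sergeevDim (l : Multiset ℕ) : ℂ := sergeevChar l (Multiset.replicate l.sum 1)

/-- The disconnected spin Hurwitz number with `b` completed `(r+1)`-cycles and ramification `μ`:
`∑_{λ ∈ SP, |λ| = |μ|} dim λ / (2 ^ (δ(λ) + |λ|) |λ|!) * ζ_μ^λ / z_μ * (p_{r+1}(λ) / (r+1)!)^b`.
The genus `g` of the covering is determined by `2g - 2 = b r - ℓ(μ) - |μ|`. -/
def spinHurwitz (r b : ℕ) {n : ℕ} (μ : n.Partition) : ℂ :=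
  ∑ l ∈ Nat.Partition.distincts n,
    sergeevDim l.parts / ((2 : ℂ) ^ (Multiset.card l.parts % 2 + n) * (n ! : ℂ)) *
      (sergeevChar l.parts μ.parts / (zFactor μ.parts : ℂ)) *
      ((casimir (r + 1) l.parts : ℂ) / ((r + 1)! : ℂ)) ^ b

section Genus

variable {A : Type*} [CommRing A] [Algebra ℂ A]

/-- The power sum variable `p_k = k t_k` after the rescaling `t_k → t_k / 2` (`k` odd). -/
def powerSumVar (R : Type*) [CommRing R] [Algebra ℂ R] (k : ℕ) : MvPowerSeries OddPos R :=
  if h : Odd k then ((k : ℂ) / 2) • MvPowerSeries.X ⟨k, h⟩ else 0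

/-- `∑_{μ ∈ OP} ∑_b ħ^{2g - 2} h_{g,μ} p_μ u^b / b!` with `2g - 2 = b r - ℓ(μ) - |μ|`, a series
in the times with coefficients in `A⟦u⟧`. -/
def genusPartitionFunction (r : ℕ) (ħ : Aˣ) : MvPowerSeries OddPos (PowerSeries A) :=
  formalSum fun μ : OddPartition =>
    MvPowerSeries.C (PowerSeries.mk fun b : ℕ =>
      ((ħ ^ ((b * r : ℤ) - Multiset.card μ.parts - μ.1.1) : Aˣ) : A) *
        algebraMap ℂ A (spinHurwitz r b μ.1.2 / (b ! : ℂ))) *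
    (μ.parts.map (powerSumVar (PowerSeries A))).prod

end Genus

end SpinHurwitz

end

/-! Write c = t/2 and c' = t'/2. A hypergeometric series is a sum over the finite sets E of natural
numbers of even size (the rows of λ, padded by 0 when their number is odd) of Pf(A_E) Pf(P_E(c)).
The weights r_λ, the parameters β and the two normalisations 2^{-ℓ/2} are absorbed into one
antisymmetric matrix A by a diagonal rescaling (`pfaffianOn_coeffMatrix`). That every such sum
solves BKP is pure Pfaffian algebra.

With z = k⁻¹ the residue becomes the linear functional zⁿ ↦ q_n(c - c') on polynomials in z, and the
shifted times become c - [z] and c' - [-z], where [z] = (z^k/k)_k. The shift changes the matrix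
P_{n,m} by rank two (`pairPAt_shift`), so a shifted Pfaffian is linear in the shifted q_n
(`pfaffianOn_pairPAt_shift`), and the functional is needed only on products of two shifted q's
(`monomialFunctional_rowQAt_mul`). The result for the pair Q_E, Q_F is their product plus twice a
signed sum over the ways to move one row between E∆{0} and F∆{0} (`monomialFunctional_pfaffianOn`).
Summed against Pf(A_E) Pf(A_F) and reindexed so that the row moves between the minors of A instead,
these extra terms become Plücker relations for A and vanish (`sum_exchange_eq_zero`).

Since Q_λ is homogeneous of weight |λ|, restricting the rows to 0, …, W gives a polynomial which
agrees with the series up to weight W and is itself an exact solution; `isBKP_of_truncations` passes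
from these polynomials to the series.

For the weights, p_k(λ) is additive over rows and telescopes along each row, so exponentials of the
p_k are content products (`contentProduct_eq_of_succ`). Conversely, given a nonvanishing r, the
partial sums of log r(i) are interpolated at the natural numbers by an odd entire function
(`exists_odd_hasSum`), whose Taylor coefficients are the u_k. The parameter ħ only rescales the
times. For completed cycles the coefficients are compared: the times δ_{k,1} select the coefficient
of t_1^{|λ|}, which is dim λ up to explicit factors, and the exponent of 1/(2ħ) is |μ| + ℓ(μ), as
the genus formula demands. -/

namespace SpinHurwitz

/-! ### Alternating deletion sums and Pfaffians of lists -/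

section AltSum

variable {ι R : Type*} [CommRing R]

/-- `∑ᵢ (-1) ^ i * f lᵢ (l with its entry lᵢ deleted)`. -/
def altSum : List ι → (ι → List ι → R) → R
  | [], _ => 0
  | x :: l, f => f x l - altSum l fun y m => f y (x :: m)

@[simp] theorem altSum_nil (f : ι → List ι → R) : altSum [] f = 0 := rfl

@[simp] theorem altSum_cons (x : ι) (l : List ι) (f : ι → List ι → R) :
    altSum (x :: l) f = f x l - altSum l fun y m => f y (x :: m) := rfl

theorem altSum_congr_perm {l : List ι} {f g : ι → List ι → R}
    (h : ∀ x m, (x :: m).Perm l → f x m = g x m) : altSum l f = altSum l g := by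
  induction l generalizing f g with
  | nil => rfl
  | cons x l ih =>
    rw [altSum_cons, altSum_cons, h x l (List.Perm.refl _)]
    congr 1
    exact ih fun y m hm => h y (x :: m) ((List.Perm.swap x y m).trans (hm.cons x))

theorem altSum_congr {l : List ι} {f g : ι → List ι → R}
    (h : ∀ x m, x ∈ l → m ⊆ l → m.length + 1 = l.length → f x m = g x m) :
    altSum l f = altSum l g :=
  altSum_congr_perm fun x m hm => h x m (hm.subset (by simp))
    (fun _ hy => hm.subset (List.mem_cons_of_mem x hy)) (by rw [← hm.length_eq, List.length_cons])

theorem altSum_add (l : List ι) (f g : ι → List ι → R) :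
    altSum l (fun x m => f x m + g x m) = altSum l f + altSum l g := by
  induction l generalizing f g with
  | nil => simp
  | cons x l ih => simp only [altSum_cons, ih]; ring

theorem altSum_mul_left (c : R) (l : List ι) (f : ι → List ι → R) :
    altSum l (fun x m => c * f x m) = c * altSum l f := by
  induction l generalizing f with
  | nil => simp
  | cons x l ih => simp only [altSum_cons, ih]; ring

theorem altSum_neg (l : List ι) (f : ι → List ι → R) :
    altSum l (fun x m => -f x m) = -altSum l f := by
  simpa using altSum_mul_left (-1) l f

theorem altSum_sub (l : List ι) (f g : ι → List ι → R) :
    altSum l (fun x m => f x m - g x m) = altSum l f - altSum l g := by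
  simp only [sub_eq_add_neg, altSum_add, altSum_neg]

theorem altSum_mul_right (c : R) (l : List ι) (f : ι → List ι → R) :
    altSum l (fun x m => f x m * c) = altSum l f * c := by
  simp only [mul_comm _ c, altSum_mul_left]

theorem map_altSum {S F : Type*} [CommRing S] [FunLike F R S] [AddMonoidHomClass F R S] (g : F)
    (l : List ι) (f : ι → List ι → R) :
    g (altSum l f) = altSum l fun x m => g (f x m) := by
  induction l generalizing f with
  | nil => simp
  | cons x l ih => simp [ih]

theorem altSum_zero (l : List ι) : altSum l (fun _ _ => (0 : R)) = 0 := by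
  induction l with
  | nil => rfl
  | cons x l ih => simp [ih]

/-- Two alternating deletion sums over different lists commute. -/
theorem altSum_comm {κ : Type*} (l : List ι) (l' : List κ)
    (f : ι → List ι → κ → List κ → R) :
    altSum l (fun x m => altSum l' fun y m' => f x m y m') =
      altSum l' fun y m' => altSum l fun x m => f x m y m' := by
  induction l generalizing f with
  | nil => simp [altSum_zero]
  | cons x l ih => simp only [altSum_cons, altSum_sub, ih]

/-- Of two entries deleted one after the other, the later one in the list has its position lowered
by one exactly when it is deleted second; hence the sign. -/
theorem altSum_swap (l : List ι) (f : ι → ι → List ι → R) :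
    altSum l (fun x m => altSum m fun y m' => f x y m') =
      -altSum l fun x m => altSum m fun y m' => f y x m' := by
  induction l generalizing f with
  | nil => simp
  | cons a l ih =>
    simp only [altSum_cons, altSum_sub]
    rw [ih fun x y m' => f x y (a :: m')]
    ring

/-- `altSum_swap` would only show that twice the sum is zero, and 2 may be a zero divisor here. The
induction cancels the two orders of deletion directly. -/
theorem altSum_altSum_eq_zero (l : List ι) (f : ι → ι → List ι → R)
    (h : ∀ x y m, f x y m = f y x m) :
    altSum l (fun x m => altSum m fun y m' => f x y m') = 0 := by
  induction l generalizing f with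
  | nil => simp
  | cons a l ih =>
    simp only [altSum_cons, altSum_sub]
    rw [ih (fun x y m' => f x y (a :: m')) fun _ _ _ => h _ _ _]
    simp only [h a]
    ring

theorem altSum_append (l l' : List ι) (f : ι → List ι → R) :
    altSum (l ++ l') f = altSum l (fun x m => f x (m ++ l')) +
      (-1) ^ l.length * altSum l' fun x m => f x (l ++ m) := by
  induction l generalizing f with
  | nil => simp
  | cons a l ih =>
    simp only [List.cons_append, altSum_cons, ih, List.length_cons, pow_succ]
    ring

theorem altSum_eq_sum (l : List ι) (f : ι → List ι → R) :
    altSum l f = ∑ i : Fin l.length, (-1) ^ (i : ℕ) * f (l.get i) (l.eraseIdx i) := by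
  induction l generalizing f with
  | nil => simp
  | cons x l ih =>
    rw [altSum_cons, ih]
    simp [Fin.sum_univ_succ, pow_succ, sub_eq_add_neg]

end AltSum

/-! ### Pfaffians of lists: row exchange, Plücker relations, rank-two perturbations. -/

section Pfaffian

variable {R : Type*} [CommRing R] (a : ℕ → ℕ → R)

@[simp] theorem pfaffian_nil : pfaffian a [] = 1 := by
  rw [pfaffian]

theorem pfaffian_cons (x : ℕ) (l : List ℕ) :
    pfaffian a (x :: l) = altSum l fun y m => a x y * pfaffian a m := by
  rw [pfaffian, altSum_eq_sum]
  exact Finset.sum_congr rfl fun i _ => by ring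

theorem map_pfaffian {S F : Type*} [CommRing S] [FunLike F R S] [RingHomClass F R S] (g : F)
    (l : List ℕ) : g (pfaffian a l) = pfaffian (fun n m => g (a n m)) l := by
  induction h : l.length using Nat.strong_induction_on generalizing l with
  | _ k ih =>
    subst h
    cases l with
    | nil => simp
    | cons x l =>
      rw [pfaffian_cons, pfaffian_cons, map_altSum]
      refine altSum_congr fun y m _ _ hm => ?_
      rw [map_mul, ih m.length (by simp; omega) m rfl]

theorem pfaffian_congr {a b : ℕ → ℕ → R} {l : List ℕ}
    (h : ∀ x ∈ l, ∀ y ∈ l, a x y = b x y) : pfaffian a l = pfaffian b l := by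
  induction hk : l.length using Nat.strong_induction_on generalizing l with
  | _ k ih =>
    subst hk
    cases l with
    | nil => simp
    | cons x l =>
      rw [pfaffian_cons, pfaffian_cons]
      refine altSum_congr fun y m hy hml hm => ?_
      rw [h x (by simp) y (by simp [hy]), ih m.length (by simp; omega)
        (fun x hx y hy => h x (by simp [hml hx]) y (by simp [hml hy])) rfl]

theorem pfaffian_of_odd {l : List ℕ} (hl : Odd l.length) : pfaffian a l = 0 := by
  induction hk : l.length using Nat.strong_induction_on generalizing l with
  | _ k ih =>
    subst hk
    cases l with
    | nil => simp at hl
    | cons x l =>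
      rw [pfaffian_cons, ← altSum_zero l]
      refine altSum_congr fun y m hy hml hm => ?_
      rw [ih m.length (by simp; omega) ?_ rfl, mul_zero]
      rw [List.length_cons, ← hm] at hl
      grind

variable {a}

section Alternating

variable (hd : ∀ n, a n n = 0) (ha : ∀ n m, a m n = -a n m)
include ha

/-- Expand along both rows: the entry a x y changes sign by antisymmetry, and the remaining double
deletion sum changes sign by `altSum_swap`. -/
theorem pfaffian_cons_cons_swap (x y : ℕ) (l : List ℕ) :
    pfaffian a (x :: y :: l) = -pfaffian a (y :: x :: l) := by
  simp only [pfaffian_cons, altSum_cons, ← altSum_mul_left]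
  rw [altSum_swap l, ha x y]
  simp only [mul_left_comm (a x _)]
  ring

theorem pfaffian_swap (p : List ℕ) (x y : ℕ) (l : List ℕ) :
    pfaffian a (p ++ x :: y :: l) = -pfaffian a (p ++ y :: x :: l) := by
  induction hk : p.length using Nat.strong_induction_on generalizing p l with
  | _ k ih =>
    subst hk
    cases p with
    | nil => exact pfaffian_cons_cons_swap ha x y l
    | cons z p =>
      simp only [List.cons_append, pfaffian_cons, altSum_append, altSum_cons]
      rw [altSum_congr (l := p) (g := fun y' m => -(a z y' * pfaffian a (m ++ y :: x :: l)))
          fun w m _ _ hm => by rw [ih m.length (by simp; omega) m l rfl]; ring,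
        altSum_congr (l := l) (g := fun y' m => -(a z y' * pfaffian a (p ++ y :: x :: m)))
          fun w m _ _ hm => by rw [ih p.length (by simp) p m rfl]; ring, altSum_neg, altSum_neg]
      ring

theorem pfaffian_move (p q l : List ℕ) (x : ℕ) :
    pfaffian a (p ++ x :: (q ++ l)) = (-1) ^ q.length * pfaffian a (p ++ (q ++ x :: l)) := by
  induction q generalizing p with
  | nil => simp
  | cons y q ih =>
    have h := ih (p ++ [y])
    simp only [List.append_assoc, List.cons_append, List.nil_append] at h
    rw [List.cons_append, pfaffian_swap ha, h, List.length_cons, pow_succ]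
    simp

-- Once the two equal rows are adjacent, expanding along both gives a double deletion sum of a
-- symmetric function. The zero diagonal is a separate hypothesis because 2 need not be cancellable.
include hd in
theorem pfaffian_of_dup (x : ℕ) (q l : List ℕ) : pfaffian a (x :: (q ++ x :: l)) = 0 := by
  have h : pfaffian a (x :: x :: (q ++ l)) = 0 := by
    simp only [pfaffian_cons, altSum_cons, hd, ← altSum_mul_left, zero_mul, zero_sub, neg_eq_zero]
    exact altSum_altSum_eq_zero _ (fun y z m => a x y * (a x z * pfaffian a m))
      fun _ _ _ => mul_left_comm _ _ _
  have h2 := pfaffian_move ha [x] q l x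
  simp only [List.cons_append, List.nil_append] at h2
  rw [h] at h2
  rcases neg_one_pow_eq_or R q.length with h3 | h3 <;> rw [h3] at h2 <;> simpa using h2.symm

/-- The Pfaffian form of the Plücker relations. -/
theorem pfaffian_pluecker (l l' : List ℕ) :
    altSum l' (fun y m => pfaffian a (y :: l) * pfaffian a m) +
      altSum l (fun x m => pfaffian a m * pfaffian a (x :: l')) = 0 := by
  simp only [pfaffian_cons, ← altSum_mul_left, ← altSum_mul_right]
  -- With all first rows expanded, both sums run over pairs (x from l, y from l') and differ only in
  -- a y x against a x y, so they cancel term by term.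
  rw [altSum_comm, ← altSum_add, ← altSum_zero l]
  congr 1; ext x m
  rw [← altSum_add, ← altSum_zero l']
  congr 1; ext y m'
  rw [ha y x]
  ring

end Alternating

/-- A perturbation of rank two of a Pfaffian. -/
theorem pfaffian_add_rank_two (a : ℕ → ℕ → R) (u w : ℕ → R) (l : List ℕ) :
    pfaffian (fun n m => a n m + w n * u m - u n * w m) l =
      pfaffian a l +
        altSum l fun n m => w n * altSum m fun k m' => u k * pfaffian a m' := by
  induction hk : l.length using Nat.strong_induction_on generalizing l with
  | _ k ih =>
    subst hk
    cases l with
    | nil => simp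
    | cons x l =>
      rw [pfaffian_cons, altSum_congr (g := fun y m => a x y * pfaffian a m +
          w x * (u y * pfaffian a m) - u x * (w y * pfaffian a m) +
          altSum m (fun n m' => altSum m' fun k m'' => a x y * (w n * (u k * pfaffian a m''))) +
          w x * altSum m (fun n m' => altSum m' fun k m'' => u y * (w n * (u k * pfaffian a m'')))
          - u x * altSum m (fun n m' => altSum m' fun k m'' =>
            w y * (w n * (u k * pfaffian a m''))))]
      -- Of the triple deletion sums, those with u twice or w twice are symmetric in two of the
      -- deleted entries and vanish.
      · have e1 : altSum l (fun y m => altSum m fun n m' => altSum m' fun k m'' =>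
            u y * (w n * (u k * pfaffian a m''))) = 0 := by
          rw [← neg_eq_zero, ← altSum_neg, ← altSum_zero l]
          have : ∀ y m, -altSum m (fun n m' => altSum m' fun k m'' =>
              u y * (w n * (u k * pfaffian a m''))) = altSum m (fun k m' => altSum m' fun n m'' =>
              u y * (w n * (u k * pfaffian a m''))) := fun y m => by
            rw [altSum_swap, neg_neg]
          simp only [this]
          rw [altSum_zero]
          exact altSum_altSum_eq_zero l (fun y k m => altSum m fun n m'' =>
            u y * (w n * (u k * pfaffian a m''))) fun y k m => by
              congr 1; ext; ring
        have e2 : altSum l (fun y m => altSum m fun n m' => altSum m' fun k m'' =>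
            w y * (w n * (u k * pfaffian a m''))) = 0 :=
          altSum_altSum_eq_zero l (fun y n m => altSum m fun k m'' =>
            w y * (w n * (u k * pfaffian a m''))) fun y k m => by
              congr 1; ext; ring
        -- Two transpositions move the deletion of y to the innermost place, where it rebuilds the
        -- expansion of a Pfaffian with first row x.
        have e3 : altSum l (fun y m => altSum m fun n m' => altSum m' fun k m'' =>
            a x y * (w n * (u k * pfaffian a m''))) =
            altSum l (fun n m => altSum m fun k m' => altSum m' fun y m'' =>
            a x y * (w n * (u k * pfaffian a m''))) := by
          rw [altSum_swap l (fun y n m' => altSum m' fun k m'' =>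
            a x y * (w n * (u k * pfaffian a m''))), ← altSum_neg]
          congr 1; ext n m
          rw [altSum_swap m (fun y k m'' => a x y * (w n * (u k * pfaffian a m''))), neg_neg]
        simp only [altSum_add, altSum_sub, altSum_mul_left, altSum_cons, pfaffian_cons,
          mul_sub] at e1 e2 e3 ⊢
        rw [e1, e2, e3]
        simp only [← altSum_mul_left, mul_left_comm (a x _)]
        ring_nf
      · intro y m _ _ hm
        rw [ih m.length (by simp; omega) m rfl]
        simp only [altSum_mul_left]
        ring

end Pfaffian

end SpinHurwitz

namespace SpinHurwitz

/-! ### Pfaffians indexed by finite sets -/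

section FinsetPfaffian

open scoped symmDiff

variable {R : Type*} [CommRing R]

/-- The Pfaffian of the minor with rows in `S`, in decreasing order. -/
noncomputable def pfaffianOn (a : ℕ → ℕ → R) (S : Finset ℕ) : R := pfaffian a (S.sort (· ≥ ·))

/-- The sign of the position of `n` in the decreasing enumeration of `S`. -/
def posSign (R : Type*) [CommRing R] (n : ℕ) (S : Finset ℕ) : R := (-1) ^ (S.filter (n < ·)).card

theorem sort_insert_max {x : ℕ} {S : Finset ℕ} (h : ∀ y ∈ S, y < x) :
    (insert x S).sort (· ≥ ·) = x :: S.sort (· ≥ ·) :=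
  Finset.sort_insert _ (fun y hy => (h y hy).le) fun hx => (h x hx).false

theorem altSum_sort (S : Finset ℕ) (f : ℕ → List ℕ → R) :
    altSum (S.sort (· ≥ ·)) f =
      ∑ n ∈ S, posSign R n S * f n ((S.erase n).sort (· ≥ ·)) := by
  induction S using Finset.induction_on_max generalizing f with
  | empty => simp
  | insert x S hx ih =>
    have hxS : x ∉ S := fun h => (hx x h).false
    rw [sort_insert_max hx, altSum_cons, ih, Finset.sum_insert hxS, Finset.erase_insert hxS,
      sub_eq_add_neg, ← Finset.sum_neg_distrib]
    congr 1
    · rw [posSign, Finset.filter_eq_empty_iff.2]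
      · simp
      · intro y hy
        rcases Finset.mem_insert.1 hy with rfl | hy
        · exact lt_irrefl _
        · exact (hx y hy).not_gt
    · refine Finset.sum_congr rfl fun n hn => ?_
      have hnx : x ≠ n := fun h => hxS (h ▸ hn)
      rw [Finset.erase_insert_of_ne hnx,
        sort_insert_max fun y hy => hx y (Finset.mem_of_mem_erase hy), posSign, posSign,
        Finset.filter_insert, if_pos (hx n hn), Finset.card_insert_of_notMem (by simp [hxS]),
        pow_succ]
      ring

variable {a b : ℕ → ℕ → R}

/-- Row n is sorted into place past the larger elements of S, one sign for each. The prefix p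
collects the maxima already passed, so that the induction on the maximum applies. -/
theorem pfaffian_append_cons_sort (ha : ∀ n m, a m n = -a n m) {n : ℕ} {S : Finset ℕ}
    (hn : n ∉ S) (p : List ℕ) :
    pfaffian a (p ++ n :: S.sort (· ≥ ·)) =
      posSign R n S * pfaffian a (p ++ (insert n S).sort (· ≥ ·)) := by
  induction S using Finset.induction_on_max generalizing p with
  | empty => simp [posSign]
  | insert x S hx ih =>
    have hxS : x ∉ S := fun h => (hx x h).false
    simp only [Finset.mem_insert, not_or] at hn
    rcases lt_or_gt_of_ne hn.1 with h | h
    · rw [sort_insert_max hx, pfaffian_swap ha, Finset.insert_comm, sort_insert_max (x := x)]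
      · have := ih hn.2 (p ++ [x])
        simp only [List.append_assoc, List.cons_append, List.nil_append] at this
        rw [this, posSign, posSign, Finset.filter_insert, if_pos h,
          Finset.card_insert_of_notMem (by simp [hxS]), pow_succ]
        ring
      · intro y hy
        rcases Finset.mem_insert.1 hy with rfl | hy
        · exact h
        · exact hx y hy
    · have hn' : ∀ y ∈ insert x S, y < n := by
        intro y hy
        rcases Finset.mem_insert.1 hy with rfl | hy
        · exact h
        · exact (hx y hy).trans h
      rw [sort_insert_max hn', posSign, Finset.filter_eq_empty_iff.2]
      · simp
      · exact fun y hy => (hn' y hy).not_gt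

theorem pfaffian_cons_sort (hd : ∀ n, a n n = 0) (ha : ∀ n m, a m n = -a n m) (n : ℕ)
    (S : Finset ℕ) :
    pfaffian a (n :: S.sort (· ≥ ·)) =
      if n ∈ S then 0 else posSign R n S * pfaffianOn a (insert n S) := by
  split_ifs with h
  · obtain ⟨q, l, hl⟩ := List.append_of_mem ((Finset.mem_sort (· ≥ ·)).2 h)
    rw [hl]
    exact pfaffian_of_dup hd ha n q l
  · exact pfaffian_append_cons_sort ha h []

theorem symmDiff_singleton_of_mem {n : ℕ} {S : Finset ℕ} (h : n ∈ S) : S ∆ {n} = S.erase n := by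
  ext x; simp only [Finset.mem_symmDiff, Finset.mem_singleton, Finset.mem_erase]; grind

theorem symmDiff_singleton_of_notMem {n : ℕ} {S : Finset ℕ} (h : n ∉ S) :
    S ∆ {n} = insert n S := by
  ext x; simp only [Finset.mem_symmDiff, Finset.mem_singleton, Finset.mem_insert]; grind

/-- Only elements larger than n enter the sign. This is needed for m = n, the row being moved, and
for m = 0, the padding row. -/
theorem posSign_symmDiff_singleton {n m : ℕ} (h : m ≤ n) (S : Finset ℕ) :
    posSign R n (S ∆ {m}) = posSign R n S := by
  unfold posSign
  congr 2
  ext x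
  simp only [Finset.mem_filter, Finset.mem_symmDiff, Finset.mem_singleton]
  grind

/-- Moving one row from one minor to the other. -/
theorem altSum_exchange (hda : ∀ n, a n n = 0) (ha : ∀ n m, a m n = -a n m)
    (hdb : ∀ n, b n n = 0) (hb : ∀ n m, b m n = -b n m) (S T : Finset ℕ) :
    altSum (T.sort (· ≥ ·)) (fun y m => pfaffian a (y :: S.sort (· ≥ ·)) * pfaffian b m) +
      altSum (S.sort (· ≥ ·)) (fun x m => pfaffian a m * pfaffian b (x :: T.sort (· ≥ ·))) =
    ∑ n ∈ S ∆ T, posSign R n S * posSign R n T *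
      (pfaffianOn a (S ∆ {n}) * pfaffianOn b (T ∆ {n})) := by
  rw [symmDiff_def, Finset.sup_eq_union, Finset.sum_union disjoint_sdiff_sdiff, add_comm,
    altSum_sort, altSum_sort]
  congr 1
  -- A row lying in both sets would occur twice in one of the Pfaffians, so only the symmetric
  -- difference contributes.
  · rw [Finset.sdiff_eq_filter, Finset.sum_filter]
    refine Finset.sum_congr rfl fun n hn => ?_
    rw [pfaffian_cons_sort hdb hb]
    split_ifs with h
    · simp
    · rw [symmDiff_singleton_of_mem hn, symmDiff_singleton_of_notMem h]
      simp only [pfaffianOn]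
      ring
  · rw [Finset.sdiff_eq_filter, Finset.sum_filter]
    refine Finset.sum_congr rfl fun n hn => ?_
    rw [pfaffian_cons_sort hda ha]
    split_ifs with h
    · simp
    · rw [symmDiff_singleton_of_mem hn, symmDiff_singleton_of_notMem h]
      simp only [pfaffianOn]
      ring

theorem pfaffianOn_pluecker (hd : ∀ n, a n n = 0) (ha : ∀ n m, a m n = -a n m)
    (S T : Finset ℕ) :
    ∑ n ∈ S ∆ T, posSign R n S * posSign R n T *
      (pfaffianOn a (S ∆ {n}) * pfaffianOn a (T ∆ {n})) = 0 := by
  rw [← altSum_exchange hd ha hd ha, pfaffian_pluecker ha]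

theorem sum_powerset_symmDiff_singleton {M : Type*} [AddCommMonoid M] {U : Finset ℕ} {n : ℕ}
    (hn : n ∈ U) (f : Finset ℕ → M) :
    ∑ S ∈ U.powerset, f (S ∆ {n}) = ∑ S ∈ U.powerset, f S := by
  refine Finset.sum_nbij' (· ∆ {n}) (· ∆ {n}) ?_ ?_ ?_ ?_ ?_
  iterate 2
    intro S hS
    rw [Finset.mem_powerset] at hS ⊢
    intro x hx
    rcases Finset.mem_symmDiff.1 hx with h | h
    · exact hS h.1
    · exact Finset.mem_singleton.1 h.1 ▸ hn
  all_goals simp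

/-- The exchange sums cancel after summation against the minors of an antisymmetric matrix. -/
theorem sum_exchange_eq_zero {c : ℕ → ℕ → R} (hd : ∀ n, c n n = 0) (hc : ∀ n m, c m n = -c n m)
    (U : Finset ℕ) (f g : Finset ℕ → R) :
    ∑ S ∈ U.powerset, ∑ T ∈ U.powerset,
      pfaffianOn c (S ∆ {0}) * pfaffianOn c (T ∆ {0}) *
        ∑ n ∈ S ∆ T, posSign R n S * posSign R n T * (f (S ∆ {n}) * g (T ∆ {n})) = 0 := by
  have key : ∀ S ∈ U.powerset, ∀ T ∈ U.powerset, S ∆ T ⊆ U := by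
    intro S hS T hT x hx
    rcases Finset.mem_symmDiff.1 hx with h | h
    · exact Finset.mem_powerset.1 hS h.1
    · exact Finset.mem_powerset.1 hT h.1
  have h1 : ∀ F : Finset ℕ → Finset ℕ → ℕ → R,
      ∑ S ∈ U.powerset, ∑ T ∈ U.powerset, ∑ n ∈ S ∆ T, F S T n =
        ∑ n ∈ U, ∑ S ∈ U.powerset, ∑ T ∈ U.powerset, if n ∈ S ∆ T then F S T n else 0 := by
    intro F
    rw [Finset.sum_comm' (t' := U.powerset) (s' := fun _ => U) (by simp [and_comm])]
    refine Finset.sum_congr rfl fun S hS => ?_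
    rw [Finset.sum_comm' (t' := U.powerset) (s' := fun _ => U) (by simp [and_comm])]
    refine Finset.sum_congr rfl fun T hT => ?_
    rw [← Finset.sum_filter, Finset.filter_mem_eq_inter,
      Finset.inter_eq_right.2 (key S hS T hT)]
  have h2 : ∀ n S T, (S ∆ {n}) ∆ (T ∆ {n}) = (S ∆ T : Finset ℕ) := by
    intro n S T
    rw [symmDiff_symmDiff_symmDiff_comm, symmDiff_self, symmDiff_bot]
  simp only [Finset.mul_sum]
  have h4 : ∀ n ∈ U, ∀ F : Finset ℕ → Finset ℕ → R,
      ∑ S ∈ U.powerset, ∑ T ∈ U.powerset, F S T =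
        ∑ S ∈ U.powerset, ∑ T ∈ U.powerset, F (S ∆ {n}) (T ∆ {n}) := by
    intro n hn F
    rw [← sum_powerset_symmDiff_singleton hn]
    exact Finset.sum_congr rfl fun S _ => (sum_powerset_symmDiff_singleton hn _).symm
  -- For each fixed n, toggling n in both S and T is a bijection which preserves S ∆ T. It turns f
  -- (S ∆ {n}) g (T ∆ {n}) into f S g T, whose total coefficient is then the Plücker relation for c
  -- at S ∆ {0} and T ∆ {0}.
  rw [h1, Finset.sum_congr rfl fun n hn => h4 n hn _]
  simp only [h2, symmDiff_symmDiff_cancel_right, posSign_symmDiff_singleton le_rfl]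
  rw [← h1]
  refine Finset.sum_eq_zero fun S _ => Finset.sum_eq_zero fun T _ => ?_
  have h3 := pfaffianOn_pluecker hd hc (S ∆ {0}) (T ∆ {0})
  simp only [h2, posSign_symmDiff_singleton (Nat.zero_le _)] at h3
  rw [← zero_mul (f S * g T), ← h3, Finset.sum_mul]
  refine Finset.sum_congr rfl fun n _ => ?_
  rw [symmDiff_right_comm S {n}, symmDiff_right_comm T {n}]
  ring

end FinsetPfaffian

end SpinHurwitz

namespace SpinHurwitz

/-! ### The polynomials `qₙ` and `P_{n,m}` at given times -/

section RowQ

open PowerSeries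

variable {R : Type*} [CommRing R] [Algebra ℂ R]

/-- The value of `qₙ` at times `c`. -/
noncomputable def rowQAt (c : OddPos → R) (n : ℕ) : R := MvPolynomial.aeval c (rowQ n)

/-- The value of `P_{n,m}` at times `c`. -/
noncomputable def pairPAt (c : OddPos → R) (n m : ℕ) : R := MvPolynomial.aeval c (pairP n m)

/-- The derivative of `2 ∑ₖ cₖ xᵏ`, `k` odd. -/
noncomputable def timesDeriv (c : OddPos → R) : R⟦X⟧ :=
  PowerSeries.mk fun j => if h : Odd (j + 1) then 2 * ((j : R) + 1) * c ⟨j + 1, h⟩ else 0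

@[simp] theorem rowQAt_zero (c : OddPos → R) : rowQAt c 0 = 1 := by simp [rowQAt, rowQ_zero]

theorem map_rowQAt {S : Type*} [CommRing S] [Algebra ℂ S] (g : R →ₐ[ℂ] S) (c : OddPos → R)
    (n : ℕ) : g (rowQAt c n) = rowQAt (fun k => g (c k)) n := by
  simp only [rowQAt, ← MvPolynomial.comp_aeval_apply]

theorem map_pairPAt {S : Type*} [CommRing S] [Algebra ℂ S] (g : R →ₐ[ℂ] S) (c : OddPos → R)
    (n m : ℕ) : g (pairPAt c n m) = pairPAt (fun k => g (c k)) n m := by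
  simp only [pairPAt, ← MvPolynomial.comp_aeval_apply]

theorem natCast_succ_mul_cancel {n : ℕ} {x y : R} (h : ((n : R) + 1) * x = (n + 1) * y) :
    x = y := by
  have hu : IsUnit ((n : R) + 1) := by
    have : IsUnit ((n : ℂ) + 1) := (Nat.cast_add_one_ne_zero n).isUnit
    simpa using this.map (algebraMap ℂ R)
  exact hu.mul_left_cancel h

/-- `formalExp` substitutes into the exponential series over ℂ, whereas the chain rule below is
applied to the exponential series over R. -/
theorem exp_subst_eq_of_algebra [Algebra ℚ R] (g : R⟦X⟧) (hg : HasSubst g) :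
    (exp R : R⟦X⟧).subst g = (exp ℂ).subst g := by
  ext n
  rw [coeff_subst' hg, coeff_subst' hg]
  refine finsum_congr fun d => ?_
  rw [← map_exp (algebraMap ℂ R), coeff_map, algebraMap_smul]

theorem derivative_rowQ_series :
    d⁄dX _ (PowerSeries.mk rowQ) = timesDeriv MvPolynomial.X * PowerSeries.mk rowQ := by
  set g : PowerSeries (MvPolynomial OddPos ℂ) :=
    PowerSeries.mk fun k => if h : Odd k then 2 * MvPolynomial.X ⟨k, h⟩ else 0 with hg
  have hs : HasSubst g := by
    apply HasSubst.of_constantCoeff_zero'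
    simp [hg]
  have hF : PowerSeries.mk rowQ = (exp (MvPolynomial OddPos ℂ)).subst g := by
    rw [exp_subst_eq_of_algebra g hs]
    ext1 n; simp [rowQ, formalExp, hg]
  rw [hF, derivative_subst hs, derivative_exp, mul_comm]
  congr 1
  ext1 n
  rw [coeff_derivative, hg, timesDeriv, coeff_mk, coeff_mk]
  split_ifs
  · ring
  · simp

theorem rowQ_succ (n : ℕ) : ((n : MvPolynomial OddPos ℂ) + 1) * rowQ (n + 1) =
    ∑ p ∈ Finset.HasAntidiagonal.antidiagonal n, coeff p.1 (timesDeriv MvPolynomial.X) * rowQ p.2 := by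
  have h := congrArg (coeff n) derivative_rowQ_series
  rw [coeff_derivative, coeff_mul] at h
  simpa [mul_comm] using h

theorem rowQAt_succ (c : OddPos → R) (n : ℕ) : ((n : R) + 1) * rowQAt c (n + 1) =
    ∑ p ∈ Finset.HasAntidiagonal.antidiagonal n, coeff p.1 (timesDeriv c) * rowQAt c p.2 := by
  have h := congrArg (MvPolynomial.aeval c) (rowQ_succ n)
  rw [map_mul, map_sum, map_add, map_natCast, map_one] at h
  refine h.trans (Finset.sum_congr rfl fun p _ => ?_)
  rw [map_mul]
  congr 1
  simp only [timesDeriv, coeff_mk]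
  split_ifs <;> simp

/-- The linear differential equation fixes each coefficient from the previous ones, since n + 1 is a
unit in a ℂ-algebra. Identities between generating series of the q_n are thereby reduced to
comparing logarithmic derivatives. -/
theorem eq_rowQAt_of_derivative {c : OddPos → R} {V : R⟦X⟧} (h0 : constantCoeff V = 1)
    (h : d⁄dX R V = timesDeriv c * V) (n : ℕ) : coeff n V = rowQAt c n := by
  induction n using Nat.strong_induction_on with
  | _ n ih =>
    cases n with
    | zero => simpa using h0
    | succ n =>
      refine natCast_succ_mul_cancel (n := n) ?_
      have h1 := congrArg (coeff n) h
      rw [coeff_derivative, coeff_mul] at h1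
      rw [rowQAt_succ, mul_comm, h1]
      refine Finset.sum_congr rfl fun p hp => ?_
      rw [ih p.2 (by have := Finset.HasAntidiagonal.mem_antidiagonal.1 hp; omega)]

theorem derivative_rowQAt_series (c : OddPos → R) :
    d⁄dX R (PowerSeries.mk (rowQAt c)) = timesDeriv c * PowerSeries.mk (rowQAt c) := by
  ext n
  rw [coeff_derivative, coeff_mul, coeff_mk, mul_comm, rowQAt_succ]
  simp

theorem timesDeriv_add {S : Type*} [CommRing S] (c c' : OddPos → S) :
    timesDeriv (fun k => c k + c' k) = timesDeriv c + timesDeriv c' := by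
  ext n
  simp only [timesDeriv, coeff_mk, map_add]
  split_ifs
  · ring
  · simp

theorem rowQAt_series_add (c c' : OddPos → R) :
    PowerSeries.mk (rowQAt fun k => c k + c' k) =
      PowerSeries.mk (rowQAt c) * PowerSeries.mk (rowQAt c') := by
  ext n
  rw [coeff_mk]
  refine (eq_rowQAt_of_derivative ?_ ?_ n).symm
  · rw [map_mul, ← coeff_zero_eq_constantCoeff_apply, ← coeff_zero_eq_constantCoeff_apply]
    simp
  · rw [Derivation.leibniz, derivative_rowQAt_series, derivative_rowQAt_series, timesDeriv_add]
    simp only [smul_eq_mul]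
    ring

/-- The generating series at c has two descriptions of its inverse: the series at -c, and, because
only odd times occur, the series at c with its variable negated. -/
theorem rowQAt_neg (c : OddPos → R) (n : ℕ) :
    rowQAt (fun k => -c k) n = (-1) ^ n * rowQAt c n := by
  have h0 := rowQAt_series_add c fun k => -c k
  have h1 : PowerSeries.mk (rowQAt fun k => c k + -c k) = 1 := by
    ext n
    rw [coeff_mk]
    refine (eq_rowQAt_of_derivative (by simp) ?_ n).symm
    ext n
    simp [timesDeriv]
  have h2 : PowerSeries.mk (rowQAt c) *
      PowerSeries.mk (fun n => (-1) ^ n * rowQAt c n) = 1 := by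
    have h3 := congrArg (PowerSeries.map (MvPolynomial.aeval c).toRingHom) rowQ_series_mul_neg
    rw [map_mul, map_one] at h3
    rw [← h3]
    congr 1
    ext n
    simp [rowQAt, evalNegHom, coeff_rescale]
  rw [h1] at h0
  have h4 : PowerSeries.mk (rowQAt fun k => -c k) =
      PowerSeries.mk (fun n => (-1) ^ n * rowQAt c n) := by
    calc _ = (PowerSeries.mk (rowQAt c) * PowerSeries.mk (fun n => (-1) ^ n * rowQAt c n)) *
        PowerSeries.mk (rowQAt fun k => -c k) := by rw [h2, one_mul]
      _ = (PowerSeries.mk (rowQAt c) * PowerSeries.mk (rowQAt fun k => -c k)) *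
        PowerSeries.mk (fun n => (-1) ^ n * rowQAt c n) := by ring
      _ = _ := by rw [← h0, one_mul]
  simpa using congrArg (coeff n) h4

/-- `qₙ` at the shifted times `c - [z]`, from
`exp (-2 ∑ₖ zᵏ xᵏ / k) = (1 - z x) / (1 + z x)`. -/
theorem rowQAt_shift (c : OddPos → R) (z : R) (n : ℕ) :
    rowQAt (fun k => c k - (1 / (k : ℂ)) • z ^ (k : ℕ)) (n + 1) +
        z * rowQAt (fun k => c k - (1 / (k : ℂ)) • z ^ (k : ℕ)) n =
      rowQAt c (n + 1) - z * rowQAt c n := by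
  set d : OddPos → R := fun k => -((1 / (k : ℂ)) • z ^ (k : ℕ)) with hd
  have hu : IsUnit (1 + C z * X : R⟦X⟧) := isUnit_iff_constantCoeff.2 (by simp)
  have hu2 : IsUnit (1 - C z * X : R⟦X⟧) := isUnit_iff_constantCoeff.2 (by simp)
  -- V is (1 - zx)/(1 + zx), to be identified with the generating series at the times d = -[z].
  obtain ⟨V, hV⟩ : ∃ V, (1 + C z * X : R⟦X⟧) * V = 1 - C z * X := by
    obtain ⟨u, hu⟩ := hu
    exact ⟨(↑u⁻¹ : R⟦X⟧) * (1 - C z * X), by rw [← hu, Units.mul_inv_cancel_left]⟩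
  -- The coefficients of `timesDeriv d` are -2z^{j+1} for even j and 0 otherwise, so it is the
  -- geometric series -2z/(1 - z²x²), the logarithmic derivative of V.
  have hd1 : (1 - C z * X) * ((1 + C z * X) * timesDeriv d) = -2 * C z := by
    have : (1 - C z * X) * ((1 + C z * X) * timesDeriv d) =
        timesDeriv d - C (z ^ 2) * timesDeriv d * X ^ 2 := by
      rw [map_pow]; ring
    rw [this]
    have e : ∀ j, coeff j (timesDeriv d) = if Odd (j + 1) then -2 * z ^ (j + 1) else 0 := by
      intro j
      simp only [timesDeriv, coeff_mk, hd]
      split_ifs with h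
      · have h1 : ((j : R) + 1) = algebraMap ℂ R (j + 1) := by simp
        have h2 : ((j : ℂ) + 1) ≠ 0 := Nat.cast_add_one_ne_zero j
        rw [mul_assoc, h1, mul_neg, ← Algebra.smul_def, smul_smul]
        push_cast
        rw [mul_one_div_cancel h2, one_smul]
        ring
      · rfl
    have e2 : (-2 * C z : R⟦X⟧) = C (-2 * z) := by simp [map_ofNat C 2]
    rw [e2]
    ext j
    rw [map_sub, coeff_mul_X_pow', coeff_C]
    rcases j with _ | _ | j
    · simp [e]
    · simp [e]
    · have : Odd (j + 2 + 1) ↔ Odd (j + 1) := by grind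
      simp only [coeff_C_mul, e, this]
      simp only [show 2 ≤ j + 1 + 1 by omega, if_true, show j + 1 + 1 - 2 = j by omega,
        show j + 1 + 1 ≠ 0 by omega, if_false]
      split_ifs <;> ring
  have hVc : constantCoeff V = 1 := by simpa using congrArg constantCoeff hV
  have hVd : d⁄dX R V = timesDeriv d * V := by
    have h1 := congrArg (d⁄dX R) hV
    simp only [Derivation.leibniz, map_add, map_sub, smul_eq_mul, derivative_C, derivative_X,
      Derivation.map_one_eq_zero] at h1
    refine (hu2.mul hu).mul_left_cancel ?_
    linear_combination (1 - C z * X) * h1 + C z * hV - V * hd1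
  have h1 : PowerSeries.mk (rowQAt fun k => c k - (1 / (k : ℂ)) • z ^ (k : ℕ)) =
      PowerSeries.mk (rowQAt c) * V := by
    have h2 : PowerSeries.mk (rowQAt d) = V := by
      ext n
      rw [eq_rowQAt_of_derivative hVc hVd, coeff_mk]
    simpa only [sub_eq_add_neg, h2] using rowQAt_series_add c d
  have h2 : (1 + C z * X) * PowerSeries.mk (rowQAt fun k => c k - (1 / (k : ℂ)) • z ^ (k : ℕ)) =
      (1 - C z * X) * PowerSeries.mk (rowQAt c) := by
    rw [h1, ← hV]; ring
  have h3 := congrArg (coeff (n + 1)) h2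
  simp only [add_mul, sub_mul, map_add, map_sub, one_mul, coeff_mk, mul_assoc, coeff_C_mul,
    coeff_succ_X_mul] at h3
  exact h3

theorem pairPAt_succ (c : OddPos → R) (n m : ℕ) :
    pairPAt c n (m + 1) + pairPAt c (n + 1) m =
      rowQAt c n * rowQAt c (m + 1) - rowQAt c (n + 1) * rowQAt c m := by
  simpa [rowQAt, pairPAt] using congrArg (MvPolynomial.aeval c) (pairP_generating n m).1

theorem pairPAt_zero_right (c : OddPos → R) (n : ℕ) :
    pairPAt c n 0 = rowQAt c n - if n = 0 then 1 else 0 := by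
  have h := congrArg (MvPolynomial.aeval c) (pairP_generating n 0).2.1
  split_ifs at h ⊢ <;> simpa [rowQAt, pairPAt, rowQ_zero] using h

theorem pairPAt_zero_left (c : OddPos → R) (m : ℕ) :
    pairPAt c 0 m = -(rowQAt c m - if m = 0 then 1 else 0) := by
  have h := congrArg (MvPolynomial.aeval c) (pairP_generating 0 m).2.2
  split_ifs at h ⊢ <;> simpa [rowQAt, pairPAt, rowQ_zero] using h

/-- The defining formula is not visibly antisymmetric. The recurrence `pairPAt_succ` and the
boundary values are, and they determine all the entries. -/
theorem pairPAt_antisymm (c : OddPos → R) (n m : ℕ) : pairPAt c m n = -pairPAt c n m := by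
  induction n generalizing m with
  | zero => rw [pairPAt_zero_right, pairPAt_zero_left, neg_neg]
  | succ n ih =>
    have h1 := pairPAt_succ c n m
    have h2 := pairPAt_succ c m n
    rw [ih (m + 1)] at h2
    linear_combination h1 + h2

theorem pairPAt_self (c : OddPos → R) (n : ℕ) : pairPAt c n n = 0 := by
  have h := pairPAt_antisymm c n n
  refine natCast_succ_mul_cancel (n := 1) ?_
  push_cast
  linear_combination h

/-- The shift `c → c - [z]` perturbs `P_{n,m}` by a matrix of rank two. -/
theorem pairPAt_shift (c : OddPos → R) (z : R) (n m : ℕ) :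
    pairPAt (fun k => c k - (1 / (k : ℂ)) • z ^ (k : ℕ)) n m = pairPAt c n m +
      rowQAt (fun k => c k - (1 / (k : ℂ)) • z ^ (k : ℕ)) n * rowQAt c m -
        rowQAt c n * rowQAt (fun k => c k - (1 / (k : ℂ)) • z ^ (k : ℕ)) m := by
  induction n generalizing m with
  | zero => simp only [pairPAt_zero_left, rowQAt_zero]; ring
  | succ n ih =>
    have h1 := pairPAt_succ c n m
    have h2 := pairPAt_succ (fun k => c k - (1 / (k : ℂ)) • z ^ (k : ℕ)) n m
    rw [ih (m + 1)] at h2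
    have h3 := rowQAt_shift c z n
    have h4 := rowQAt_shift c z m
    -- Let q̃ be the shifted q. Then q̃_{n+1} - q_{n+1} = -z(q̃_n + q_n), hence (q̃_{n+1} -
    -- q_{n+1})(q̃_m + q_m) is symmetric in n and m; this is the cancellation of z used here.
    linear_combination h2 - h1 +
      (-rowQAt (fun k => c k - (1 / (k : ℂ)) • z ^ (k : ℕ)) m - rowQAt c m) * h3 +
      (rowQAt (fun k => c k - (1 / (k : ℂ)) • z ^ (k : ℕ)) n + rowQAt c n) * h4

end RowQ

end SpinHurwitz

namespace SpinHurwitz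

/-! ### Shifted `Q`-polynomials -/

section Shift

open scoped symmDiff

variable {R : Type*} [CommRing R] [Algebra ℂ R]

theorem sort_insert_zero {S : Finset ℕ} (h : 0 ∉ S) :
    (insert 0 S).sort (· ≥ ·) = S.sort (· ≥ ·) ++ [0] := by
  induction S using Finset.induction_on_max with
  | empty => simp
  | insert x S hx ih =>
    simp only [Finset.mem_insert, not_or] at h
    rw [Finset.insert_comm, sort_insert_max, sort_insert_max hx, ih h.2, List.cons_append]
    intro y hy
    rcases Finset.mem_insert.1 hy with rfl | hy
    · exact Nat.pos_of_ne_zero (Ne.symm h.1)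
    · exact hx y hy

theorem pairPAt_zero_left_of_ne (c : OddPos → R) {m : ℕ} (hm : m ≠ 0) :
    pairPAt c 0 m = -rowQAt c m := by
  rw [pairPAt_zero_left, if_neg hm, sub_zero]

theorem pfaffian_pairPAt_zero_cons (c : OddPos → R) {l : List ℕ} (hl : ∀ x ∈ l, x ≠ 0) :
    pfaffian (pairPAt c) (0 :: l) =
      -altSum l fun y m => rowQAt c y * pfaffian (pairPAt c) m := by
  rw [pfaffian_cons, ← altSum_neg]
  refine altSum_congr fun y m hy _ _ => ?_
  rw [pairPAt_zero_left_of_ne c (hl y hy), neg_mul]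

/-- The row 0 is moved to the front past an odd number of rows; this sign cancels the one in P_{0,m}
= -q_m. -/
theorem pfaffian_pairPAt_append_zero (c : OddPos → R) {l : List ℕ} (hl : ∀ x ∈ l, x ≠ 0)
    (ho : Odd l.length) :
    pfaffian (pairPAt c) (l ++ [0]) =
      altSum l fun y m => rowQAt c y * pfaffian (pairPAt c) m := by
  have h := pfaffian_move (pairPAt_antisymm c) [] l [] 0
  simp only [List.nil_append, List.append_nil, ho.neg_one_pow] at h
  rw [pfaffian_pairPAt_zero_cons c hl] at h
  linear_combination h

/-- The value of `Q_λ` at shifted times, up to a constant, as a sum over the deletions of a row. -/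
theorem pfaffianOn_pairPAt_shift (c : OddPos → R) (z : R) {E : Finset ℕ} (hE : Even E.card) :
    pfaffianOn (pairPAt fun k => c k - (1 / (k : ℂ)) • z ^ (k : ℕ)) E =
      altSum ((E ∆ {0}).sort (· ≥ ·)) fun n m =>
        rowQAt (fun k => c k - (1 / (k : ℂ)) • z ^ (k : ℕ)) n * pfaffian (pairPAt c) m := by
  set c' : OddPos → R := fun k => c k - (1 / (k : ℂ)) • z ^ (k : ℕ) with hc'
  have hP : ∀ l, pfaffian (pairPAt c') l = pfaffian (pairPAt c) l +
      altSum l fun n m => rowQAt c' n * altSum m fun k m' =>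
        rowQAt c k * pfaffian (pairPAt c) m' := fun l => by
    rw [← pfaffian_add_rank_two]
    exact pfaffian_congr fun n _ m _ => pairPAt_shift c z n m
  by_cases h0 : 0 ∈ E
  · rw [symmDiff_singleton_of_mem h0, pfaffianOn]
    have hcard := Finset.card_erase_add_one h0
    obtain ⟨S, hS, rfl⟩ : ∃ S, 0 ∉ S ∧ E = insert 0 S :=
      ⟨E.erase 0, by simp, (Finset.insert_erase h0).symm⟩
    rw [Finset.erase_insert hS] at hcard ⊢
    have hl : ∀ x ∈ S.sort (· ≥ ·), x ≠ 0 := by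
      intro x hx h
      exact hS (h ▸ (Finset.mem_sort _).1 hx)
    rw [sort_insert_zero hS, pfaffian_pairPAt_append_zero c' hl (by
      rw [Finset.length_sort]; grind)]
    -- Expanding along the row 0 already produces shifted q's in front of shifted minors. The
    -- rank-two correction of those minors contributes a term quadratic in the shifted q's, which is
    -- symmetric and so vanishes.
    simp only [hP, mul_add, altSum_add, ← altSum_mul_left]
    rw [add_eq_left]
    exact altSum_altSum_eq_zero _ (fun y n m => altSum m fun k m'' =>
      rowQAt c' y * (rowQAt c' n * (rowQAt c k * pfaffian (pairPAt c) m''))) fun y k m => by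
        congr 1; ext; ring
  · have hl : ∀ x ∈ E.sort (· ≥ ·), x ≠ 0 := by
      intro x hx h
      exact h0 (h ▸ (Finset.mem_sort _).1 hx)
    -- Deleting the added row 0 leaves the unshifted Pfaffian, because q_0 = 1; deleting any other
    -- row gives the rank-two correction, whose inner sum is a Pfaffian with the row 0 appended.
    rw [symmDiff_singleton_of_notMem h0, pfaffianOn, sort_insert_zero h0, altSum_append, hP,
      add_comm]
    congr 1
    · refine altSum_congr fun y m hy hml hm => ?_
      rw [pfaffian_pairPAt_append_zero c (fun x hx => hl x (hml hx))]
      rw [Finset.length_sort] at hm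
      grind
    · simp [hE.neg_one_pow]

theorem pfaffianOn_pairPAt (c : OddPos → R) {E : Finset ℕ} (hE : Even E.card) :
    pfaffianOn (pairPAt c) E =
      altSum ((E ∆ {0}).sort (· ≥ ·)) fun n m => rowQAt c n * pfaffian (pairPAt c) m := by
  have h : (fun k : OddPos => c k - (1 / (k : ℂ)) • (0 : R) ^ (k : ℕ)) = c := by
    ext k
    rw [zero_pow k.2.pos.ne', smul_zero, sub_zero]
  simpa only [h] using pfaffianOn_pairPAt_shift c 0 hE

/-! ### The residue as a functional on polynomials in the spectral variable. -/

open Polynomial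

/-- The linear functional on polynomials which takes the values `e n` on the monomials. -/
noncomputable def monomialFunctional {R : Type*} [CommRing R] (e : ℕ → R) : R[X] →ₗ[R] R :=
  Polynomial.lsum fun n => e n • LinearMap.id

theorem monomialFunctional_apply {R : Type*} [CommRing R] (e : ℕ → R) {p : R[X]} {n : ℕ} (h : p.natDegree < n) :
    monomialFunctional e p = ∑ i ∈ Finset.range n, e i * p.coeff i := by
  rw [monomialFunctional, Polynomial.lsum_apply, Polynomial.sum_over_range' _ _ n h]
  · simp
  · simp

theorem monomialFunctional_C_mul_X_pow {R : Type*} [CommRing R] (e : ℕ → R) (a : R) (n : ℕ) :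
    monomialFunctional e (C a * X ^ n) = e n * a := by
  rw [monomialFunctional_apply e (Nat.lt_succ_of_le (natDegree_C_mul_X_pow_le a n)),
    Finset.sum_eq_single n]
  · simp
  · intro b _ hb; simp [coeff_X_pow, hb]
  · simp

/-- The times `c - [s z]` for a formal variable `z`. -/
noncomputable def shiftedTimes (c : OddPos → R) (s : R) (k : OddPos) : R[X] :=
  C (c k) - (1 / (k : ℂ)) • (C s * X) ^ (k : ℕ)

theorem rowQAt_C (c : OddPos → R) (n : ℕ) : rowQAt (fun k => C (c k)) n = C (rowQAt c n) :=
  (map_rowQAt ((CAlgHom : R →ₐ[R] R[X]).restrictScalars ℂ) c n).symm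

theorem pairPAt_C (c : OddPos → R) (n m : ℕ) :
    pairPAt (fun k => C (c k)) n m = C (pairPAt c n m) :=
  (map_pairPAt ((CAlgHom : R →ₐ[R] R[X]).restrictScalars ℂ) c n m).symm

theorem rowQAt_shiftedTimes_succ (c : OddPos → R) (s : R) (n : ℕ) :
    rowQAt (shiftedTimes c s) (n + 1) + C s * X * rowQAt (shiftedTimes c s) n =
      C (rowQAt c (n + 1)) - C s * X * C (rowQAt c n) := by
  rw [← rowQAt_C, ← rowQAt_C]
  exact rowQAt_shift (fun k => C (c k)) (C s * X) n

/-- This is (1 - szx)/(1 + szx) = 2/(1 + szx) - 1, read off coefficient by coefficient. -/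
theorem rowQAt_shiftedTimes (c : OddPos → R) (s : R) (n : ℕ) :
    rowQAt (shiftedTimes c s) n =
      2 * (∑ p ∈ Finset.HasAntidiagonal.antidiagonal n,
        C ((-s) ^ p.1 * rowQAt c p.2) * X ^ p.1) - C (rowQAt c n) := by
  induction n with
  | zero => simp; ring
  | succ n ih =>
    have h := rowQAt_shiftedTimes_succ c s n
    rw [ih] at h
    rw [Finset.Nat.antidiagonal_succ, Finset.sum_cons, Finset.sum_map]
    simp only [Function.Embedding.prodMap, Function.Embedding.coeFn_mk, Prod.map,
      Function.Embedding.refl_apply, pow_zero, one_mul, mul_one]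
    have h2 : ∑ x ∈ Finset.HasAntidiagonal.antidiagonal n,
        C ((-s) ^ Nat.succ x.1 * rowQAt c x.2) * X ^ Nat.succ x.1 =
        -(C s * X) * ∑ p ∈ Finset.HasAntidiagonal.antidiagonal n,
          C ((-s) ^ p.1 * rowQAt c p.2) * X ^ p.1 := by
      rw [Finset.mul_sum]
      refine Finset.sum_congr rfl fun p _ => ?_
      simp only [Nat.succ_eq_add_one, pow_succ, map_mul, map_neg]
      ring
    rw [h2]
    linear_combination h

variable (c c' : OddPos → R)

theorem monomialFunctional_rowQAt (e : ℕ → R) (s : R) (n : ℕ) :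
    monomialFunctional e (rowQAt (shiftedTimes c s) n) =
      2 * (∑ p ∈ Finset.HasAntidiagonal.antidiagonal n, (-s) ^ p.1 * e p.1 * rowQAt c p.2) -
        e 0 * rowQAt c n := by
  have h2 : (2 : R[X]) = C 2 := (map_ofNat C 2).symm
  have h3 := monomialFunctional_C_mul_X_pow e (rowQAt c n) 0
  rw [pow_zero, mul_one] at h3
  rw [rowQAt_shiftedTimes, map_sub, h2, ← smul_eq_C_mul, map_smul, map_sum, h3, smul_eq_mul]
  congr 2
  refine Finset.sum_congr rfl fun p _ => ?_
  rw [monomialFunctional_C_mul_X_pow]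
  ring

theorem rowQAt_add (c c' : OddPos → R) (n : ℕ) : rowQAt (fun k => c k + c' k) n =
    ∑ p ∈ Finset.HasAntidiagonal.antidiagonal n, rowQAt c p.1 * rowQAt c' p.2 := by
  simpa [PowerSeries.coeff_mul] using congrArg (PowerSeries.coeff n) (rowQAt_series_add c c')

/-- The signs (-1)^i turn q_i(c - c') into q_i(c' - c), and the convolution with q(c) is then q(c')
by the addition formula. -/
theorem monomialFunctional_rowQAt_left (n : ℕ) :
    monomialFunctional (rowQAt fun k => c k - c' k) (rowQAt (shiftedTimes c 1) n) =
      2 * rowQAt c' n - rowQAt c n := by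
  rw [monomialFunctional_rowQAt]
  have h := rowQAt_add (fun k => -(c k - c' k)) c n
  simp only [neg_sub, sub_add_cancel] at h
  rw [h]
  simp only [← rowQAt_neg, neg_sub, rowQAt_zero, one_mul]

theorem monomialFunctional_rowQAt_right (n : ℕ) :
    monomialFunctional (rowQAt fun k => c k - c' k) (rowQAt (shiftedTimes c' (-1)) n) =
      2 * rowQAt c n - rowQAt c' n := by
  rw [monomialFunctional_rowQAt]
  have h := rowQAt_add (fun k => c k - c' k) c' n
  simp only [sub_add_cancel] at h
  rw [h]
  simp

/-- Adding the shift recurrences for the two factors cancels the term X q̃_n q̃'_m. What remains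
trades n + 1, m for n, m + 1 up to terms linear in the shifted q's, on which the functional is
known, and this is the recurrence satisfied by the P's. -/
theorem monomialFunctional_rowQAt_mul (n m : ℕ) :
    monomialFunctional (rowQAt fun k => c k - c' k)
        (rowQAt (shiftedTimes c 1) n * rowQAt (shiftedTimes c' (-1)) m) =
      2 * pairPAt c m n + 2 * pairPAt c' n m + rowQAt c n * rowQAt c' m := by
  set L := monomialFunctional (rowQAt fun k => c k - c' k) with hL
  have hC : ∀ (a : R) (p : R[X]), L (C a * p) = a * L p := fun a p => by
    rw [← smul_eq_C_mul, map_smul, smul_eq_mul]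
  have hl := monomialFunctional_rowQAt_left c c'
  have hr := monomialFunctional_rowQAt_right c c'
  rw [← hL] at hl hr
  have h1 : L 1 = 1 := by
    simpa [hL] using monomialFunctional_C_mul_X_pow (rowQAt fun k => c k - c' k) 1 0
  have hXl : ∀ n, L (X * rowQAt (shiftedTimes c 1) n) =
      2 * rowQAt c (n + 1) - 2 * rowQAt c' (n + 1) - rowQAt c n * L X := fun n => by
    have h : X * rowQAt (shiftedTimes c 1) n = C (rowQAt c (n + 1)) * 1 -
        C (rowQAt c n) * X - rowQAt (shiftedTimes c 1) (n + 1) := by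
      have := rowQAt_shiftedTimes_succ c 1 n
      simp only [map_one, one_mul] at this
      linear_combination this
    rw [h, map_sub, map_sub, hC, hC, hl, h1]
    ring
  have hXr : ∀ n, L (X * rowQAt (shiftedTimes c' (-1)) n) =
      2 * rowQAt c (n + 1) - 2 * rowQAt c' (n + 1) - rowQAt c' n * L X := fun n => by
    have h : X * rowQAt (shiftedTimes c' (-1)) n = rowQAt (shiftedTimes c' (-1)) (n + 1) -
        C (rowQAt c' (n + 1)) * 1 - C (rowQAt c' n) * X := by
      have := rowQAt_shiftedTimes_succ c' (-1) n
      simp only [map_one, map_neg] at this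
      linear_combination -this
    rw [h, map_sub, map_sub, hC, hC, hr, h1]
    ring
  induction n generalizing m with
  | zero =>
    rw [rowQAt_zero, one_mul, hr, pairPAt_zero_right, pairPAt_zero_left, rowQAt_zero]
    ring
  | succ n ih =>
    have h : rowQAt (shiftedTimes c 1) (n + 1) * rowQAt (shiftedTimes c' (-1)) m =
        C (rowQAt c (n + 1)) * rowQAt (shiftedTimes c' (-1)) m -
        C (rowQAt c n) * (X * rowQAt (shiftedTimes c' (-1)) m) +
        C (rowQAt c' (m + 1)) * rowQAt (shiftedTimes c 1) n +
        C (rowQAt c' m) * (X * rowQAt (shiftedTimes c 1) n) -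
        rowQAt (shiftedTimes c 1) n * rowQAt (shiftedTimes c' (-1)) (m + 1) := by
      have e1 := rowQAt_shiftedTimes_succ c 1 n
      have e2 := rowQAt_shiftedTimes_succ c' (-1) m
      simp only [map_one, map_neg, one_mul] at e1 e2
      linear_combination rowQAt (shiftedTimes c' (-1)) m * e1 + rowQAt (shiftedTimes c 1) n * e2
    rw [h, map_sub, map_add, map_add, map_sub, hC, hC, hC, hC, hXl, hXr, hl, hr, ih]
    have h3 := pairPAt_succ c m n
    have h4 := pairPAt_succ c' n m
    linear_combination -2 * h3 - 2 * h4

/-- The bilinear form of the `BKP` hierarchy on two `Q`-polynomials. -/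
theorem monomialFunctional_pfaffianOn {E F : Finset ℕ} (hE : Even E.card) (hF : Even F.card) :
    monomialFunctional (rowQAt fun k => c k - c' k)
        (pfaffianOn (pairPAt (shiftedTimes c 1)) E *
          pfaffianOn (pairPAt (shiftedTimes c' (-1))) F) =
      pfaffianOn (pairPAt c) E * pfaffianOn (pairPAt c') F +
        2 * ∑ n ∈ (E ∆ {0}) ∆ (F ∆ {0}), posSign R n (E ∆ {0}) * posSign R n (F ∆ {0}) *
          (pfaffianOn (pairPAt c) (E ∆ {0} ∆ {n}) * pfaffianOn (pairPAt c') (F ∆ {0} ∆ {n})) := by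
  rw [← altSum_exchange (pairPAt_self c) (pairPAt_antisymm c) (pairPAt_self c')
    (pairPAt_antisymm c'), pfaffianOn_pairPAt c hE, pfaffianOn_pairPAt c' hF]
  have hpf : ∀ (c : OddPos → R) l,
      pfaffian (pairPAt fun k => C (c k)) l = C (pfaffian (pairPAt c) l) := fun c l => by
    rw [map_pfaffian]
    exact pfaffian_congr fun _ _ _ _ => pairPAt_C c _ _
  have h1 := pfaffianOn_pairPAt_shift (fun k => C (c k)) (C 1 * X) hE
  have h2 := pfaffianOn_pairPAt_shift (fun k => C (c' k)) (C (-1) * X) hF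
  simp only [hpf] at h1 h2
  change pfaffianOn (pairPAt (shiftedTimes c 1)) E = altSum _ (fun n m =>
    rowQAt (shiftedTimes c 1) n * C (pfaffian (pairPAt c) m)) at h1
  change pfaffianOn (pairPAt (shiftedTimes c' (-1))) F = altSum _ (fun n m =>
    rowQAt (shiftedTimes c' (-1)) n * C (pfaffian (pairPAt c') m)) at h2
  rw [h1, h2, ← altSum_mul_right, map_altSum]
  simp only [← altSum_mul_left, map_altSum]
  have h3 : ∀ n m k l, monomialFunctional (rowQAt fun k => c k - c' k)
      (rowQAt (shiftedTimes c 1) n * C (pfaffian (pairPAt c) m) *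
        (rowQAt (shiftedTimes c' (-1)) k * C (pfaffian (pairPAt c') l))) =
      (rowQAt c n * pfaffian (pairPAt c) m) * (rowQAt c' k * pfaffian (pairPAt c') l) +
      2 * ((pairPAt c k n * pfaffian (pairPAt c) m) * pfaffian (pairPAt c') l) +
      2 * (pfaffian (pairPAt c) m * (pairPAt c' n k * pfaffian (pairPAt c') l)) := by
    intro n m k l
    have : rowQAt (shiftedTimes c 1) n * C (pfaffian (pairPAt c) m) *
        (rowQAt (shiftedTimes c' (-1)) k * C (pfaffian (pairPAt c') l)) =
        (pfaffian (pairPAt c) m * pfaffian (pairPAt c') l) •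
          (rowQAt (shiftedTimes c 1) n * rowQAt (shiftedTimes c' (-1)) k) := by
      rw [smul_eq_C_mul, map_mul]; ring
    rw [this, map_smul, monomialFunctional_rowQAt_mul, smul_eq_mul]
    ring
  -- The three terms of h3 sum to the product of the two Pfaffians, to Pfaffians at c with a row of
  -- the second list prepended, and to Pfaffians at c' with a row of the first list prepended.
  simp only [h3, altSum_add, altSum_mul_left, altSum_mul_right, pfaffian_cons]
  rw [altSum_comm]
  simp only [altSum_mul_right]
  ring

end Shift

end SpinHurwitz

namespace SpinHurwitz

/-! ### Weights -/

section Weights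

/-- The weight of `t_k` is `k`. -/
abbrev timeWeight : OddPos → ℕ := Subtype.val

/-- The weights of the variables `t_k` and `t'_k`. -/
abbrev twoTimesWeight : TwoTimes → ℕ := Sum.elim timeWeight timeWeight

/-- The weights of `t_k`, `t'_k` and of the spectral variable. -/
abbrev spectralWeight : Option TwoTimes → ℕ := fun o => o.elim 1 twoTimesWeight

open MvPolynomial

variable {R σ : Type*} [CommRing R] [Algebra ℂ R] {w : σ → ℕ} {c : OddPos → MvPolynomial σ R}

theorem isWeightedHomogeneous_rowQAt (hc : ∀ k, (c k).IsWeightedHomogeneous w (k : ℕ)) (n : ℕ) :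
    (rowQAt c n).IsWeightedHomogeneous w n := by
  induction n using Nat.strong_induction_on with
  | _ n ih =>
    cases n with
    | zero => rw [rowQAt_zero]; exact isWeightedHomogeneous_one R w
    | succ n =>
      have h : (((n : MvPolynomial σ R) + 1) * rowQAt c (n + 1)).IsWeightedHomogeneous w
          (n + 1) := by
        rw [rowQAt_succ]
        refine IsWeightedHomogeneous.sum _ _ _ fun p hp => ?_
        have hp := Finset.HasAntidiagonal.mem_antidiagonal.1 hp
        rw [show n + 1 = (p.1 + 1) + p.2 by omega]
        refine IsWeightedHomogeneous.mul ?_ (ih p.2 (by omega))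
        simp only [timesDeriv, PowerSeries.coeff_mk]
        split_ifs with h
        · have : (2 * ((p.1 : MvPolynomial σ R) + 1)) = C (2 * ((p.1 : R) + 1)) := by
            simp [map_ofNat C 2]
          rw [this]
          exact (hc ⟨p.1 + 1, h⟩).C_mul _
        · exact isWeightedHomogeneous_zero R w _
      have h2 : rowQAt c (n + 1) = C (algebraMap ℂ R ((n : ℂ) + 1)⁻¹) *
          (((n : MvPolynomial σ R) + 1) * rowQAt c (n + 1)) := by
        have h3 : ((n : MvPolynomial σ R) + 1) = C (algebraMap ℂ R ((n : ℂ) + 1)) := by simp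
        rw [h3, ← mul_assoc, ← C_mul, ← map_mul, inv_mul_cancel₀ (Nat.cast_add_one_ne_zero n)]
        simp
      rw [h2]
      exact h.C_mul _

theorem isWeightedHomogeneous_pairPAt (hc : ∀ k, (c k).IsWeightedHomogeneous w (k : ℕ))
    (n m : ℕ) : (pairPAt c n m).IsWeightedHomogeneous w (n + m) := by
  induction n generalizing m with
  | zero =>
    rw [pairPAt_zero_left, zero_add]
    split_ifs with h
    · subst h
      simpa using isWeightedHomogeneous_zero R w 0
    · simpa using (isWeightedHomogeneous_rowQAt hc m).neg
  | succ n ih =>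
    have h := pairPAt_succ c n m
    rw [← eq_sub_iff_add_eq'] at h
    rw [h]
    have e : n + 1 + m = n + (m + 1) := by omega
    refine .sub (.sub (e ▸ .mul (isWeightedHomogeneous_rowQAt hc n)
      (isWeightedHomogeneous_rowQAt hc (m + 1))) (.mul (isWeightedHomogeneous_rowQAt hc (n + 1))
      (isWeightedHomogeneous_rowQAt hc m))) (e ▸ ih (m + 1))

end Weights

section WeightsAltSum

open MvPolynomial

variable {R σ : Type*} [CommRing R] {w : σ → ℕ}

theorem isWeightedHomogeneous_altSum {ι : Type*} {l : List ι} {f : ι → List ι → MvPolynomial σ R}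
    {n : ℕ} (h : ∀ x m, (x :: m).Perm l → (f x m).IsWeightedHomogeneous w n) :
    (altSum l f).IsWeightedHomogeneous w n := by
  induction l generalizing f with
  | nil => exact isWeightedHomogeneous_zero R w n
  | cons x l ih =>
    rw [altSum_cons]
    refine (h x l (List.Perm.refl _)).sub (ih fun y m hm => h y (x :: m) ?_)
    exact (List.Perm.swap x y m).trans (hm.cons x)

theorem isWeightedHomogeneous_pfaffian {a : ℕ → ℕ → MvPolynomial σ R}
    (ha : ∀ n m, (a n m).IsWeightedHomogeneous w (n + m)) (l : List ℕ) :
    (pfaffian a l).IsWeightedHomogeneous w l.sum := by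
  induction hk : l.length using Nat.strong_induction_on generalizing l with
  | _ k ih =>
    subst hk
    cases l with
    | nil => simpa using isWeightedHomogeneous_one R w
    | cons x l =>
      rw [pfaffian_cons]
      refine isWeightedHomogeneous_altSum fun y m hm => ?_
      have h1 : l.sum = y + m.sum := by rw [← hm.sum_eq, List.sum_cons]
      have h2 : m.length + 1 = l.length := by rw [← hm.length_eq, List.length_cons]
      rw [List.sum_cons, h1, ← add_assoc]
      exact (ha x y).mul (ih m.length (by simp; omega) m rfl)

/-- Every term of a Pfaffian uses each row exactly once. -/
theorem pfaffian_scale (d : ℕ → R) (a : ℕ → ℕ → R) (l : List ℕ) :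
    pfaffian (fun n m => d n * d m * a n m) l = (l.map d).prod * pfaffian a l := by
  induction hk : l.length using Nat.strong_induction_on generalizing l with
  | _ k ih =>
    subst hk
    cases l with
    | nil => simp
    | cons x l =>
      rw [pfaffian_cons, pfaffian_cons, ← altSum_mul_left]
      refine altSum_congr_perm fun y m hm => ?_
      have h2 : m.length + 1 = l.length := by rw [← hm.length_eq, List.length_cons]
      rw [ih m.length (by simp; omega) m rfl, List.map_cons, List.prod_cons,
        ← (hm.map d).prod_eq, List.map_cons, List.prod_cons]
      ring

end WeightsAltSum

/-! ### Reduction of the `BKP` hierarchy to truncations -/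

section Truncation

variable {R : Type*} [CommRing R]

open MvPowerSeries

/-- Two series have the same terms of weight at most `W`. -/
def AgreeUpTo {σ : Type*} (w : σ → ℕ) (W : ℕ) (f g : MvPowerSeries σ R) : Prop :=
  ∀ m, Finsupp.weight w m ≤ W → coeff m f = coeff m g

variable {σ : Type*} {w : σ → ℕ} {W : ℕ}

theorem agreeUpTo_iff {f g : MvPowerSeries σ R} :
    AgreeUpTo w W f g ↔ ((W + 1 : ℕ) : ℕ∞) ≤ (f - g).weightedOrder w := by
  constructor
  · intro h
    refine nat_le_weightedOrder w fun d hd => ?_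
    rw [map_sub, h d (by omega), sub_self]
  · intro h m hm
    rw [← sub_eq_zero, ← map_sub]
    exact coeff_eq_zero_of_lt_weightedOrder w
      (lt_of_lt_of_le (by exact_mod_cast Nat.lt_succ_of_le hm) h)

theorem AgreeUpTo.mul {f g f' g' : MvPowerSeries σ R} (h : AgreeUpTo w W f g)
    (h' : AgreeUpTo w W f' g') : AgreeUpTo w W (f * f') (g * g') := by
  classical
  intro m hm
  rw [coeff_mul, coeff_mul]
  refine Finset.sum_congr rfl fun p hp => ?_
  have hp := congrArg (Finsupp.weight w) (Finset.HasAntidiagonal.mem_antidiagonal.1 hp)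
  rw [map_add] at hp
  rw [h p.1 (by omega), h' p.2 (by omega)]

/-- Replacing each variable by a series of at least its own weight cannot lower the weight of a
difference. -/
theorem AgreeUpTo.subst {τ : Type*} {v : τ → ℕ} {a : σ → MvPowerSeries τ R} (ha : HasSubst a)
    (hw : ∀ i, (w i : ℕ∞) ≤ (a i).weightedOrder v) {f g : MvPowerSeries σ R}
    (h : AgreeUpTo w W f g) : AgreeUpTo v W (f.subst a) (g.subst a) := by
  rw [agreeUpTo_iff] at h ⊢
  rw [← subst_sub ha]
  refine le_trans ?_ (le_weightedOrder_subst v ha (f - g))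
  refine le_iInf₂ fun d hd => ?_
  refine (h.trans (weightedOrder_le w hd)).trans ?_
  simp only [Finsupp.weight_apply, Finsupp.sum]
  push_cast
  refine Finset.sum_le_sum fun i _ => ?_
  simp only [smul_eq_mul, nsmul_eq_mul, Nat.cast_mul, Function.comp_apply]
  gcongr
  exact hw i

theorem optionElim_eq_embDomain_add_single {α : Type*} (n : ℕ) (m : α →₀ ℕ) :
    m.optionElim n = m.embDomain Function.Embedding.some + Finsupp.single none n := by
  ext o
  cases o with
  | none =>
    rw [Finsupp.add_apply, Finsupp.embDomain_of_notMem_range _ _ _ (by simp)]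
    simp
  | some i =>
    have : m.embDomain Function.Embedding.some (some i) = m i :=
      Finsupp.embDomain_apply_self Function.Embedding.some m i
    simp [this]

theorem spectralCoeff_eq (n : ℕ) (f : MvPowerSeries (Option TwoTimes) R) :
    spectralCoeff n f = PowerSeries.coeff n (optionEquivLeft TwoTimes R f) := by
  ext m
  rw [coeff_coeff_optionEquivLeft]
  change coeff (m.embDomain Function.Embedding.some + Finsupp.single none n) f = _
  rw [optionElim_eq_embDomain_add_single]

theorem weight_optionElim (n : ℕ) (m : TwoTimes →₀ ℕ) :
    Finsupp.weight spectralWeight (m.optionElim n) = n + Finsupp.weight twoTimesWeight m := by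
  rw [optionElim_eq_embDomain_add_single, map_add, Finsupp.weight_single, add_comm, Finsupp.weight_apply, Finsupp.weight_apply,
    Finsupp.sum_embDomain]
  simp

end Truncation

end SpinHurwitz

namespace SpinHurwitz

/-! ### The two factors of the bilinear identity, and the passage from polynomials to series. -/

section BKPTruncation

variable {R : Type*} [CommRing R] [Algebra ℂ R]

theorem coeff_exp_subst_times (c : OddPos → R) (n : ℕ) :
    PowerSeries.coeff n ((PowerSeries.exp ℂ).subst
      (PowerSeries.mk fun k => if h : Odd k then 2 * c ⟨k, h⟩ else 0)) = rowQAt c n := by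
  let _ : Algebra ℚ R := ((algebraMap ℂ R).comp (algebraMap ℚ ℂ)).toAlgebra
  have hs : PowerSeries.HasSubst
      (PowerSeries.mk fun k => if h : Odd k then 2 * c ⟨k, h⟩ else 0) := by
    apply PowerSeries.HasSubst.of_constantCoeff_zero'
    simp
  rw [← exp_subst_eq_of_algebra _ hs]
  refine eq_rowQAt_of_derivative ?_ ?_ n
  · rw [← PowerSeries.coeff_zero_eq_constantCoeff_apply, PowerSeries.coeff_subst' hs,
      finsum_eq_single _ 0]
    · simp
    · intro d hd
      simp [hd]
  · rw [PowerSeries.derivative_subst hs, PowerSeries.derivative_exp, mul_comm]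
    congr 1
    ext n
    rw [PowerSeries.coeff_derivative, timesDeriv, PowerSeries.coeff_mk, PowerSeries.coeff_mk]
    split_ifs
    · ring
    · simp

open MvPowerSeries

theorem optionEquivLeft_xi {S : Type*} [CommRing S] :
    optionEquivLeft TwoTimes S (formalSum fun j : OddPos =>
      (X (some (Sum.inl j)) - X (some (Sum.inr j))) * X none ^ (j : ℕ)) =
    PowerSeries.mk fun k => if h : Odd k then
      X (Sum.inl ⟨k, h⟩) - X (Sum.inr ⟨k, h⟩) else 0 := by
  ext k m
  rw [coeff_coeff_optionEquivLeft]
  change (∑ᶠ j : OddPos, coeff (m.optionElim k) _) = _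
  simp only [← coeff_coeff_optionEquivLeft, map_mul, map_sub, map_pow, optionEquivLeft_X_some,
    optionEquivLeft_X_none, PowerSeries.coeff_mk]
  simp only [← map_sub, PowerSeries.coeff_C_mul, PowerSeries.coeff_X_pow]
  split_ifs with h
  · rw [finsum_eq_single _ ⟨k, h⟩]
    · simp
    · intro j hj
      rw [if_neg fun e => hj (Subtype.ext e.symm)]
      simp
  · refine finsum_eq_zero_of_forall_eq_zero fun j => ?_
    rw [if_neg fun e : k = j => h (e ▸ j.2)]
    simp

variable (R) in
/-- A polynomial as a power series, as a homomorphism of `ℂ`-algebras. -/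
noncomputable def polyToSeries (σ : Type*) : MvPolynomial σ R →ₐ[ℂ] MvPowerSeries σ R :=
  { MvPolynomial.coeToMvPowerSeries.ringHom with
    commutes' := fun r => by
      simp [MvPolynomial.algebraMap_apply, MvPowerSeries.algebraMap_apply] }

theorem polyToSeries_apply {σ : Type*} (p : MvPolynomial σ R) : polyToSeries R σ p = p := rfl

variable (R) in
/-- The times `t_k / 2`. -/
noncomputable def leftTimes (k : OddPos) : MvPolynomial TwoTimes R :=
  (1 / 2 : ℂ) • MvPolynomial.X (Sum.inl k)

variable (R) in
/-- The times `t'_k / 2`. -/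
noncomputable def rightTimes (k : OddPos) : MvPolynomial TwoTimes R :=
  (1 / 2 : ℂ) • MvPolynomial.X (Sum.inr k)

/-- The generating series of the q_n carries a factor 2 in its exponent, so exp ξ(t - t', k) is that
series at the halved times (t - t')/2. In particular each coefficient is a polynomial. -/
theorem spectralCoeff_expXi (n : ℕ) : spectralCoeff n (expXi (R := R)) =
    (rowQAt (fun k => leftTimes R k - rightTimes R k) n : MvPolynomial TwoTimes R) := by
  set ξ : MvPowerSeries (Option TwoTimes) R := formalSum fun j : OddPos =>
    (X (some (Sum.inl j)) - X (some (Sum.inr j))) * X none ^ (j : ℕ) with hξ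
  set g : PowerSeries (MvPowerSeries TwoTimes R) := PowerSeries.mk fun k => if h : Odd k then
      2 * ((1 / 2 : ℂ) • (X (Sum.inl ⟨k, h⟩) - X (Sum.inr ⟨k, h⟩))) else 0 with hg
  have hs : PowerSeries.HasSubst g := by
    apply PowerSeries.HasSubst.of_constantCoeff_zero'
    simp [hg]
  have hξg : optionEquivLeft TwoTimes R ξ = g := by
    rw [hξ, optionEquivLeft_xi]
    ext1 k
    rw [hg, PowerSeries.coeff_mk, PowerSeries.coeff_mk]
    split_ifs
    · rw [two_mul, ← add_smul]
      norm_num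
    · rfl
  have hξs : PowerSeries.HasSubst ξ := by
    apply PowerSeries.HasSubst.of_constantCoeff_zero
    change (∑ᶠ j : OddPos, coeff 0 _) = _
    refine finsum_eq_zero_of_forall_eq_zero fun j => ?_
    simp
  have h1 : PowerSeries.coeff n ((PowerSeries.exp ℂ).subst g) =
      (rowQAt (fun k => leftTimes R k - rightTimes R k) n : MvPolynomial TwoTimes R) := by
    rw [hg, coeff_exp_subst_times (fun k => (1 / 2 : ℂ) • (X (Sum.inl k) - X (Sum.inr k)) :
      OddPos → MvPowerSeries TwoTimes R), ← polyToSeries_apply, map_rowQAt]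
    congr 1
    ext1 k
    simp only [leftTimes, rightTimes, map_sub, map_smul, polyToSeries_apply, MvPolynomial.coe_X,
      smul_sub]
  rw [← h1, spectralCoeff_eq]
  ext m
  rw [coeff_coeff_optionEquivLeft, expXi, formalExp, PowerSeries.coeff_subst hξs,
    PowerSeries.coeff_subst' hs]
  have h2 := map_finsum (coeff (R := R) m).toAddMonoidHom
    (PowerSeries.coeff_subst_finite' hs (PowerSeries.exp ℂ) n)
  refine Eq.trans (finsum_congr fun d => ?_) h2.symm
  change _ = coeff m (PowerSeries.coeff d (PowerSeries.exp ℂ) • PowerSeries.coeff n (g ^ d))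
  rw [← coeff_coeff_optionEquivLeft, map_pow, hξg]
  exact (map_smul ((coeff (R := R) m).restrictScalars ℂ) _ _).symm

variable (R) in
/-- The substitution `t_j → t_j - 2 z^j / j` in polynomials. -/
noncomputable def shiftLeft : MvPolynomial OddPos R →ₐ[R] Polynomial (MvPolynomial TwoTimes R) :=
  MvPolynomial.aeval fun j : OddPos => Polynomial.C (MvPolynomial.X (Sum.inl j)) -
    (2 / (j : ℂ)) • Polynomial.X ^ (j : ℕ)

variable (R) in
/-- The substitution `t_j → t'_j + 2 z^j / j` in polynomials. -/
noncomputable def shiftRight : MvPolynomial OddPos R →ₐ[R] Polynomial (MvPolynomial TwoTimes R) :=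
  MvPolynomial.aeval fun j : OddPos => Polynomial.C (MvPolynomial.X (Sum.inr j)) +
    (2 / (j : ℂ)) • Polynomial.X ^ (j : ℕ)

variable (R) in
/-- Polynomials in `z` over polynomials in `t, t'` as power series. -/
noncomputable def spectralToSeries :
    Polynomial (MvPolynomial TwoTimes R) →+* PowerSeries (MvPowerSeries TwoTimes R) :=
  (PowerSeries.map (polyToSeries R TwoTimes).toRingHom).comp Polynomial.coeToPowerSeries.ringHom

theorem coeff_spectralToSeries (p : Polynomial (MvPolynomial TwoTimes R)) (n : ℕ) :
    PowerSeries.coeff n (spectralToSeries R p) = (p.coeff n : MvPowerSeries TwoTimes R) := by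
  simp [spectralToSeries, polyToSeries_apply]

theorem spectralToSeries_smul_X_pow (a : ℂ) (j : ℕ) :
    spectralToSeries R (a • Polynomial.X ^ j) =
      optionEquivLeft TwoTimes R (a • X none ^ j) := by
  rw [Algebra.smul_def, Algebra.smul_def, map_mul, map_mul, map_pow, map_pow,
    optionEquivLeft_X_none]
  congr 1
  · rw [MvPowerSeries.algebraMap_apply, optionEquivLeft_C]
    ext n
    rw [coeff_spectralToSeries, Polynomial.algebraMap_apply, MvPolynomial.algebraMap_apply,
      Polynomial.coeff_C, PowerSeries.coeff_C]
    split_ifs <;> simp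
  · congr 1
    ext n
    rw [coeff_spectralToSeries, Polynomial.coeff_X, PowerSeries.coeff_X]
    split_ifs <;> simp_all

theorem spectralToSeries_C_X (i : TwoTimes) :
    spectralToSeries R (Polynomial.C (MvPolynomial.X i)) =
      optionEquivLeft TwoTimes R (X (some i)) := by
  ext n
  rw [coeff_spectralToSeries, optionEquivLeft_X_some, Polynomial.coeff_C, PowerSeries.coeff_C]
  split_ifs <;> simp

theorem optionEquivLeft_aeval (p : MvPolynomial OddPos R)
    (a : OddPos → MvPowerSeries (Option TwoTimes) R)
    (b : OddPos → Polynomial (MvPolynomial TwoTimes R))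
    (h : ∀ j, spectralToSeries R (b j) = optionEquivLeft TwoTimes R (a j)) :
    optionEquivLeft TwoTimes R (MvPolynomial.aeval a p) =
      spectralToSeries R (MvPolynomial.aeval b p) := by
  have : ((optionEquivLeft TwoTimes R).toRingEquiv.toRingHom.comp (MvPolynomial.aeval (R := R) a).toRingHom)
      = (spectralToSeries R).comp (MvPolynomial.aeval (R := R) b).toRingHom := by
    refine MvPolynomial.ringHom_ext (fun r => ?_) fun j => ?_
    · have h1 : optionEquivLeft TwoTimes R (algebraMap R _ r) = PowerSeries.C (C r) := by
        rw [MvPowerSeries.algebraMap_apply]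
        exact optionEquivLeft_C r
      simp only [RingHom.comp_apply, AlgHom.toRingHom_eq_coe, RingHom.coe_coe,
        MvPolynomial.aeval_C]
      refine h1.trans ?_
      ext n
      rw [coeff_spectralToSeries, Polynomial.algebraMap_apply, Polynomial.coeff_C,
        PowerSeries.coeff_C]
      split_ifs <;> simp
    · simpa using (h j).symm
  exact RingHom.congr_fun this p

theorem spectralCoeff_shiftedProduct (p : MvPolynomial OddPos R) (n : ℕ) :
    spectralCoeff n (shiftedProduct (p : MvPowerSeries OddPos R)) =
      ((shiftLeft R p * shiftRight R p).coeff n : MvPolynomial TwoTimes R) := by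
  rw [spectralCoeff_eq, shiftedProduct, subst_coe, subst_coe, map_mul,
    optionEquivLeft_aeval p _ (fun j : OddPos => Polynomial.C (MvPolynomial.X (Sum.inl j)) -
      (2 / (j : ℂ)) • Polynomial.X ^ (j : ℕ)),
    optionEquivLeft_aeval p _ (fun j : OddPos => Polynomial.C (MvPolynomial.X (Sum.inr j)) +
      (2 / (j : ℂ)) • Polynomial.X ^ (j : ℕ)), ← map_mul, coeff_spectralToSeries]
  · rfl
  · intro j
    rw [map_add, map_add, spectralToSeries_C_X, spectralToSeries_smul_X_pow]
  · intro j
    rw [map_sub, map_sub, spectralToSeries_C_X, spectralToSeries_smul_X_pow]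

theorem hasSubst_smul_X_none_pow (a : OddPos → ℂ) :
    HasSubst fun j : OddPos => (a j • X none ^ (j : ℕ) : MvPowerSeries (Option TwoTimes) R) where
  const_coeff j := by
    have : constantCoeff (a j • X none ^ (j : ℕ) : MvPowerSeries (Option TwoTimes) R) = 0 := by
      rw [Algebra.smul_def, map_mul, map_pow, constantCoeff_X, zero_pow j.2.pos.ne', mul_zero]
    rw [this]
    exact IsNilpotent.zero
  coeff_zero d := by
    classical
    refine Set.Subsingleton.finite fun i hi j hj => ?_
    have key : ∀ i : OddPos, coeff d (a i • X none ^ (i : ℕ) :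
        MvPowerSeries (Option TwoTimes) R) ≠ 0 → d = Finsupp.single none (i : ℕ) := by
      intro i hi
      by_contra hne
      apply hi
      rw [Algebra.smul_def, MvPowerSeries.algebraMap_apply, coeff_C_mul, coeff_X_pow, if_neg hne,
        mul_zero]
    have h := (key i hi).symm.trans (key j hj)
    exact Subtype.ext (by simpa using DFunLike.congr_fun h none)

theorem le_weightedOrder_X {S : Type*} [CommRing S] {σ : Type*} (w : σ → ℕ) (i : σ) :
    (w i : ℕ∞) ≤ (X i : MvPowerSeries σ S).weightedOrder w := by
  classical
  refine nat_le_weightedOrder w fun d hd => ?_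
  rw [coeff_X, if_neg]
  rintro rfl
  rw [Finsupp.weight_single] at hd
  simp at hd

theorem le_weightedOrder_smul_X_none_pow (a : ℂ) (j : ℕ) :
    (j : ℕ∞) ≤ (a • X none ^ j : MvPowerSeries (Option TwoTimes) R).weightedOrder
      spectralWeight := by
  classical
  refine nat_le_weightedOrder _ fun d hd => ?_
  rw [Algebra.smul_def, MvPowerSeries.algebraMap_apply, coeff_C_mul, coeff_X_pow, if_neg,
    mul_zero]
  rintro rfl
  rw [Finsupp.weight_single] at hd
  simp at hd

theorem hasSubst_X_comp {S : Type*} [CommRing S] {σ τ : Type*} {f : σ → τ} (hf : Function.Injective f) :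
    HasSubst fun j => (X (f j) : MvPowerSeries τ S) :=
  have := Filter.tendstoCofinite_of_injective hf
  HasSubst.X_comp f

/-- The spectral variable has weight 1, so z^j weighs as much as t_j and the shift respects weights.
-/
theorem agreeUpTo_shiftedProduct {W : ℕ} {τ τ' : MvPowerSeries OddPos R}
    (h : AgreeUpTo timeWeight W τ τ') :
    AgreeUpTo spectralWeight W (shiftedProduct τ) (shiftedProduct τ') := by
  have e : ∀ j : OddPos, ∀ x : MvPowerSeries (Option TwoTimes) R,
      x - (2 / (j : ℂ)) • X none ^ (j : ℕ) = x + (-2 / (j : ℂ)) • X none ^ (j : ℕ) := by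
    intro j x
    rw [neg_div, neg_smul, sub_eq_add_neg]
  have key : ∀ (i : OddPos → TwoTimes) (hi : Function.Injective i)
      (hw : ∀ j, twoTimesWeight (i j) = j) (a : OddPos → ℂ),
      AgreeUpTo spectralWeight W
        (τ.subst fun j => (X (some (i j)) + a j • X none ^ (j : ℕ) :
          MvPowerSeries (Option TwoTimes) R))
        (τ'.subst fun j => (X (some (i j)) + a j • X none ^ (j : ℕ) :
          MvPowerSeries (Option TwoTimes) R)) := by
    intro i hi hw a
    refine h.subst ?_ fun j => ?_
    · exact (hasSubst_X_comp (f := fun j => some (i j))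
        ((Option.some_injective _).comp hi)).add (hasSubst_smul_X_none_pow a)
    · refine le_trans (le_min ?_ ?_) (min_weightedOrder_le_add spectralWeight)
      · have := le_weightedOrder_X (S := R) spectralWeight (some (i j))
        simpa [hw] using this
      · exact le_weightedOrder_smul_X_none_pow _ _
  unfold shiftedProduct
  simp only [e]
  exact (key Sum.inl Sum.inl_injective (fun _ => rfl) _).mul
    (key Sum.inr Sum.inr_injective (fun _ => rfl) _)

/-- The `BKP` hierarchy for a polynomial. -/
def IsPolynomialBKP (p : MvPolynomial OddPos R) : Prop :=
  monomialFunctional (rowQAt fun k => leftTimes R k - rightTimes R k)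
    (shiftLeft R p * shiftRight R p) =
      MvPolynomial.rename Sum.inl p * MvPolynomial.rename Sum.inr p

theorem isWeightedHomogeneous_left_sub_right (k : OddPos) :
    (leftTimes R k - rightTimes R k).IsWeightedHomogeneous twoTimesWeight (k : ℕ) := by
  simp only [leftTimes, rightTimes, Algebra.smul_def, MvPolynomial.algebraMap_apply]
  exact ((MvPolynomial.isWeightedHomogeneous_X R twoTimesWeight (Sum.inl k)).C_mul _).sub
    ((MvPolynomial.isWeightedHomogeneous_X R twoTimesWeight (Sum.inr k)).C_mul _)

/-- A series all of whose truncations extend to polynomial solutions of `BKP` solves `BKP`. -/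
theorem isBKP_of_truncations {τ : MvPowerSeries OddPos R}
    (h : ∀ W, ∃ p : MvPolynomial OddPos R, AgreeUpTo timeWeight W τ p ∧ IsPolynomialBKP p) :
    IsBKP τ := by
  classical
  ext m
  obtain ⟨p, hp, hb⟩ := h (Finsupp.weight twoTimesWeight m)
  have hX : ∀ (i : OddPos → TwoTimes), Function.Injective i →
      (∀ j, twoTimesWeight (i j) = j) → AgreeUpTo twoTimesWeight (Finsupp.weight twoTimesWeight m)
        (τ.subst fun j => (X (i j) : MvPowerSeries TwoTimes R))
        (MvPolynomial.rename i p : MvPolynomial TwoTimes R) := by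
    intro i hi hw
    have h1 : (MvPolynomial.rename i p : MvPowerSeries TwoTimes R) =
        (p : MvPowerSeries OddPos R).subst fun j => (X (i j) : MvPowerSeries TwoTimes R) := by
      have := Filter.tendstoCofinite_of_injective hi
      rw [← rename_coe, rename_eq_subst]
      rfl
    rw [h1]
    refine hp.subst (hasSubst_X_comp hi) fun j => ?_
    have := le_weightedOrder_X (S := R) twoTimesWeight (i j)
    rwa [hw] at this
  have hr := (hX Sum.inl Sum.inl_injective fun _ => rfl).mul
    (hX Sum.inr Sum.inr_injective fun _ => rfl) m le_rfl
  rw [hr, ← MvPolynomial.coe_mul, ← hb]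
  have hl : ∀ n, coeff m (spectralCoeff n (expXi (R := R)) * spectralCoeff n (shiftedProduct τ)) =
      MvPolynomial.coeff m (rowQAt (fun k => leftTimes R k - rightTimes R k) n *
        (shiftLeft R p * shiftRight R p).coeff n) := by
    intro n
    rw [← MvPolynomial.coeff_coe, MvPolynomial.coe_mul, ← spectralCoeff_expXi,
      ← spectralCoeff_shiftedProduct, coeff_mul, coeff_mul]
    refine Finset.sum_congr rfl fun q hq => ?_
    -- The coefficient of kⁿ in the exponential is homogeneous of weight n. When it contributes, the
    -- monomial zⁿ times q.2 in the other factor has exactly the weight of m, so the truncation does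
    -- not affect it.
    by_cases h0 : coeff q.1 (spectralCoeff n (expXi (R := R))) = 0
    · rw [h0, zero_mul, zero_mul]
    congr 1
    rw [spectralCoeff_expXi, MvPolynomial.coeff_coe] at h0
    have hw := isWeightedHomogeneous_rowQAt isWeightedHomogeneous_left_sub_right n h0
    rw [spectralCoeff_eq, spectralCoeff_eq, coeff_coeff_optionEquivLeft,
      coeff_coeff_optionEquivLeft]
    refine agreeUpTo_shiftedProduct hp _ ?_
    rw [weight_optionElim, ← Finset.HasAntidiagonal.mem_antidiagonal.1 hq, map_add, hw]
  change (∑ᶠ n, coeff m _) = _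
  rw [finsum_congr hl, MvPolynomial.coeff_coe,
    monomialFunctional_apply _ (Nat.lt_succ_self _), MvPolynomial.coeff_sum]
  refine finsum_eq_sum_of_support_subset _ fun n hn => ?_
  rw [Finset.coe_range, Set.mem_Iio]
  by_contra hlt
  apply hn
  beta_reduce
  rw [Polynomial.coeff_eq_zero_of_natDegree_lt (by omega), mul_zero, MvPolynomial.coeff_zero]

end BKPTruncation

end SpinHurwitz

namespace SpinHurwitz

/-! ### Strict partitions as finite sets -/

section StrictPartition

theorem StrictPartition.nodup (l : StrictPartition) : l.parts.Nodup := by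
  have h := l.2
  rw [Nat.Partition.distincts, Finset.mem_filter] at h
  exact h.2

theorem StrictPartition.ext_parts {l l' : StrictPartition} (h : l.parts = l'.parts) : l = l' := by
  obtain ⟨⟨n, p⟩, hp⟩ := l
  obtain ⟨⟨n', p'⟩, hp'⟩ := l'
  change p.parts = p'.parts at h
  obtain rfl : n = n' := by rw [← p.parts_sum, ← p'.parts_sum, h]
  obtain rfl : p = p' := Nat.Partition.ext h
  rfl

/-- The set of rows of a strict partition, together with `0` if the number of rows is odd. -/
def rowSet (l : StrictPartition) : Finset ℕ :=
  if Even (Multiset.card l.parts) then ⟨l.parts, l.nodup⟩ else insert 0 ⟨l.parts, l.nodup⟩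

theorem zero_notMem_parts (l : StrictPartition) : 0 ∉ l.parts :=
  fun h => (l.1.2.parts_pos h).false

theorem rowSet_erase_zero (l : StrictPartition) : ((rowSet l).erase 0).val = l.parts := by
  rw [rowSet]
  have h0 : (0 : ℕ) ∉ (⟨l.parts, l.nodup⟩ : Finset ℕ) := zero_notMem_parts l
  split_ifs
  · rw [Finset.erase_eq_of_notMem h0]
  · rw [Finset.erase_insert h0]

theorem even_card_rowSet (l : StrictPartition) : Even (rowSet l).card := by
  rw [rowSet]
  have h0 : (0 : ℕ) ∉ (⟨l.parts, l.nodup⟩ : Finset ℕ) := zero_notMem_parts l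
  split_ifs with h
  · exact h
  · rw [Finset.card_insert_of_notMem h0]
    exact (Nat.not_even_iff_odd.1 h).add_one

/-- Strict partitions correspond to finite sets of natural numbers of even cardinality. -/
def rowSetEquiv : StrictPartition ≃ {E : Finset ℕ // Even E.card} where
  toFun l := ⟨rowSet l, even_card_rowSet l⟩
  invFun E := ⟨⟨(E.1.erase 0).val.sum, ⟨(E.1.erase 0).val, fun h =>
    Nat.pos_of_ne_zero (Finset.ne_of_mem_erase h), rfl⟩⟩,
      Finset.mem_filter.2 ⟨Finset.mem_univ _, (E.1.erase 0).nodup⟩⟩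
  left_inv l := StrictPartition.ext_parts (rowSet_erase_zero l)
  right_inv E := by
    obtain ⟨E, hE⟩ := E
    refine Subtype.ext ?_
    change (if Even (E.erase 0).card then E.erase 0 else insert 0 (E.erase 0)) = E
    by_cases h0 : 0 ∈ E
    · have := Finset.card_erase_add_one h0
      rw [if_neg (by grind), Finset.insert_erase h0]
    · rw [Finset.erase_eq_of_notMem h0, if_pos hE]

theorem evenRows_parts (l : StrictPartition) : evenRows l.parts = (rowSet l).sort (· ≥ ·) := by
  have h0 : (0 : ℕ) ∉ (⟨l.parts, l.nodup⟩ : Finset ℕ) := zero_notMem_parts l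
  rw [evenRows, rowSet]
  split_ifs
  · rfl
  · rw [sort_insert_zero h0]
    rfl

theorem sum_rowSet (l : StrictPartition) : ∑ n ∈ rowSet l, n = l.1.1 := by
  rw [← Finset.sum_erase (rowSet l) (f := fun n => n) (a := 0) rfl, Finset.sum,
    rowSet_erase_zero, Multiset.map_id']
  exact l.1.2.parts_sum

theorem prod_rowSet {M : Type*} [CommMonoid M] {d : ℕ → M} (hd : d 0 = 1) (l : StrictPartition) :
    ∏ n ∈ rowSet l, d n = (l.parts.map d).prod := by
  rw [← Finset.prod_erase (rowSet l) (a := 0) hd, Finset.prod, rowSet_erase_zero]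

end StrictPartition

/-! ### Sums of Q-polynomials with Pfaffian coefficients. -/

section Hypergeometric

open scoped symmDiff

theorem map_pfaffianOn {R S F : Type*} [CommRing R] [CommRing S] [FunLike F R S] [RingHomClass F R S] (g : F)
    (a : ℕ → ℕ → R) (E : Finset ℕ) :
    g (pfaffianOn a E) = pfaffianOn (fun n m => g (a n m)) E :=
  map_pfaffian a g _

theorem pfaffianOn_of_odd {R : Type*} [CommRing R] (a : ℕ → ℕ → R) {E : Finset ℕ} (hE : Odd E.card) :
    pfaffianOn a E = 0 :=
  pfaffian_of_odd a (by rwa [Finset.length_sort])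

variable {R : Type*} [CommRing R] [Algebra ℂ R]

theorem schurQAt_eq (l : StrictPartition) (c : OddPos → R) :
    schurQAt l.parts c = algebraMap ℂ R (((Real.sqrt 2 : ℝ) : ℂ) ^ Multiset.card l.parts)⁻¹ *
      pfaffianOn (pairPAt c) (rowSet l) := by
  rw [schurQAt, schurQ, map_mul, MvPolynomial.aeval_C, evenRows_parts, map_pfaffian]
  rfl

theorem map_schurQAt {S : Type*} [CommRing S] [Algebra ℂ S] (g : R →ₐ[ℂ] S) (l : Multiset ℕ)
    (c : OddPos → R) : g (schurQAt l c) = schurQAt l fun k => g (c k) := by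
  simp only [schurQAt, ← MvPolynomial.comp_aeval_apply]

theorem isWeightedHomogeneous_schurQAt {σ : Type*} {w : σ → ℕ} {c : OddPos → MvPolynomial σ R}
    (hc : ∀ k, (c k).IsWeightedHomogeneous w (k : ℕ)) (l : StrictPartition) :
    (schurQAt l.parts c).IsWeightedHomogeneous w l.1.1 := by
  rw [schurQAt_eq, MvPolynomial.algebraMap_apply, ← sum_rowSet]
  refine MvPolynomial.IsWeightedHomogeneous.C_mul ?_ _
  have := isWeightedHomogeneous_pfaffian (isWeightedHomogeneous_pairPAt hc)
    ((rowSet l).sort (· ≥ ·))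
  rwa [← Multiset.sum_coe, Finset.sort_eq, ← Multiset.map_id' (rowSet l).val] at this

theorem isWeightedHomogeneous_smul_X (a : ℂ) (k : OddPos) :
    (a • MvPolynomial.X k : MvPolynomial OddPos R).IsWeightedHomogeneous timeWeight (k : ℕ) := by
  rw [Algebra.smul_def, MvPolynomial.algebraMap_apply]
  exact (MvPolynomial.isWeightedHomogeneous_X R timeWeight k).C_mul _

/-- For every monomial, only finitely many `Q_λ`, `λ` strict, contain it. -/
theorem finite_coeff_schurQ_ne_zero (m : OddPos →₀ ℕ) :
    {l : StrictPartition | MvPolynomial.coeff m (schurQ l.parts) ≠ 0}.Finite := by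
  have hsub : {l : StrictPartition | MvPolynomial.coeff m (schurQ l.parts) ≠ 0} ⊆
      Set.range fun p : {p : (Finsupp.weight timeWeight m).Partition //
        p ∈ Nat.Partition.distincts (Finsupp.weight timeWeight m)} =>
          (⟨⟨Finsupp.weight timeWeight m, p.1⟩, p.2⟩ : StrictPartition) := by
    rintro l hl
    have h := isWeightedHomogeneous_schurQAt (R := ℂ) (c := MvPolynomial.X)
      (MvPolynomial.isWeightedHomogeneous_X ℂ timeWeight) l
    have h2 : schurQAt l.parts (MvPolynomial.X : OddPos → MvPolynomial OddPos ℂ) =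
        schurQ l.parts := by
      simp [schurQAt]
    rw [h2] at h
    obtain ⟨⟨n, p⟩, hp⟩ := l
    obtain rfl : Finsupp.weight timeWeight m = n := h hl
    exact ⟨⟨p, hp⟩, rfl⟩
  exact (Set.finite_range _).subset hsub

/-- `Q_λ(t / 2)` up to a constant, as a polynomial. -/
noncomputable def halfQ (R : Type*) [CommRing R] [Algebra ℂ R] (E : Finset ℕ) :
    MvPolynomial OddPos R :=
  pfaffianOn (pairPAt fun k => (1 / 2 : ℂ) • MvPolynomial.X k) E

theorem isWeightedHomogeneous_halfQ (E : Finset ℕ) :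
    (halfQ R E).IsWeightedHomogeneous timeWeight (∑ n ∈ E, n) := by
  have := isWeightedHomogeneous_pfaffian (isWeightedHomogeneous_pairPAt
    (isWeightedHomogeneous_smul_X (R := R) (1 / 2))) (E.sort (· ≥ ·))
  rwa [← Multiset.sum_coe, Finset.sort_eq, ← Multiset.map_id' E.val] at this

theorem shiftLeft_halfQ (E : Finset ℕ) :
    shiftLeft R (halfQ R E) = pfaffianOn (pairPAt (shiftedTimes (leftTimes R) 1)) E := by
  rw [halfQ, map_pfaffianOn]
  refine pfaffian_congr fun n _ m _ => ?_
  let g : MvPolynomial OddPos R →ₐ[ℂ] Polynomial (MvPolynomial TwoTimes R) :=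
    (shiftLeft R).restrictScalars ℂ
  have hg : ∀ x, shiftLeft R x = g x := fun _ => rfl
  rw [hg, map_pairPAt]
  refine congrArg (fun c => pairPAt c n m) ?_
  ext1 k
  rw [map_smul, ← hg, shiftLeft, MvPolynomial.aeval_X, smul_sub, smul_smul,
    shiftedTimes, map_one, one_mul, leftTimes, Polynomial.smul_C]
  congr 2
  ring

/-- Halving the times turns 2z^k/k into z^k/k, and since k is odd, adding [z] is subtracting [-z];
hence the parameter -1. -/
theorem shiftRight_halfQ (E : Finset ℕ) :
    shiftRight R (halfQ R E) = pfaffianOn (pairPAt (shiftedTimes (rightTimes R) (-1))) E := by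
  rw [halfQ, map_pfaffianOn]
  refine pfaffian_congr fun n _ m _ => ?_
  let g : MvPolynomial OddPos R →ₐ[ℂ] Polynomial (MvPolynomial TwoTimes R) :=
    (shiftRight R).restrictScalars ℂ
  have hg : ∀ x, shiftRight R x = g x := fun _ => rfl
  rw [hg, map_pairPAt]
  refine congrArg (fun c => pairPAt c n m) ?_
  ext1 k
  rw [map_smul, ← hg, shiftRight, MvPolynomial.aeval_X, smul_add,
    smul_smul, shiftedTimes, map_neg, map_one, neg_one_mul, k.2.neg_pow, smul_neg, sub_neg_eq_add,
    rightTimes, Polynomial.smul_C]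
  congr 2
  ring

theorem rename_halfQ {σ : Type*} (i : OddPos → σ) (E : Finset ℕ) :
    MvPolynomial.rename i (halfQ R E) =
      pfaffianOn (pairPAt fun k => (1 / 2 : ℂ) • (MvPolynomial.X (i k) : MvPolynomial σ R)) E := by
  rw [halfQ, map_pfaffianOn]
  congr 1
  ext1 n; ext1 m
  refine (map_pairPAt ((MvPolynomial.rename (R := R) i).restrictScalars ℂ) _ n m).trans ?_
  congr 1
  ext1 k
  rw [map_smul, AlgHom.restrictScalars_apply, MvPolynomial.rename_X]

/-- A finite sum of `Q`-polynomials with Pfaffian coefficients solves `BKP`. -/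
theorem isPolynomialBKP_sum_halfQ {a : ℕ → ℕ → R} (hd : ∀ n, a n n = 0)
    (ha : ∀ n m, a m n = -a n m) {U : Finset ℕ} (hU : 0 ∈ U) :
    IsPolynomialBKP (∑ E ∈ U.powerset, MvPolynomial.C (pfaffianOn a E) * halfQ R E) := by
  set K : R →+* MvPolynomial TwoTimes R := MvPolynomial.C
  have hK : ∀ E, K (pfaffianOn a E) = pfaffianOn (fun n m => K (a n m)) E :=
    fun E => map_pfaffianOn K a E
  have hC : ∀ r, algebraMap R (Polynomial (MvPolynomial TwoTimes R)) r = Polynomial.C (K r) := by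
    intro r
    rw [Polynomial.algebraMap_apply]
    rfl
  rw [IsPolynomialBKP]
  simp only [map_sum, map_mul, MvPolynomial.rename_C, rename_halfQ, shiftLeft_halfQ,
    shiftRight_halfQ]
  have h1 : ∀ r, shiftLeft R (MvPolynomial.C r) = Polynomial.C (K r) := fun r => by
    rw [shiftLeft, MvPolynomial.aeval_C, hC]
  have h2 : ∀ r, shiftRight R (MvPolynomial.C r) = Polynomial.C (K r) := fun r => by
    rw [shiftRight, MvPolynomial.aeval_C, hC]
  simp only [h1, h2, Finset.sum_mul_sum, map_sum]
  have h3 : ∀ E F : Finset ℕ, monomialFunctional (rowQAt fun k => leftTimes R k - rightTimes R k)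
      (Polynomial.C (K (pfaffianOn a E)) * pfaffianOn (pairPAt (shiftedTimes (leftTimes R) 1)) E *
        (Polynomial.C (K (pfaffianOn a F)) *
          pfaffianOn (pairPAt (shiftedTimes (rightTimes R) (-1))) F)) =
      K (pfaffianOn a E) * pfaffianOn (pairPAt (leftTimes R)) E *
        (K (pfaffianOn a F) * pfaffianOn (pairPAt (rightTimes R)) F) +
      2 * (K (pfaffianOn a E) * K (pfaffianOn a F) * ∑ n ∈ (E ∆ {0}) ∆ (F ∆ {0}),
        posSign _ n (E ∆ {0}) * posSign _ n (F ∆ {0}) *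
          (pfaffianOn (pairPAt (leftTimes R)) (E ∆ {0} ∆ {n}) *
            pfaffianOn (pairPAt (rightTimes R)) (F ∆ {0} ∆ {n}))) := by
    -- Sets of odd size have vanishing Pfaffian. They may therefore be kept in the sum, which leaves
    -- the index set stable under toggling a row.
    intro E F
    rcases Nat.even_or_odd E.card with hE | hE
    · rcases Nat.even_or_odd F.card with hF | hF
      · have h := monomialFunctional_pfaffianOn (leftTimes R) (rightTimes R) hE hF
        have e : Polynomial.C (K (pfaffianOn a E)) *
            pfaffianOn (pairPAt (shiftedTimes (leftTimes R) 1)) E *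
            (Polynomial.C (K (pfaffianOn a F)) *
              pfaffianOn (pairPAt (shiftedTimes (rightTimes R) (-1))) F) =
            (K (pfaffianOn a E) * K (pfaffianOn a F)) •
              (pfaffianOn (pairPAt (shiftedTimes (leftTimes R) 1)) E *
                pfaffianOn (pairPAt (shiftedTimes (rightTimes R) (-1))) F) := by
          rw [Polynomial.smul_eq_C_mul, Polynomial.C_mul]
          ring
        rw [e, map_smul, h, smul_eq_mul]
        ring
      · simp [pfaffianOn_of_odd a hF]
    · simp [pfaffianOn_of_odd a hE]
  simp only [h3, Finset.sum_add_distrib, ← Finset.mul_sum]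
  have h4 : ∑ E ∈ U.powerset, ∑ F ∈ U.powerset, (K (pfaffianOn a E) * K (pfaffianOn a F) *
      ∑ n ∈ (E ∆ {0}) ∆ (F ∆ {0}), posSign _ n (E ∆ {0}) * posSign _ n (F ∆ {0}) *
          (pfaffianOn (pairPAt (leftTimes R)) (E ∆ {0} ∆ {n}) *
            pfaffianOn (pairPAt (rightTimes R)) (F ∆ {0} ∆ {n}))) = 0 := by
    -- Replacing E and F by E ∆ {0} and F ∆ {0}, possible because 0 lies in U, puts the exchange
    -- terms in the form of `sum_exchange_eq_zero`.
    rw [← sum_powerset_symmDiff_singleton hU]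
    simp_rw [← sum_powerset_symmDiff_singleton hU (fun F => K (pfaffianOn a _) *
      K (pfaffianOn a F) * _)]
    simp only [symmDiff_symmDiff_cancel_right, hK]
    exact sum_exchange_eq_zero (fun n => by rw [hd, map_zero])
      (fun n m => by rw [ha, map_neg]) U _ _
  rw [h4, mul_zero, add_zero]
  rfl

end Hypergeometric

end SpinHurwitz

namespace SpinHurwitz

/-! ### Hypergeometric series as Pfaffian sums, and their rescaling. -/

section Tau

variable {R : Type*} [CommRing R] [Algebra ℂ R]

open MvPowerSeries

/-- In `contentProduct` the parts are coerced to integers as a whole multiset, through the monad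
structure; here the coercion is moved inside the map. -/
theorem contentProduct_eq {S : Type*} [CommRing S] (r : ℤ → S) (l : Multiset ℕ) :
    contentProduct r l = (l.map fun n : ℕ => ∏ j ∈ Finset.Icc (1 : ℤ) n, r j).prod := by
  rw [contentProduct]
  congr 1
  have : (do let a ← l; pure (a : ℤ)) = l.map fun n : ℕ => (n : ℤ) := by
    simp [Multiset.bind_def, Multiset.pure_def]
  rw [this, Multiset.map_map]
  rfl

/-- The diagonal factors by which the weights of a hypergeometric series enter its Pfaffians. -/
noncomputable def rowFactor (r : ℤ → R) (n : ℕ) : R :=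
  if n = 0 then 1 else algebraMap ℂ R (1 / 2) * ∏ j ∈ Finset.Icc (1 : ℤ) n, r j

/-- The antisymmetric matrix whose Pfaffians are the coefficients of a hypergeometric series. -/
noncomputable def coeffMatrix (r : ℤ → R) (β : OddPos → R) (n m : ℕ) : R :=
  rowFactor r n * rowFactor r m * pairPAt (fun k => (1 / 2 : ℂ) • β k) n m

theorem schurQAt_half_X (l : StrictPartition) :
    schurQAt l.parts (fun k => (1 / 2 : ℂ) • (X k : MvPowerSeries OddPos R)) =
      C (algebraMap ℂ R (((Real.sqrt 2 : ℝ) : ℂ) ^ Multiset.card l.parts)⁻¹) *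
        (halfQ R (rowSet l) : MvPowerSeries OddPos R) := by
  rw [schurQAt_eq, halfQ, ← polyToSeries_apply, map_pfaffianOn, MvPowerSeries.algebraMap_apply]
  congr 1
  refine pfaffian_congr fun n _ m _ => ?_
  rw [map_pairPAt]
  refine congrArg (fun c => pairPAt c n m) ?_
  ext1 k
  rw [map_smul, polyToSeries_apply, MvPolynomial.coe_X]

/-- Content products and the factors 1/2 are both products over nonzero rows, hence a diagonal
rescaling of the matrix. The padding row has factor 1. The power of 1/2 is the product of the
normalisations 2^{-ℓ/2} of the two Q's. -/
theorem pfaffianOn_coeffMatrix (r : ℤ → R) (β : OddPos → R) (l : StrictPartition) :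
    pfaffianOn (coeffMatrix r β) (rowSet l) = contentProduct r l.parts *
      (algebraMap ℂ R (1 / 2) ^ Multiset.card l.parts *
        pfaffianOn (pairPAt fun k => (1 / 2 : ℂ) • β k) (rowSet l)) := by
  have h : pfaffianOn (coeffMatrix r β) (rowSet l) = (∏ n ∈ rowSet l, rowFactor r n) *
      pfaffianOn (pairPAt fun k => (1 / 2 : ℂ) • β k) (rowSet l) := by
    rw [pfaffianOn, pfaffianOn, Finset.prod, ← Finset.sort_eq (rowSet l) (· ≥ ·),
      Multiset.map_coe, Multiset.prod_coe]
    exact pfaffian_scale (rowFactor r) _ _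
  rw [h, prod_rowSet (by simp [rowFactor]), ← mul_assoc]
  congr 1
  rw [contentProduct_eq, ← Multiset.prod_replicate, ← Multiset.map_const', ← Multiset.prod_map_mul]
  congr 1
  refine Multiset.map_congr rfl fun n hn => ?_
  rw [rowFactor, if_neg fun h : n = 0 => zero_notMem_parts l (h ▸ hn), mul_comm]

theorem sqrt_two_pow_inv_mul_self (n : ℕ) :
    (((Real.sqrt 2 : ℝ) : ℂ) ^ n)⁻¹ * (((Real.sqrt 2 : ℝ) : ℂ) ^ n)⁻¹ = (1 / 2) ^ n := by
  have h : ((Real.sqrt 2 : ℝ) : ℂ) * ((Real.sqrt 2 : ℝ) : ℂ) = 2 := by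
    rw [← Complex.ofReal_mul, Real.mul_self_sqrt (by norm_num)]
    norm_num
  rw [← mul_inv, ← mul_pow, h, one_div, inv_pow]

theorem hypergeometricTau_eq (r : ℤ → R) (β : OddPos → R) :
    hypergeometricTau r β = formalSum fun l : StrictPartition =>
      C (pfaffianOn (coeffMatrix r β) (rowSet l)) *
        (halfQ R (rowSet l) : MvPowerSeries OddPos R) := by
  rw [hypergeometricTau, weightedQSeries]
  congr 1
  ext1 l
  simp only [inv_one, Units.val_one, one_mul, map_one]
  rw [schurQAt_half_X, schurQAt_eq, pfaffianOn_coeffMatrix, ← map_pow, ← sqrt_two_pow_inv_mul_self,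
    ← mul_assoc, ← map_mul]
  congr 2
  rw [map_mul]
  ring

theorem coeff_hypergeometricTau (r : ℤ → R) (β : OddPos → R) {m : OddPos →₀ ℕ} {W : ℕ}
    (hm : Finsupp.weight timeWeight m ≤ W) :
    coeff m (hypergeometricTau r β) =
      MvPolynomial.coeff m (∑ E ∈ (Finset.range (W + 1)).powerset,
        MvPolynomial.C (pfaffianOn (coeffMatrix r β) E) * halfQ R E) := by
  rw [hypergeometricTau_eq]
  set F : Finset ℕ → R := fun E =>
    pfaffianOn (coeffMatrix r β) E * MvPolynomial.coeff m (halfQ R E) with hF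
  have h1 : coeff m (formalSum fun l : StrictPartition =>
      C (pfaffianOn (coeffMatrix r β) (rowSet l)) *
        (halfQ R (rowSet l) : MvPowerSeries OddPos R)) = ∑ᶠ l, F (rowSetEquiv l).1 := by
    refine finsum_congr fun l => ?_
    rw [coeff_C_mul, MvPolynomial.coeff_coe]
    rfl
  rw [h1, finsum_comp_equiv rowSetEquiv (f := fun E => F E.1),
    finsum_subtype_eq_finsum_cond (f := F) (p := fun E : Finset ℕ => Even E.card),
    MvPolynomial.coeff_sum]
  have h2 : ∀ E : Finset ℕ, (∑ᶠ _ : Even E.card, F E) = F E := by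
    intro E
    rcases Nat.even_or_odd E.card with h | h
    · simp [h]
    · simp [hF, pfaffianOn_of_odd _ h]
  rw [finsum_congr h2]
  simp only [MvPolynomial.coeff_C_mul]
  -- A Q-polynomial containing m has weight equal to the sum of E, so no row of E exceeds W.
  refine finsum_eq_sum_of_support_subset _ fun E hE => ?_
  rw [Finset.mem_coe, Finset.mem_powerset]
  intro n hn
  have h3 : MvPolynomial.coeff m (halfQ R E) ≠ 0 := fun h => hE (by simp [h])
  have h4 := isWeightedHomogeneous_halfQ E h3
  have h5 : n ≤ ∑ n ∈ E, n := Finset.single_le_sum (f := fun n => n) (fun _ _ => Nat.zero_le _) hn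
  rw [Finset.mem_range]
  omega

/-- Hypergeometric series solve the `BKP` hierarchy. -/
theorem isBKP_hypergeometricTau (r : ℤ → R) (β : OddPos → R) : IsBKP (hypergeometricTau r β) := by
  refine isBKP_of_truncations fun W => ⟨_, fun m hm => ?_,
    isPolynomialBKP_sum_halfQ (a := coeffMatrix r β) (fun n => ?_) (fun n m => ?_)
      (U := Finset.range (W + 1)) (by simp)⟩
  · rw [coeff_hypergeometricTau r β hm, MvPolynomial.coeff_coe]
  · rw [coeffMatrix, pairPAt_self, mul_zero]
  · rw [coeffMatrix, pairPAt_antisymm, coeffMatrix]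
    ring

theorem rescale_formalSum {S ι σ : Type*} [CommRing S] (a : σ → S) (f : ι → MvPowerSeries σ S)
    (h : ∀ m, {i | coeff m (f i) ≠ 0}.Finite) :
    rescale a (formalSum f) = formalSum fun i => rescale a (f i) := by
  ext m
  rw [coeff_rescale]
  change _ * (∑ᶠ i, coeff m (f i)) = ∑ᶠ i, coeff m (rescale a (f i))
  rw [mul_finsum' _ _ (h m)]
  exact finsum_congr fun i => (coeff_rescale _ _ _).symm

theorem finite_coeff_ne_zero (f : StrictPartition → R) (a : ℂ) (m : OddPos →₀ ℕ) :
    {l : StrictPartition | coeff m (C (f l) *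
      schurQAt l.parts fun k => a • (X k : MvPowerSeries OddPos R)) ≠ 0}.Finite := by
  have hsub : ∀ l : StrictPartition, coeff m (C (f l) *
      schurQAt l.parts fun k => a • (X k : MvPowerSeries OddPos R)) ≠ 0 →
        Finsupp.weight timeWeight m = l.1.1 := by
    intro l hl
    have h := isWeightedHomogeneous_schurQAt (isWeightedHomogeneous_smul_X (R := R) a) l
    refine h fun h0 => hl ?_
    have h1 : schurQAt l.parts (fun k => a • (X k : MvPowerSeries OddPos R)) =
        polyToSeries R OddPos (schurQAt l.parts fun k => a • MvPolynomial.X k) := by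
      rw [map_schurQAt]
      congr 1
      ext1 k
      rw [map_smul, polyToSeries_apply, MvPolynomial.coe_X]
    rw [coeff_C_mul, h1, polyToSeries_apply, MvPolynomial.coeff_coe, h0, mul_zero]
  refine (Set.finite_range fun p : {p : (Finsupp.weight timeWeight m).Partition //
        p ∈ Nat.Partition.distincts (Finsupp.weight timeWeight m)} =>
          (⟨⟨Finsupp.weight timeWeight m, p.1⟩, p.2⟩ : StrictPartition)).subset fun l hl => ?_
  have h := hsub l hl
  obtain ⟨⟨n, p⟩, hp⟩ := l
  obtain rfl : Finsupp.weight timeWeight m = n := h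
  exact ⟨⟨p, hp⟩, rfl⟩

theorem rescale_schurQAt (h : R) (l : Multiset ℕ) :
    rescale (fun _ => h) (schurQAt l fun k => (1 / 2 : ℂ) • (X k : MvPowerSeries OddPos R)) =
      schurQAt l fun k => (1 / 2 : ℂ) • (C h * X k : MvPowerSeries OddPos R) := by
  let g : MvPowerSeries OddPos R →ₐ[ℂ] MvPowerSeries OddPos R :=
    (rescaleAlgHom (fun _ : OddPos => h)).restrictScalars ℂ
  have hg : ∀ x, rescale (fun _ => h) x = g x := fun x =>
    (rescaleAlgHom_apply (fun _ : OddPos => h) x).symm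
  rw [hg, map_schurQAt]
  refine congrArg (schurQAt l) (funext fun k => ?_)
  rw [map_smul, ← hg]
  congr 1
  classical
  ext m
  rw [coeff_rescale, coeff_C_mul, coeff_X]
  split_ifs with hm
  · simp [hm]
  · simp

/-- The deformed series is the hypergeometric series at rescaled times. -/
theorem weightedQSeries_eq_scaledHypergeometricTau (ħ : Rˣ) (w : StrictPartition → R)
    (r : ℤ → R) (h : ∀ l : StrictPartition, w l = contentProduct r l.parts) (β : OddPos → R) :
    weightedQSeries ħ w β = scaledHypergeometricTau ħ r β := by
  rw [scaledHypergeometricTau, timesOver, hypergeometricTau, weightedQSeries, weightedQSeries]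
  simp only [inv_one, Units.val_one, one_mul, map_one]
  rw [rescale_formalSum _ _ (finite_coeff_ne_zero _ (1 / 2))]
  congr 1
  ext1 l
  rw [map_mul (rescale _), rescale_schurQAt, h l]
  congr 1
  ext m
  rw [coeff_rescale]
  classical
  rw [coeff_C]
  split_ifs with hm
  · simp [hm]
  · simp

theorem isHbarBKP_scaledHypergeometricTau (ħ : Rˣ) (r : ℤ → R) (β : OddPos → R) :
    IsHbarBKP ħ (scaledHypergeometricTau ħ r β) := by
  rw [IsHbarBKP, scaledHypergeometricTau, timesOver, rescale_rescale]
  have : ((fun _ => ((ħ⁻¹ : Rˣ) : R)) * fun _ => (ħ : R) : OddPos → R) = 1 := by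
    ext k
    simp
  rw [this, rescale_one]
  exact isBKP_hypergeometricTau _ _

theorem prod_Icc_eq_of_succ {M : Type*} [CommMonoid M] (f : ℤ → M) (g : ℕ → M) (h0 : g 0 = 1)
    (h : ∀ n : ℕ, g (n + 1) = g n * f (n + 1)) (m : ℕ) :
    ∏ j ∈ Finset.Icc (1 : ℤ) m, f j = g m := by
  induction m with
  | zero => simp [h0]
  | succ m ih =>
    have : Finset.Icc (1 : ℤ) (m + 1 : ℕ) = insert ((m : ℤ) + 1) (Finset.Icc (1 : ℤ) m) := by
      ext j
      simp only [Finset.mem_Icc, Finset.mem_insert]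
      push_cast
      omega
    rw [this, Finset.prod_insert (by simp), ih, h, mul_comm]

end Tau

end SpinHurwitz

namespace SpinHurwitz

/-! ### Exponential weights -/

theorem boxCasimir_one_sub {k : ℕ} (hk : Odd k) (n : ℤ) :
    boxCasimir k (1 - n) = boxCasimir k n := by
  rw [boxCasimir, boxCasimir, show 1 - n - 1 = -n by ring, show 1 - n = -(n - 1) by ring,
    hk.neg_pow, hk.neg_pow]
  ring

theorem boxCasimir_succ (k n : ℕ) : boxCasimir k (n + 1) = (n + 1 : ℤ) ^ k - n ^ k := by
  simp [boxCasimir]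

@[simp] theorem casimir_zero (k : ℕ) : casimir k 0 = 0 := rfl

@[simp] theorem casimir_cons (k n : ℕ) (l : Multiset ℕ) :
    casimir k (n ::ₘ l) = n ^ k + casimir k l := by simp [casimir]

/-- An exponential of the power sums of the rows is a product over the contents. -/
theorem contentProduct_eq_of_succ {R : Type*} [CommRing R] {r : ℤ → R} {F : Multiset ℕ → R}
    (h0 : F 0 = 1) (hc : ∀ n l, F (n ::ₘ l) = F {n} * F l) (h1 : F {0} = 1)
    (hr : ∀ n : ℕ, F {n + 1} = F {n} * r (n + 1)) (l : Multiset ℕ) :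
    F l = contentProduct r l := by
  rw [contentProduct_eq]
  induction l using Multiset.induction_on with
  | empty => simpa using h0
  | cons n l ih =>
    rw [hc, ih, Multiset.map_cons, Multiset.prod_cons,
      prod_Icc_eq_of_succ r (fun n => F {n}) h1 hr]

section Numerical

variable {u : OddPos → ℂ}

/-- With an integer N at least 1 and at least ‖ħ‖, the terms are dominated by those of the
undeformed series at the integer N * n, where summability is assumed. -/
theorem summable_deformed
    (hu : ∀ n : ℕ, Summable fun k : OddPos => u k * (n : ℂ) ^ (k : ℕ))
    (ħ : ℂ) (n : ℕ) :
    Summable fun k : OddPos => u k * (ħ ^ ((k : ℕ) - 1) * (n : ℂ) ^ (k : ℕ)) := by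
  obtain ⟨N, hN⟩ := exists_nat_ge (max 1 ‖ħ‖)
  have hN1 : (1 : ℝ) ≤ N := (le_max_left _ _).trans hN
  have hN2 : ‖ħ‖ ≤ N := (le_max_right _ _).trans hN
  refine Summable.of_norm_bounded (hu (N * n)).norm fun k => ?_
  rw [norm_mul, norm_mul, norm_mul, norm_pow, norm_pow, norm_pow]
  push_cast
  rw [norm_mul, mul_pow, Complex.norm_natCast, Complex.norm_natCast]
  gcongr
  calc ‖ħ‖ ^ ((k : ℕ) - 1) ≤ (N : ℝ) ^ ((k : ℕ) - 1) := by gcongr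
    _ ≤ (N : ℝ) ^ (k : ℕ) := pow_le_pow_right₀ hN1 (Nat.sub_le _ _)

theorem summable_casimir
    (hu : ∀ n : ℕ, Summable fun k : OddPos => u k * (n : ℂ) ^ (k : ℕ))
    (ħ : ℂ) (l : Multiset ℕ) :
    Summable fun k : OddPos => u k * (ħ ^ ((k : ℕ) - 1) * (casimir k l : ℂ)) := by
  induction l using Multiset.induction_on with
  | empty => simp [summable_zero]
  | cons n l ih =>
    convert (summable_deformed hu ħ n).add ih using 2 with k
    rw [casimir_cons]
    push_cast
    ring

theorem numWeight_eq_contentProduct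
    (hu : ∀ n : ℕ, Summable fun k : OddPos => u k * (n : ℂ) ^ (k : ℕ))
    (ħ : ℂ) (l : Multiset ℕ) :
    numWeight u ħ l = contentProduct (numBox u ħ) l := by
  refine contentProduct_eq_of_succ (F := numWeight u ħ) ?_ ?_ ?_ ?_ l
  · simp [numWeight, numExp]
  · intro n l
    rw [numWeight, numWeight, numWeight, numExp, numExp, numExp, ← Complex.exp_add,
      ← (summable_casimir hu ħ {n}).tsum_add (summable_casimir hu ħ l)]
    congr 2
    ext k
    rw [casimir_cons, ← Multiset.cons_zero, casimir_cons, casimir_zero]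
    push_cast
    ring
  · have : ∀ k : OddPos, casimir k {0} = 0 := fun k => by
      rw [← Multiset.cons_zero, casimir_cons, casimir_zero, zero_pow k.2.pos.ne']
    simp [numWeight, numExp, this]
  · intro n
    have h : ∀ k : OddPos, u k * (ħ ^ ((k : ℕ) - 1) * (boxCasimir k (n + 1) : ℂ)) =
        u k * (ħ ^ ((k : ℕ) - 1) * (casimir k {n + 1} : ℂ)) -
          u k * (ħ ^ ((k : ℕ) - 1) * (casimir k {n} : ℂ)) := fun k => by
      rw [boxCasimir_succ, ← Multiset.cons_zero, casimir_cons, casimir_zero,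
        ← Multiset.cons_zero, casimir_cons, casimir_zero]
      push_cast
      ring
    rw [numWeight, numWeight, numBox, numExp, numExp, numExp, ← Complex.exp_add, tsum_congr h,
      (summable_casimir hu ħ {n + 1}).tsum_sub (summable_casimir hu ħ {n}), add_sub_cancel]

end Numerical

theorem numBox_one_sub (u : OddPos → ℂ) (ħ : ℂ) (n : ℤ) :
    numBox u ħ n = numBox u ħ (1 - n) := by
  rw [numBox, numBox]
  congr 1
  ext k
  rw [boxCasimir_one_sub k.2]

theorem numBox_one (u : OddPos → ℂ) (n : ℤ) :
    numBox u 1 n = numExp u fun k => (boxCasimir k n : ℂ) := by simp [numBox]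

theorem numWeight_one (u : OddPos → ℂ) (l : Multiset ℕ) :
    numWeight u 1 l = numExp u fun k => (casimir k l : ℂ) := by simp [numWeight]

/-! ### Exponentials of formal series and formal parameters. -/

section FormalExp

variable {σ R : Type*} [CommRing R] [Algebra ℂ R]

open MvPowerSeries

/-- The universal case of the addition theorem, equivalent to the factorial form of the binomial
coefficients; `formalExp_add` specialises the two variables. -/
theorem exp_subst_X_add_X :
    (PowerSeries.exp ℂ).subst (X 0 + X 1 : MvPowerSeries (Fin 2) ℂ) =
      (PowerSeries.exp ℂ).subst (X 0 : MvPowerSeries (Fin 2) ℂ) *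
        (PowerSeries.exp ℂ).subst (X 1 : MvPowerSeries (Fin 2) ℂ) := by
  ext e
  rw [PowerSeries.coeff_subst_X_zero_add_X_one, PowerSeries.coeff_subst_X_zero_subst_mul_X_one]
  simp only [PowerSeries.coeff_exp, eq_ratCast]
  rw [Nat.cast_choose ℂ (Nat.le_add_right _ _), Nat.add_sub_cancel_left]
  have := Nat.factorial_ne_zero (e 0 + e 1)
  push_cast
  field_simp

theorem formalExp_add {f g : MvPowerSeries σ R} (hf : constantCoeff f = 0)
    (hg : constantCoeff g = 0) : formalExp (f + g) = formalExp f * formalExp g := by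
  have hb : HasSubst ![f, g] := hasSubst_of_constantCoeff_zero fun i => by
    fin_cases i <;> simp [hf, hg]
  have h := congrArg (MvPowerSeries.subst ![f, g]) exp_subst_X_add_X
  have hs : ∀ {a : MvPowerSeries (Fin 2) ℂ}, constantCoeff a = 0 →
      subst ![f, g] ((PowerSeries.exp ℂ).subst a) = (PowerSeries.exp ℂ).subst (subst ![f, g] a) :=
    fun h => subst_comp_subst_apply (PowerSeries.HasSubst.of_constantCoeff_zero h).const hb _
  rw [subst_mul hb, hs (by simp), hs (by simp), hs (by simp), subst_add hb, subst_X hb,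
    subst_X hb] at h
  simpa [formalExp] using h

theorem formalExp_zero : formalExp (0 : MvPowerSeries σ R) = 1 := by
  ext m
  rw [formalExp, PowerSeries.coeff_subst PowerSeries.HasSubst.zero, finsum_eq_single _ 0]
  · simp
  · intro d hd
    simp [hd]

end FormalExp

section Variables

variable {A : Type*} [CommRing A] [Algebra ℂ A]

open MvPowerSeries

theorem coeff_varExponent {A : Type*} [CommRing A] (c : OddPos → A) (m : OddPos →₀ ℕ) :
    coeff m (formalSum fun k : OddPos => C (c k) * X k) =
      ∑ k ∈ m.support, c k * coeff m (X k) := by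
  classical
  change (∑ᶠ k, coeff m (C (c k) * X k)) = _
  simp only [coeff_C_mul]
  refine finsum_eq_sum_of_support_subset _ fun k hk => ?_
  by_contra hkm
  apply hk
  beta_reduce
  rw [coeff_X, if_neg, mul_zero]
  rintro rfl
  simp at hkm

theorem varExp_add (c c' : OddPos → A) :
    varExp (fun k => c k + c' k) = varExp c * varExp c' := by
  have h : (formalSum fun k : OddPos => C (c k + c' k) * X k) =
      (formalSum fun k : OddPos => C (c k) * X k) + formalSum fun k : OddPos => C (c' k) * X k := by
    ext m
    simp only [map_add (coeff m), coeff_varExponent, add_mul, Finset.sum_add_distrib]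
  have h0 : ∀ c : OddPos → A,
      constantCoeff (formalSum fun k : OddPos => C (c k) * X k) = 0 := fun c => by
    rw [← coeff_zero_eq_constantCoeff_apply, coeff_varExponent]
    simp
  rw [varExp, h, formalExp_add (h0 c) (h0 c')]
  rfl

theorem varExp_zero : varExp (fun _ => (0 : A)) = 1 := by
  have h : (formalSum fun k : OddPos => C (0 : A) * X k) = 0 := by
    ext m
    rw [coeff_varExponent fun _ => 0]
    simp
  rw [varExp, h, formalExp_zero]

theorem varWeight_eq_contentProduct (ħ : A) (l : Multiset ℕ) :
    varWeight ħ l = contentProduct (varBox ħ) l := by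
  refine contentProduct_eq_of_succ (F := varWeight ħ) ?_ ?_ ?_ ?_ l
  · simp [varWeight, varExp_zero]
  · intro n l
    rw [varWeight, varWeight, varWeight, ← varExp_add]
    congr 1
    ext k
    rw [casimir_cons, ← Multiset.cons_zero, casimir_cons, casimir_zero]
    push_cast
    ring
  · have : ∀ k : OddPos, casimir k {0} = 0 := fun k => by
      rw [← Multiset.cons_zero, casimir_cons, casimir_zero, zero_pow k.2.pos.ne']
    simp [varWeight, varExp_zero, this]
  · intro n
    rw [varWeight, varWeight, varBox, ← varExp_add]
    congr 1
    ext k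
    rw [boxCasimir_succ, ← Multiset.cons_zero, casimir_cons, casimir_zero,
      ← Multiset.cons_zero, casimir_cons, casimir_zero]
    push_cast
    ring

theorem varBox_one_sub (ħ : A) (n : ℤ) : varBox ħ n = varBox ħ (1 - n) := by
  rw [varBox, varBox]
  congr 1
  ext k
  rw [boxCasimir_one_sub k.2]

theorem oneVarExp_add (c c' : A) : oneVarExp (c + c') = oneVarExp c * oneVarExp c' := by
  rw [oneVarExp, map_add, add_mul]
  have h0 : ∀ c : A, PowerSeries.constantCoeff (PowerSeries.C c * PowerSeries.X) = 0 := by simp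
  exact formalExp_add (R := A) (σ := Unit) (h0 c) (h0 c')

theorem oneVarExp_zero : oneVarExp (0 : A) = 1 := by
  rw [oneVarExp, map_zero, zero_mul]
  exact formalExp_zero

theorem cycleWeight_eq_contentProduct (r : ℕ) (ħ : A) (l : Multiset ℕ) :
    cycleWeight r ħ l = contentProduct (cycleBox r ħ) l := by
  refine contentProduct_eq_of_succ (F := cycleWeight r ħ) ?_ ?_ ?_ ?_ l
  · simp [cycleWeight, oneVarExp_zero]
  · intro n l
    rw [cycleWeight, cycleWeight, cycleWeight, ← oneVarExp_add, ← mul_add, ← map_add, ← add_div,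
      casimir_cons, ← Multiset.cons_zero, casimir_cons, casimir_zero]
    push_cast
    rw [add_zero]
  · rw [cycleWeight, ← Multiset.cons_zero, casimir_cons, casimir_zero]
    simp [oneVarExp_zero]
  · intro n
    rw [cycleWeight, cycleWeight, cycleBox, ← oneVarExp_add, ← mul_add, ← map_add, ← add_div,
      boxCasimir_succ, ← Multiset.cons_zero, casimir_cons, casimir_zero,
      ← Multiset.cons_zero, casimir_cons, casimir_zero]
    push_cast
    congr 4
    ring

theorem cycleBox_one_sub {r : ℕ} (hr : Even r) (ħ : A) (n : ℤ) :
    cycleBox r ħ n = cycleBox r ħ (1 - n) := by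
  rw [cycleBox, cycleBox, boxCasimir_one_sub hr.add_one]

end Variables

end SpinHurwitz

namespace SpinHurwitz

/-! ### Interpolation by odd power series -/

section Interpolation

open Polynomial

/-- An odd polynomial with zeros at `0, …, N`, a given value at `N + 1` and coefficients which
are small at radius `N`. -/
theorem exists_odd_polynomial (N : ℕ) (v : ℂ) {ε : ℝ} (hε : 0 < ε) :
    ∃ p : ℂ[X], (∀ k, Even k → p.coeff k = 0) ∧ (∀ j ≤ N, p.eval (j : ℂ) = 0) ∧
      p.eval ((N + 1 : ℕ) : ℂ) = v ∧ ∑ k ∈ p.support, ‖p.coeff k‖ * (N : ℝ) ^ k ≤ ε := by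
  -- q = ∏ (z² - j²) is even with zeros at 1, …, N. The polynomial sought is a multiple of z^{2M+1}
  -- q, which is odd and also vanishes at 0.
  set q : ℂ[X] := expand ℂ 2 (∏ j ∈ Finset.Icc 1 N, (X - C ((j : ℂ) ^ 2))) with hq
  have hev : ∀ z : ℂ, q.eval z = ∏ j ∈ Finset.Icc 1 N, (z ^ 2 - (j : ℂ) ^ 2) := fun z => by
    simp [hq, eval_prod]
  have hne : q.eval ((N + 1 : ℕ) : ℂ) ≠ 0 := by
    rw [hev, Finset.prod_ne_zero_iff]
    intro j hj h
    have h2 : (((N + 1) ^ 2 : ℕ) : ℂ) = ((j ^ 2 : ℕ) : ℂ) := by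
      push_cast at h ⊢
      exact sub_eq_zero.mp h
    have h3 := Nat.pow_left_injective two_ne_zero (Nat.cast_injective h2)
    have := (Finset.mem_Icc.mp hj).2
    omega
  have hN : ((N + 1 : ℕ) : ℂ) ≠ 0 := Nat.cast_ne_zero.mpr N.succ_ne_zero
  set a : ℕ → ℂ := fun M => v / (((N + 1 : ℕ) : ℂ) ^ (2 * M + 1) * q.eval ((N + 1 : ℕ) : ℂ))
  set S : ℝ := ∑ k ∈ q.support, ‖q.coeff k‖ * (N : ℝ) ^ k
  -- Normalising the value at N + 1 divides the coefficients by (N + 1)^{2M+1}, while radius N costs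
  -- only N^{2M+1}; a large M makes the sum as small as desired.
  have hlim : Filter.Tendsto (fun M : ℕ => ‖v‖ / ‖q.eval ((N + 1 : ℕ) : ℂ)‖ * S *
      ((N : ℝ) / (N + 1 : ℕ)) ^ (2 * M + 1)) Filter.atTop (nhds 0) := by
    have h1 : (N : ℝ) / (N + 1 : ℕ) < 1 := by
      rw [div_lt_one (by positivity)]
      exact_mod_cast N.lt_succ_self
    have h2 : Filter.Tendsto (fun M : ℕ => 2 * M + 1) Filter.atTop Filter.atTop :=
      Filter.tendsto_atTop_mono (fun M => by simp only [id]; omega) Filter.tendsto_id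
    simpa using ((tendsto_pow_atTop_nhds_zero_of_lt_one (by positivity) h1).comp h2).const_mul
      (‖v‖ / ‖q.eval ((N + 1 : ℕ) : ℂ)‖ * S)
  obtain ⟨M, hM⟩ := (hlim.eventually (ge_mem_nhds hε)).exists
  have hc : ∀ k, (C (a M) * q * X ^ (2 * M + 1)).coeff (k + (2 * M + 1)) = a M * q.coeff k :=
    fun k => by rw [coeff_mul_X_pow, coeff_C_mul]
  refine ⟨C (a M) * q * X ^ (2 * M + 1), fun k hk => ?_, fun j hj => ?_, ?_, le_trans ?_ hM⟩
  · rw [coeff_mul_X_pow']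
    split_ifs with h
    · rw [coeff_C_mul, hq, coeff_expand two_pos, if_neg, mul_zero]
      obtain ⟨i, rfl⟩ := hk
      omega
    · rfl
  · rcases Nat.eq_zero_or_pos j with rfl | hj0
    · simp
    · rw [eval_mul, eval_mul, hev, Finset.prod_eq_zero (Finset.mem_Icc.mpr ⟨hj0, hj⟩) (sub_self _)]
      simp
  · rw [eval_mul, eval_mul, eval_C, eval_pow, eval_X]
    simp only [a]
    field_simp
  · have hsub : (C (a M) * q * X ^ (2 * M + 1)).support ⊆
        q.support.image (· + (2 * M + 1)) := fun k hk => by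
      rw [mem_support_iff, coeff_mul_X_pow'] at hk
      rw [Finset.mem_image]
      split_ifs at hk with h
      · rw [coeff_C_mul] at hk
        exact ⟨k - (2 * M + 1), mem_support_iff.mpr (right_ne_zero_of_mul hk), by omega⟩
      · exact absurd rfl hk
    refine (Finset.sum_le_sum_of_subset_of_nonneg hsub fun k _ _ => by positivity).trans_eq ?_
    rw [Finset.sum_image (by simp), mul_right_comm (‖v‖ / _), Finset.mul_sum]
    refine Finset.sum_congr rfl fun k _ => ?_
    rw [hc, norm_mul, norm_div, norm_mul, norm_pow, Complex.norm_natCast, div_pow]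
    have : ‖q.eval ((N + 1 : ℕ) : ℂ)‖ ≠ 0 := norm_ne_zero_iff.mpr hne
    field_simp
    ring

/-- The summands of an interpolation of `f` by odd polynomials. -/
theorem exists_odd_polynomial_seq (f : ℕ → ℂ) (hf : f 0 = 0) :
    ∃ d : ℕ → ℂ[X], (∀ N k, Even k → (d N).coeff k = 0) ∧
      (∀ N, ∀ j ≤ N, (d N).eval (j : ℂ) = 0) ∧
      (∀ n : ℕ, ∑ i ∈ Finset.range n, (d i).eval (n : ℂ) = f n) ∧
      ∀ N, ∑ k ∈ (d N).support, ‖(d N).coeff k‖ * (N : ℝ) ^ k ≤ (1 / 2) ^ N := by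
  choose P hodd hzero hval hsmall using fun (N : ℕ) (v : ℂ) =>
    exists_odd_polynomial N v (pow_pos (one_half_pos (α := ℝ)) N)
  -- Newton-type interpolation: s N is right at 0, …, N, and the next correction fixes the value at
  -- N + 1 without disturbing the earlier ones.
  let s : ℕ → ℂ[X] := fun n =>
    Nat.rec 0 (fun N p => p + P N (f (N + 1) - p.eval ((N + 1 : ℕ) : ℂ))) n
  set d : ℕ → ℂ[X] := fun N => P N (f (N + 1) - (s N).eval ((N + 1 : ℕ) : ℂ)) with hd
  have hs : ∀ N, s (N + 1) = s N + d N := fun N => rfl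
  have hsum : ∀ N, s N = ∑ i ∈ Finset.range N, d i := fun N => by
    induction N with
    | zero => rfl
    | succ N ih => rw [hs, ih, Finset.sum_range_succ]
  refine ⟨d, fun N => hodd N _, fun N => hzero N _, fun n => ?_, fun N => hsmall N _⟩
  rw [← eval_finsetSum, ← hsum]
  cases n with
  | zero => rw [hsum, hf]; simp
  | succ N => rw [hs, eval_add, hd, hval, add_sub_cancel]

/-- Every function on the natural numbers vanishing at `0` is interpolated by an odd entire
function. -/
theorem exists_odd_hasSum (f : ℕ → ℂ) (hf : f 0 = 0) :
    ∃ u : OddPos → ℂ, ∀ n : ℕ, HasSum (fun k : OddPos => u k * (n : ℂ) ^ (k : ℕ)) (f n) := by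
  obtain ⟨d, hodd, hzero, hval, hsmall⟩ := exists_odd_polynomial_seq f hf
  have hfin : ∀ N n : ℕ, ∀ k ∉ (d N).support, (d N).coeff k * (n : ℂ) ^ k = 0 := fun N n k hk => by
    rw [notMem_support_iff.mp hk, zero_mul]
  have hfin' : ∀ N n : ℕ, ∀ k ∉ (d N).support, ‖(d N).coeff k * (n : ℂ) ^ k‖ = 0 :=
    fun N n k hk => by rw [hfin N n k hk, norm_zero]
  -- Absolute summability over pairs (N, k): from N = n on, the terms with index N sum to at most
  -- (1/2)^N. So the double sum may be taken over N first, giving f n, or over k first, giving a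
  -- power series in n.
  have hsm : ∀ n : ℕ, Summable fun x : ℕ × ℕ => (d x.1).coeff x.2 * (n : ℂ) ^ x.2 := fun n => by
    refine Summable.of_norm ((summable_prod_of_nonneg fun x => norm_nonneg _).mpr
      ⟨fun N => summable_of_ne_finset_zero (hfin' N n), ?_⟩)
    refine Summable.of_norm_bounded_eventually_nat summable_geometric_two ?_
    filter_upwards [Filter.eventually_ge_atTop n] with N hN
    rw [tsum_eq_sum (hfin' N n), Real.norm_of_nonneg (by positivity)]
    refine le_trans (Finset.sum_le_sum fun k _ => ?_) (hsmall N)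
    rw [norm_mul, norm_pow, Complex.norm_natCast]
    gcongr
  have hS : ∀ n : ℕ, HasSum (fun x : ℕ × ℕ => (d x.1).coeff x.2 * (n : ℂ) ^ x.2) (f n) :=
    fun n => by
    have h1 : ∀ N, HasSum (fun k => (d N).coeff k * (n : ℂ) ^ k) ((d N).eval (n : ℂ)) :=
      fun N => by
      rw [eval_eq_sum, Polynomial.sum]
      exact hasSum_sum_of_ne_finset_zero (hfin N n)
    have h2 := (hsm n).hasSum.prod_fiberwise h1
    have h3 : HasSum (fun N => (d N).eval (n : ℂ)) (f n) := by
      rw [← hval n]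
      refine hasSum_sum_of_ne_finset_zero fun N hN => hzero N n ?_
      simpa using hN
    rw [← h2.unique h3]
    exact (hsm n).hasSum
  set U : ℕ → ℂ := fun k => ∑' N, (d N).coeff k
  refine ⟨fun k => U k, fun n => ?_⟩
  have h : HasSum (fun k => U k * (n : ℂ) ^ k) (f n) := by
    have h1 : HasSum (fun x : ℕ × ℕ => (d x.2).coeff x.1 * (n : ℂ) ^ x.1) (f n) :=
      (Equiv.prodComm ℕ ℕ).hasSum_iff.mpr (hS n)
    have h2 : ∀ k, Summable fun N => (d N).coeff k := fun k => by
      have h3 := (hsm 1).comp_injective (Prod.mk_left_injective k)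
      simpa only [Function.comp_def, Nat.cast_one, one_pow, mul_one] using h3
    have h3 : ∀ k, HasSum (fun N => (d N).coeff k * (n : ℂ) ^ k) (U k * (n : ℂ) ^ k) :=
      fun k => (h2 k).hasSum.mul_right _
    exact h1.prod_fiberwise h3
  -- The even coefficients of every correction vanish, so summing over odd k loses nothing.
  refine (Subtype.val_injective.hasSum_iff fun k hk => ?_).mpr h
  have hk' : Even k := by simpa using hk
  simp [U, hodd _ _ hk']

end Interpolation

/-- A nowhere vanishing function on the contents is an exponential of the functions
`p_k(n) = n ^ k - (n - 1) ^ k`. -/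
theorem exists_eq_numExp_boxCasimir {r : ℤ → ℂ} (h0 : ∀ n, r n ≠ 0) (hr : ∀ n, r n = r (1 - n)) :
    ∃ u : OddPos → ℂ, (∀ n : ℕ, Summable fun k : OddPos => u k * (n : ℂ) ^ (k : ℕ)) ∧
      ∀ n : ℤ, r n = numExp u fun k => (boxCasimir k n : ℂ) := by
  -- The interpolated function has increments log r(n + 1), so the p_k-series at n + 1 is a
  -- logarithm of r(n + 1). The nonpositive integers follow by the reflection n ↦ 1 - n.
  obtain ⟨u, hu⟩ := exists_odd_hasSum
    (fun n => ∑ i ∈ Finset.range n, Complex.log (r (i + 1))) (by simp)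
  have hpos : ∀ n : ℕ, r (n + 1) = numExp u fun k => (boxCasimir k (n + 1) : ℂ) := fun n => by
    have h := (hu (n + 1)).sub (hu n)
    rw [Finset.sum_range_succ, add_sub_cancel_left] at h
    rw [numExp, ← Complex.exp_log (h0 (n + 1)), ← h.tsum_eq]
    congr 2
    ext k
    rw [boxCasimir_succ]
    push_cast
    ring
  refine ⟨u, fun n => (hu n).summable, fun n => ?_⟩
  rcases lt_or_ge 0 n with h | h
  · obtain ⟨m, rfl⟩ := Int.eq_succ_of_zero_lt h
    exact hpos m
  · obtain ⟨m, hm⟩ := Int.eq_succ_of_zero_lt (show 0 < 1 - n by omega)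
    have := hpos m
    rw [show ((m : ℤ) + 1) = 1 - n by rw [hm], ← hr n] at this
    rw [this]
    congr 1
    ext k
    rw [boxCasimir_one_sub k.2]

end SpinHurwitz

namespace SpinHurwitz

/-! ### Coefficients of `Q`-Schur polynomials -/

section Coefficients

variable {R : Type*} [CommRing R] [Algebra ℂ R]

theorem coeff_aeval_C_mul_X {σ : Type*} (c : σ → R) (p : MvPolynomial σ ℂ) (m : σ →₀ ℕ) :
    MvPolynomial.coeff m (MvPolynomial.aeval (fun k =>
      (MvPolynomial.C (c k) * MvPolynomial.X k : MvPolynomial σ R)) p) =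
      algebraMap ℂ R (MvPolynomial.coeff m p) * m.prod fun k i => c k ^ i := by
  classical
  induction p using MvPolynomial.induction_on' with
  | monomial s a =>
    have h : (s.prod fun k i => (MvPolynomial.C (c k) * MvPolynomial.X k : MvPolynomial σ R) ^ i) =
        MvPolynomial.monomial s (s.prod fun k i => c k ^ i) := by
      rw [MvPolynomial.monomial_eq, map_finsuppProd, ← Finsupp.prod_mul]
      simp only [mul_pow, map_pow]
    rw [MvPolynomial.aeval_monomial, h, MvPolynomial.algebraMap_apply, MvPolynomial.coeff_C_mul,
      MvPolynomial.coeff_monomial, MvPolynomial.coeff_monomial]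
    split_ifs with hs
    · rw [hs]
    · simp
  | add p q hp hq =>
    rw [map_add, MvPolynomial.coeff_add, hp, hq, MvPolynomial.coeff_add, map_add, add_mul]

theorem coeff_schurQAt_C_mul_X (c : OddPos → R) (l : Multiset ℕ) (m : OddPos →₀ ℕ) :
    MvPowerSeries.coeff m (schurQAt l fun k =>
      (MvPowerSeries.C (c k) * MvPowerSeries.X k : MvPowerSeries OddPos R)) =
      algebraMap ℂ R (MvPolynomial.coeff m (schurQ l)) * m.prod fun k i => c k ^ i := by
  have h : (schurQAt l fun k =>
      (MvPowerSeries.C (c k) * MvPowerSeries.X k : MvPowerSeries OddPos R)) =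
      polyToSeries R OddPos (schurQAt l fun k => MvPolynomial.C (c k) * MvPolynomial.X k) := by
    rw [map_schurQAt]
    simp only [polyToSeries_apply, MvPolynomial.coe_mul, MvPolynomial.coe_C, MvPolynomial.coe_X]
  rw [h, polyToSeries_apply, MvPolynomial.coeff_coe, schurQAt, coeff_aeval_C_mul_X]

theorem weight_eq_of_coeff_schurQ_ne_zero {l : StrictPartition} {m : OddPos →₀ ℕ}
    (h : MvPolynomial.coeff m (schurQ l.parts) ≠ 0) : Finsupp.weight timeWeight m = l.1.1 := by
  have h2 := isWeightedHomogeneous_schurQAt (R := ℂ) (c := MvPolynomial.X)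
    (MvPolynomial.isWeightedHomogeneous_X ℂ timeWeight) l
  rw [schurQAt, MvPolynomial.aeval_X_left_apply] at h2
  exact h2 h

/-- The index of the time `t_1`. -/
def oddOne : OddPos := ⟨1, odd_one⟩

/-- When all times but t_1 vanish only pure powers of t_1 survive, and homogeneity leaves the
exponent |λ| alone. -/
theorem schurQAt_first_time (x : R) (l : StrictPartition) :
    schurQAt l.parts (fun k => if (k : ℕ) = 1 then x else 0) =
      algebraMap ℂ R (MvPolynomial.coeff (Finsupp.single oddOne l.1.1) (schurQ l.parts)) *
        x ^ l.1.1 := by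
  have hk : ∀ k : OddPos, k ≠ oddOne → (if (k : ℕ) = 1 then x else 0) = 0 := fun k hk =>
    if_neg fun h => hk (Subtype.ext h)
  have hsum : schurQAt l.parts (fun k => if (k : ℕ) = 1 then x else 0) =
      ∑ s ∈ (schurQ l.parts).support, algebraMap ℂ R (MvPolynomial.coeff s (schurQ l.parts)) *
        s.prod fun k i => (if (k : ℕ) = 1 then x else 0) ^ i := by
    rw [schurQAt, MvPolynomial.aeval_def, MvPolynomial.eval₂_eq]
    rfl
  rw [hsum, Finset.sum_eq_single (Finsupp.single oddOne l.1.1)]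
  · rw [Finsupp.prod_single_index (h := fun (k : OddPos) i => (if (k : ℕ) = 1 then x else 0) ^ i)
      (pow_zero _), if_pos (show (oddOne : ℕ) = 1 from rfl)]
  · intro s hs hne
    obtain ⟨k, hks, hk1⟩ : ∃ k ∈ s.support, k ≠ oddOne := by
      by_contra! hcon
      obtain ⟨i, rfl⟩ : ∃ i, s = Finsupp.single oddOne i :=
        ⟨s oddOne, Finsupp.eq_single_iff.mpr ⟨fun k hk => by simpa using hcon k hk, rfl⟩⟩
      have h := weight_eq_of_coeff_schurQ_ne_zero (MvPolynomial.mem_support_iff.mp hs)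
      rw [Finsupp.weight_single] at h
      apply hne
      rw [← h]
      exact congrArg _ (mul_one i).symm
    rw [Finsupp.prod, Finset.prod_eq_zero hks, mul_zero]
    rw [hk k hk1, zero_pow (Finsupp.mem_support_iff.mp hks)]
  · intro h
    rw [MvPolynomial.notMem_support_iff.mp h, map_zero, zero_mul]

theorem finsum_strictPartition {M : Type*} [AddCommMonoid M] (n : ℕ) (F : Multiset ℕ → M)
    (hF : ∀ l : StrictPartition, l.1.1 ≠ n → F l.parts = 0) :
    ∑ᶠ l : StrictPartition, F l.parts = ∑ p ∈ Nat.Partition.distincts n, F p.parts := by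
  classical
  rw [← Finset.sum_attach, finsum_eq_sum_of_support_subset
    (s := (Nat.Partition.distincts n).attach.image fun p => (⟨⟨n, p.1⟩, p.2⟩ : StrictPartition))]
  · rw [Finset.sum_image]
    rintro ⟨p, hp⟩ - ⟨q, hq⟩ - h
    simpa using h
  · intro l hl
    obtain ⟨⟨n', p⟩, hp⟩ := l
    obtain rfl : n' = n := by
      by_contra h
      exact hl (hF _ h)
    simpa using hp

/-- The coefficients of a weighted series at `β = (1, 0, 0, …)`. -/
theorem coeff_weightedQSeries_deltaTimes (h : Rˣ) (w : Multiset ℕ → R) (m : OddPos →₀ ℕ) :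
    MvPowerSeries.coeff m (weightedQSeries h (fun l => w l.parts) deltaTimes) =
      ∑ p ∈ Nat.Partition.distincts (Finsupp.weight timeWeight m), w p.parts *
        (algebraMap ℂ R (MvPolynomial.coeff
            (Finsupp.single oddOne (Finsupp.weight timeWeight m)) (schurQ p.parts) *
          MvPolynomial.coeff m (schurQ p.parts)) *
        ((1 / 2 : ℂ) • ((h⁻¹ : Rˣ) : R)) ^ (Finsupp.weight timeWeight m + m.degree)) := by
  -- Both sets of times carry the factor x = 1/(2ħ): the value at β supplies x to the power |λ|, and
  -- the monomial m in t supplies x to the degree of m.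
  set x : R := (1 / 2 : ℂ) • ((h⁻¹ : Rˣ) : R) with hx
  have h1 : ∀ k : OddPos, (1 / 2 : ℂ) • (((h⁻¹ : Rˣ) : R) * deltaTimes k) =
      if (k : ℕ) = 1 then x else 0 := fun k => by
    rw [deltaTimes]
    split_ifs <;> simp [hx]
  have h2 : ∀ k : OddPos, (1 / 2 : ℂ) • (MvPowerSeries.C ((h⁻¹ : Rˣ) : R) * MvPowerSeries.X k :
      MvPowerSeries OddPos R) = MvPowerSeries.C x * MvPowerSeries.X k := fun k => by
    rw [← smul_mul_assoc, hx]
    congr 1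
    ext s
    classical
    simp [MvPowerSeries.coeff_C]
  have h3 : (m.prod fun _ i => x ^ i) = x ^ m.degree := by
    rw [Finsupp.degree_apply, Finsupp.prod, Finset.prod_pow_eq_pow_sum]
  rw [weightedQSeries]
  simp only [h1, h2, schurQAt_first_time]
  refine (finsum_congr fun l : StrictPartition => ?_).trans (finsum_strictPartition _ (fun l => w l *
    (algebraMap ℂ R (MvPolynomial.coeff (Finsupp.single oddOne l.sum) (schurQ l) *
      MvPolynomial.coeff m (schurQ l)) * x ^ (l.sum + m.degree))) fun l hl => ?_) |>.trans
        (Finset.sum_congr rfl fun p _ => ?_)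
  · rw [MvPowerSeries.coeff_C_mul, coeff_schurQAt_C_mul_X, h3, l.1.2.parts_sum, map_mul, pow_add]
    ring
  · by_contra hne
    refine hl (weight_eq_of_coeff_schurQ_ne_zero fun h0 => hne ?_).symm
    rw [h0, mul_zero, map_zero, zero_mul, mul_zero]
  · rw [p.parts_sum]

end Coefficients

/-! ### Odd partitions as exponents -/

section OddPartition

theorem partExponent_apply (l : Multiset ℕ) (k : OddPos) : partExponent l k = l.count (k : ℕ) := rfl

theorem partExponent_zero : partExponent 0 = 0 := by
  ext k
  simp [partExponent_apply]

theorem partExponent_cons (k : OddPos) (l : Multiset ℕ) :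
    partExponent ((k : ℕ) ::ₘ l) = Finsupp.single k 1 + partExponent l := by
  classical
  ext j
  rw [Finsupp.add_apply, partExponent_apply, partExponent_apply, Multiset.count_cons,
    Finsupp.single_apply, add_comm]
  simp only [Subtype.ext_iff, eq_comm]

theorem OddPartition.odd_of_mem (μ : OddPartition) : ∀ k ∈ μ.parts, Odd k := by
  have h := μ.2
  rw [Nat.Partition.odds, Nat.Partition.restricted, Finset.mem_filter] at h
  exact fun k hk => Nat.not_even_iff_odd.mp (h.2 k hk)

/-- Induction on multisets of odd numbers. -/
@[elab_as_elim] theorem odd_multiset_induction {motive : Multiset ℕ → Prop} (h0 : motive 0)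
    (hc : ∀ (k : OddPos) (l : Multiset ℕ), motive l → motive ((k : ℕ) ::ₘ l))
    (l : Multiset ℕ) (hl : ∀ k ∈ l, Odd k) : motive l := by
  induction l using Multiset.induction_on with
  | empty => exact h0
  | cons k l ih =>
    exact hc ⟨k, hl k (Multiset.mem_cons_self k l)⟩ l
      (ih fun j hj => hl j (Multiset.mem_cons_of_mem hj))

theorem weight_partExponent (l : Multiset ℕ) (hl : ∀ k ∈ l, Odd k) :
    Finsupp.weight timeWeight (partExponent l) = l.sum := by
  refine odd_multiset_induction ?_ (fun k l ih => ?_) l hl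
  · simp [partExponent_zero]
  rw [partExponent_cons, map_add, ih, Finsupp.weight_single, Multiset.sum_cons, one_smul]

theorem degree_partExponent (l : Multiset ℕ) (hl : ∀ k ∈ l, Odd k) :
    (partExponent l).degree = Multiset.card l := by
  refine odd_multiset_induction ?_ (fun k l ih => ?_) l hl
  · simp [partExponent_zero]
  rw [partExponent_cons, map_add, ih, Finsupp.degree_single, Multiset.card_cons, add_comm]

theorem partExponent_replicate (n : ℕ) :
    partExponent (Multiset.replicate n 1) = Finsupp.single oddOne n := by
  induction n with
  | zero => simp [partExponent_zero]
  | succ n ih =>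
    rw [Multiset.replicate_succ, show (1 : ℕ) = (oddOne : ℕ) from rfl, partExponent_cons,
      show ((oddOne : OddPos) : ℕ) = 1 from rfl, ih, ← Finsupp.single_add, add_comm]

theorem prod_powerSumVar {R : Type*} [CommRing R] [Algebra ℂ R] (l : Multiset ℕ)
    (hl : ∀ k ∈ l, Odd k) :
    (l.map (powerSumVar R)).prod = MvPowerSeries.monomial (partExponent l)
      (algebraMap ℂ R ((partExponent l).prod fun k i => ((k : ℂ) / 2) ^ i)) := by
  refine odd_multiset_induction ?_ (fun k l ih => ?_) l hl
  · simp [partExponent_zero]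
  have h : powerSumVar R k =
      MvPowerSeries.monomial (Finsupp.single k 1) (algebraMap ℂ R ((k : ℂ) / 2)) := by
    rw [powerSumVar, dif_pos k.2, MvPowerSeries.X]
    ext s
    classical
    rw [Algebra.smul_def, MvPowerSeries.algebraMap_apply, MvPowerSeries.coeff_C_mul,
      MvPowerSeries.coeff_monomial, MvPowerSeries.coeff_monomial, mul_ite, mul_one, mul_zero]
  rw [Multiset.map_cons, Multiset.prod_cons, ih, h, MvPowerSeries.monomial_mul_monomial,
    partExponent_cons, ← map_mul, Finsupp.prod_add_index' (by simp) (by simp [pow_add]),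
    Finsupp.prod_single_index (by simp), pow_one]

theorem partExponent_injective : Function.Injective fun μ : OddPartition => partExponent μ.parts := by
  intro μ ν h
  have hp : μ.parts = ν.parts := by
    ext k
    rcases Nat.even_or_odd k with hk | hk
    · rw [Multiset.count_eq_zero_of_notMem fun h => Nat.not_even_iff_odd.mpr (μ.odd_of_mem k h) hk,
        Multiset.count_eq_zero_of_notMem fun h => Nat.not_even_iff_odd.mpr (ν.odd_of_mem k h) hk]
    · exact DFunLike.congr_fun h (⟨k, hk⟩ : OddPos)
  obtain ⟨⟨n, p⟩, hp⟩ := μ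
  obtain ⟨⟨n', p'⟩, hp'⟩ := ν
  change p.parts = p'.parts at hp
  obtain rfl : n = n' := by rw [← p.parts_sum, ← p'.parts_sum, hp]
  obtain rfl : p = p' := Nat.Partition.ext hp
  rfl

theorem exists_partExponent_eq (m : OddPos →₀ ℕ) : ∃ μ : OddPartition, partExponent μ.parts = m := by
  classical
  set l : Multiset ℕ := (Finsupp.toMultiset m).map Subtype.val with hl
  have hodd : ∀ k ∈ l, Odd k := fun k hk => by
    obtain ⟨j, -, rfl⟩ := Multiset.mem_map.mp hk
    exact j.2
  refine ⟨⟨⟨l.sum, ⟨l, fun h => (hodd _ h).pos, rfl⟩⟩, ?_⟩, ?_⟩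
  · rw [Nat.Partition.odds, Nat.Partition.restricted, Finset.mem_filter]
    exact ⟨Finset.mem_univ _, fun k hk => Nat.not_even_iff_odd.mpr (hodd k hk)⟩
  · ext k
    change l.count (k : ℕ) = m k
    rw [hl, Multiset.count_map_eq_count' _ _ Subtype.val_injective, Finsupp.count_toMultiset]

end OddPartition

end SpinHurwitz

namespace SpinHurwitz

/-! ### Spin Hurwitz numbers -/

section Genus

theorem zFactor_ne_zero {l : Multiset ℕ} (hl : 0 ∉ l) : zFactor l ≠ 0 := by
  rw [zFactor, Finset.prod_ne_zero_iff]
  intro k hk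
  have h : k ≠ 0 := fun h => hl (h ▸ Multiset.mem_toFinset.mp hk)
  positivity

theorem zFactor_replicate_one (n : ℕ) : zFactor (Multiset.replicate n 1) = n ! := by
  rcases Nat.eq_zero_or_pos n with rfl | hn
  · simp [zFactor]
  · rw [zFactor, Multiset.toFinset_replicate, if_neg hn.ne', Finset.prod_singleton,
      Multiset.count_replicate_self, one_pow, one_mul]

theorem sergeevChar_eq (l μ : Multiset ℕ) :
    sergeevChar l μ = ((Real.sqrt 2 : ℝ) : ℂ) ^ (Multiset.card l % 2) * (zFactor μ : ℂ) *
      (MvPolynomial.coeff (partExponent μ) (schurQ l) *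
        (partExponent μ).prod fun k i => ((k : ℂ)⁻¹) ^ i) := by
  rw [sergeevChar, schurQAt, coeff_aeval_C_mul_X]
  rfl

theorem sergeevDim_eq (l : Multiset ℕ) :
    sergeevDim l = ((Real.sqrt 2 : ℝ) : ℂ) ^ (Multiset.card l % 2) * (l.sum ! : ℂ) *
      MvPolynomial.coeff (Finsupp.single oddOne l.sum) (schurQ l) := by
  rw [sergeevDim, sergeevChar_eq, zFactor_replicate_one, partExponent_replicate,
    Finsupp.prod_single_index (h := fun (k : OddPos) i => ((k : ℂ)⁻¹) ^ i) (pow_zero _)]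
  simp [oddOne]

/-- The factors √2^δ of dim λ and of ζ multiply to 2^δ, which cancels against the denominator, as do
|λ|! and z_μ. What is left of 2^{δ+|λ|} is 2^{|λ|}. -/
theorem spinHurwitz_eq (r b : ℕ) {n : ℕ} (μ : n.Partition) :
    spinHurwitz r b μ = ∑ p ∈ Nat.Partition.distincts n,
      MvPolynomial.coeff (Finsupp.single oddOne n) (schurQ p.parts) *
        MvPolynomial.coeff (partExponent μ.parts) (schurQ p.parts) * (1 / 2) ^ n *
        ((partExponent μ.parts).prod fun k i => ((k : ℂ)⁻¹) ^ i) *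
        ((casimir (r + 1) p.parts : ℂ) / ((r + 1)! : ℂ)) ^ b := by
  refine Finset.sum_congr rfl fun p _ => ?_
  congr 1
  have h1 : (n ! : ℂ) ≠ 0 := Nat.cast_ne_zero.mpr n.factorial_ne_zero
  have h2 : (zFactor μ.parts : ℂ) ≠ 0 :=
    Nat.cast_ne_zero.mpr (zFactor_ne_zero fun h => (μ.parts_pos h).false)
  have h3 : ((Real.sqrt 2 : ℝ) : ℂ) ^ (Multiset.card p.parts % 2) *
      ((Real.sqrt 2 : ℝ) : ℂ) ^ (Multiset.card p.parts % 2) =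
        2 ^ (Multiset.card p.parts % 2) := by
    rw [← mul_pow, ← Complex.ofReal_mul, Real.mul_self_sqrt zero_le_two]
    norm_num
  rw [sergeevDim_eq, sergeevChar_eq, p.parts_sum, pow_add, one_div, inv_pow]
  field_simp
  rw [← h3]
  ring

variable {A : Type*} [CommRing A] [Algebra ℂ A]

theorem coeff_oneVarExp (c : A) (b : ℕ) :
    PowerSeries.coeff b (oneVarExp c) = algebraMap ℂ A ((b ! : ℂ)⁻¹) * c ^ b := by
  have hs : PowerSeries.HasSubst (PowerSeries.C c * PowerSeries.X : PowerSeries A) :=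
    PowerSeries.HasSubst.of_constantCoeff_zero' (by simp)
  rw [oneVarExp, formalExp, PowerSeries.coeff_subst' hs, finsum_eq_single _ b]
  · rw [PowerSeries.coeff_exp, mul_pow, ← map_pow, PowerSeries.coeff_C_mul_X_pow, if_pos rfl,
      Algebra.smul_def]
    simp
  · intro d hd
    rw [mul_pow, ← map_pow, PowerSeries.coeff_C_mul_X_pow, if_neg hd.symm, smul_zero]

theorem units_zpow_sub_sub {A : Type*} [CommRing A] (ħ : Aˣ) (r b d n : ℕ) :
    ((ħ ^ ((b * r : ℤ) - d - n) : Aˣ) : A) = (ħ : A) ^ (r * b) * ((ħ⁻¹ : Aˣ) : A) ^ (n + d) := by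
  have h : ((b * r : ℤ) - d - n) = ((r * b : ℕ) : ℤ) + -((n + d : ℕ) : ℤ) := by
    push_cast
    ring
  rw [h, zpow_add, zpow_natCast, zpow_neg, zpow_natCast, ← inv_pow]
  simp

theorem coeff_genusPartitionFunction (r : ℕ) (ħ : Aˣ) (μ : OddPartition) :
    MvPowerSeries.coeff (partExponent μ.parts) (genusPartitionFunction r ħ) =
      PowerSeries.mk (fun b : ℕ =>
        ((ħ ^ ((b * r : ℤ) - Multiset.card μ.parts - μ.1.1) : Aˣ) : A) *
          algebraMap ℂ A (spinHurwitz r b μ.1.2 / (b ! : ℂ))) *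
        algebraMap ℂ (PowerSeries A)
          ((partExponent μ.parts).prod fun k i => ((k : ℂ) / 2) ^ i) := by
  classical
  refine (finsum_eq_single _ μ fun ν hν => ?_).trans ?_
  · rw [MvPowerSeries.coeff_C_mul, prod_powerSumVar _ ν.odd_of_mem, MvPowerSeries.coeff_monomial,
      if_neg fun h => hν (partExponent_injective h.symm), mul_zero]
  · rw [MvPowerSeries.coeff_C_mul, prod_powerSumVar _ μ.odd_of_mem, MvPowerSeries.coeff_monomial,
      if_pos rfl]

/-- The ζ are defined with p_k = k t_k but the partition function is taken at p_k = k t_k / 2; the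
discrepancy is one factor 1/2 for each part of μ. -/
theorem prod_inv_mul_prod_half (m : OddPos →₀ ℕ) :
    (m.prod fun k i => ((k : ℂ)⁻¹) ^ i) * (m.prod fun k i => ((k : ℂ) / 2) ^ i) =
      (1 / 2) ^ m.degree := by
  rw [← Finsupp.prod_mul, Finsupp.degree_apply, ← Finset.prod_pow_eq_pow_sum, Finsupp.prod]
  refine Finset.prod_congr rfl fun k _ => ?_
  have : ((k : ℕ) : ℂ) ≠ 0 := Nat.cast_ne_zero.mpr k.2.pos.ne'
  rw [← mul_pow]
  congr 1
  field_simp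

/-- The partition function of the spin Hurwitz numbers, `ħ` inserted according to the genus, is a
sum over strict partitions. -/
theorem genusPartitionFunction_eq (r : ℕ) (ħ : Aˣ) :
    genusPartitionFunction r ħ =
      weightedQSeries (constUnit Unit ħ) (fun l => cycleWeight r (ħ : A) l.parts) deltaTimes := by
  ext m : 1
  obtain ⟨μ, rfl⟩ := exists_partExponent_eq m
  have hw : Finsupp.weight timeWeight (partExponent μ.parts) = μ.1.1 := by
    rw [weight_partExponent _ μ.odd_of_mem, μ.1.2.parts_sum]
  rw [coeff_genusPartitionFunction]
  refine Eq.trans ?_ (coeff_weightedQSeries_deltaTimes (R := PowerSeries A) (constUnit Unit ħ)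
    (cycleWeight r (ħ : A)) (partExponent μ.parts)).symm
  rw [hw, degree_partExponent _ μ.odd_of_mem]
  have hħ : (((constUnit Unit ħ)⁻¹ : (PowerSeries A)ˣ) : PowerSeries A) =
      PowerSeries.C ((ħ⁻¹ : Aˣ) : A) := rfl
  refine PowerSeries.ext fun b => ?_
  rw [hħ, PowerSeries.algebraMap_apply, PowerSeries.coeff_mul_C, PowerSeries.coeff_mk, map_sum,
    units_zpow_sub_sub, mul_assoc, ← map_mul, spinHurwitz_eq, Finset.sum_div, Finset.sum_mul,
    map_sum, Finset.mul_sum]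
  refine Finset.sum_congr rfl fun p _ => ?_
  -- The scalar is constant in u, with (2ħ)^{-1} to the power |μ| + ℓ(μ). The remaining ħ^{rb} of
  -- ħ^{2g-2} comes from the exponential weight.
  have hx : algebraMap ℂ (PowerSeries A)
      (MvPolynomial.coeff (Finsupp.single oddOne μ.1.1) (schurQ p.parts) *
        MvPolynomial.coeff (partExponent μ.parts) (schurQ p.parts)) *
      ((1 / 2 : ℂ) • PowerSeries.C ((ħ⁻¹ : Aˣ) : A)) ^ (μ.1.1 + Multiset.card μ.parts) =
      PowerSeries.C (algebraMap ℂ A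
        (MvPolynomial.coeff (Finsupp.single oddOne μ.1.1) (schurQ p.parts) *
          MvPolynomial.coeff (partExponent μ.parts) (schurQ p.parts) *
            (1 / 2) ^ (μ.1.1 + Multiset.card μ.parts)) *
        ((ħ⁻¹ : Aˣ) : A) ^ (μ.1.1 + Multiset.card μ.parts)) := by
    rw [smul_pow, Algebra.smul_def, PowerSeries.algebraMap_apply, PowerSeries.algebraMap_apply]
    simp only [map_mul, map_pow, mul_assoc]
  rw [hx, PowerSeries.coeff_mul_C, cycleWeight, coeff_oneVarExp, mul_pow, ← pow_mul, ← map_pow,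
    pow_add (1 / 2 : ℂ), ← degree_partExponent _ μ.odd_of_mem, ← prod_inv_mul_prod_half]
  rw [div_eq_mul_inv (_ * _ ^ b) (b ! : ℂ)]
  simp only [map_mul]
  ring

end Genus

/-- The generating function with numerical parameters is hypergeometric. -/
theorem weightedQSeries_numExp {u : OddPos → ℂ}
    (hu : ∀ n : ℕ, Summable fun k : OddPos => u k * (n : ℂ) ^ (k : ℕ)) (β : OddPos → ℂ) :
    weightedQSeries 1 (fun l => numExp u fun k => (casimir k l.parts : ℂ)) β =
      hypergeometricTau (fun n => numExp u fun k => (boxCasimir k n : ℂ)) β := by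
  simp only [← numWeight_one, ← numBox_one]
  rw [hypergeometricTau]
  simp only [numWeight_eq_contentProduct hu]

end SpinHurwitz
open SpinHurwitz in
theorem mainTheorem4 :
    -- the sums over strict partitions are locally finite
    (∀ m : OddPos →₀ ℕ,
      {l : StrictPartition | MvPolynomial.coeff m (schurQ l.parts) ≠ 0}.Finite) ∧
    -- the generating function with numerical parameters `u` is hypergeometric, and solves `BKP`
    (∀ u : OddPos → ℂ, (∀ n : ℕ, Summable fun k : OddPos => u k * (n : ℂ) ^ (k : ℕ)) →
      (∀ n : ℤ, numExp u (fun k => (boxCasimir k n : ℂ)) =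
        numExp u (fun k => (boxCasimir k (1 - n) : ℂ))) ∧
      ∀ β : OddPos → ℂ,
        weightedQSeries 1 (fun l => numExp u fun k => (casimir k l.parts : ℂ)) β =
          hypergeometricTau (fun n => numExp u fun k => (boxCasimir k n : ℂ)) β ∧
        IsBKP (weightedQSeries 1 (fun l => numExp u fun k => (casimir k l.parts : ℂ)) β)) ∧
    -- conversely, every hypergeometric series with nowhere vanishing `ρ` is of this form
    (∀ ρ : ℤ → ℂ, (∀ n, ρ n ≠ 0) → (∀ n, ρ n = ρ (1 - n)) →
      ∃ u : OddPos → ℂ, (∀ n : ℕ, Summable fun k : OddPos => u k * (n : ℂ) ^ (k : ℕ)) ∧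
        (∀ n : ℤ, ρ n = numExp u fun k => (boxCasimir k n : ℂ)) ∧
        ∀ β : OddPos → ℂ, hypergeometricTau ρ β =
          weightedQSeries 1 (fun l => numExp u fun k => (casimir k l.parts : ℂ)) β) ∧
    -- the deformation `p_k → ħ^{k-1} p_k`, `β → β / ħ`, `t → t / ħ`; numerical `u` and `ħ`
    (∀ u : OddPos → ℂ, (∀ n : ℕ, Summable fun k : OddPos => u k * (n : ℂ) ^ (k : ℕ)) →
      ∀ ħ : ℂˣ, (∀ n : ℤ, numBox u ħ n = numBox u ħ (1 - n)) ∧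
        ∀ β : OddPos → ℂ,
          weightedQSeries ħ (fun l => numWeight u ħ l.parts) β =
            scaledHypergeometricTau ħ (numBox u ħ) β ∧
          IsHbarBKP ħ (weightedQSeries ħ (fun l => numWeight u ħ l.parts) β)) ∧
    -- the same for formal parameters `u` and `ħ` invertible in any commutative `ℂ`-algebra
    (∀ (A : Type*) [CommRing A] [Algebra ℂ A] (ħ : Aˣ),
      (∀ n : ℤ, varBox (ħ : A) n = varBox (ħ : A) (1 - n)) ∧
      ∀ β : OddPos → MvPowerSeries OddPos A,
        weightedQSeries (constUnit OddPos ħ) (fun l => varWeight (ħ : A) l.parts) β =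
          scaledHypergeometricTau (constUnit OddPos ħ) (varBox (ħ : A)) β ∧
        IsHbarBKP (constUnit OddPos ħ)
          (weightedQSeries (constUnit OddPos ħ) (fun l => varWeight (ħ : A) l.parts) β)) ∧
    -- completed `(r+1)`-cycles, with `ħ` inserted according to the genus
    (∀ (A : Type*) [CommRing A] [Algebra ℂ A] (ħ : Aˣ) (r : ℕ), Even r → 0 < r →
      (∀ n : ℤ, cycleBox r (ħ : A) n = cycleBox r (ħ : A) (1 - n)) ∧
      genusPartitionFunction r ħ =
        weightedQSeries (constUnit Unit ħ) (fun l => cycleWeight r (ħ : A) l.parts) deltaTimes ∧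
      genusPartitionFunction r ħ =
        scaledHypergeometricTau (constUnit Unit ħ) (cycleBox r (ħ : A)) deltaTimes ∧
      IsHbarBKP (constUnit Unit ħ) (genusPartitionFunction r ħ)) := by
  refine ⟨finite_coeff_schurQ_ne_zero, fun u hu => ⟨fun n => ?_, fun β => ?_⟩,
    fun ρ h0 hρ => ?_, fun u hu ħ => ⟨numBox_one_sub u ħ, fun β => ?_⟩,
    fun A _ _ ħ => ⟨varBox_one_sub (ħ : A), fun β => ?_⟩,
    fun A _ _ ħ r hr _ => ⟨cycleBox_one_sub hr (ħ : A), genusPartitionFunction_eq r ħ, ?_⟩⟩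
  · simpa only [numBox_one] using numBox_one_sub u 1 n
  · have h := weightedQSeries_numExp hu β
    exact ⟨h, h ▸ isBKP_hypergeometricTau _ _⟩
  · obtain ⟨u, hu, hρu⟩ := exists_eq_numExp_boxCasimir h0 hρ
    refine ⟨u, hu, hρu, fun β => ?_⟩
    rw [weightedQSeries_numExp hu β,
      ← funext hρu]
  · have h := weightedQSeries_eq_scaledHypergeometricTau ħ _ _
      (fun l => numWeight_eq_contentProduct hu (ħ : ℂ) l.parts) β
    exact ⟨h, h ▸ isHbarBKP_scaledHypergeometricTau _ _ _⟩
  · have h := weightedQSeries_eq_scaledHypergeometricTau (constUnit OddPos ħ) _ _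
      (fun l => varWeight_eq_contentProduct (ħ : A) l.parts) β
    exact ⟨h, h ▸ isHbarBKP_scaledHypergeometricTau _ _ _⟩
  · have h := (genusPartitionFunction_eq r ħ).trans
      (weightedQSeries_eq_scaledHypergeometricTau (R := PowerSeries A) (constUnit Unit ħ) _ _
        (fun l => cycleWeight_eq_contentProduct r (ħ : A) l.parts) deltaTimes)
    exact ⟨h, h ▸ isHbarBKP_scaledHypergeometricTau (R := PowerSeries A) (constUnit Unit ħ) _ _⟩
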